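/- Let $M$ be a nonempty topological manifold without boundary of dimension $d \ge 2$ (a Hausdorff space in which every point has an open neighbourhood homeomorphic to an open subset of $\mathbb{R}^d$; neither connectedness nor second countability is required), and let $n \ge 2$. Let $F(M,n) = \{(x_1,\dots,x_n) \in M^n : x_i \neq x_j \text{ for } i \neq j\}$ with the subspace topology, and let $B(M,n) = F(M,n)/\mathfrak{S}_n$ be the quotient space by the action of the symmetric group $\mathfrak{S}_n$ permuting the coordinates, which is a topological manifold of dimension $nd$. Then $B(M,n)$ is orientable if and only if $M$ is orientable and $d$ is even. Here a topological $m$-manifold $X$ is called orientable if it has an atlas of charts onto open subsets of $\mathbb{R}^m$ all of whose transition maps preserve orientation, where a homeomorphism $f$ between open subsets of $\mathbb{R}^m$ preserves orientation if it has local degree $1$ at every point: for every $x$ and $r>0$ such that the closed ball of radius $r$ about $x$ lies in the domain of $f$, the map $S^{m-1} \to \mathbb{R}^m \setminus \{0\}$, $u \mapsto f(x+ru)-f(x)$, induces the same homomorphism on $H_{m-1}(\,\cdot\,;\mathbb{Z})$ as the inclusion $S^{m-1} \hookrightarrow \mathbb{R}^m\setminus\{0\}$. -/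

import Mathlib

open CategoryTheory

noncomputable section

/-! ### Configuration spaces -/

/-- The ordered configuration space `F(M, n)`: the subspace of `M ^ n` of `n`-tuples of pairwise
distinct points, i.e. the complement of the fat diagonal. -/
abbrev OrderedConfig (M : Type*) (n : ℕ) : Type _ :=
  {x : Fin n → M // ∀ i j : Fin n, i ≠ j → x i ≠ x j}

/-- Two ordered configurations are identified if they differ by a permutation of the labels:
these are the orbits of the permutation action of the symmetric group on `F(M, n)`. -/
def configSetoid (M : Type*) (n : ℕ) : Setoid (OrderedConfig M n) where
  r x y := ∃ σ : Equiv.Perm (Fin n), ∀ i : Fin n, y.1 i = x.1 (σ i)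
  iseqv :=
    { refl := fun _ => ⟨Equiv.refl _, fun _ => rfl⟩
      symm := by
        rintro x y ⟨σ, h⟩
        exact ⟨σ.symm, fun i => by rw [h, Equiv.apply_symm_apply]⟩
      trans := by
        rintro x y z ⟨σ, h⟩ ⟨τ, k⟩
        exact ⟨τ.trans σ, fun i => by rw [k, h, Equiv.trans_apply]⟩ }

/-- The unordered configuration space (braid space) `B(M, n) = F(M, n) / 𝔖_n`. -/
def UnorderedConfig (M : Type*) (n : ℕ) : Type _ :=
  Quotient (configSetoid M n)

/-- `B(M, n)` carries the quotient topology of `F(M, n) ⊆ M ^ n`. -/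
instance (M : Type*) [TopologicalSpace M] (n : ℕ) : TopologicalSpace (UnorderedConfig M n) :=
  inferInstanceAs (TopologicalSpace (Quotient (configSetoid M n)))

/-! ### Orientation of topological manifolds -/

/-- The map induced by `g` on the `k`-th singular homology groups with integer coefficients. -/
def homologyMap (k : ℕ) {X Y : Type} [TopologicalSpace X] [TopologicalSpace Y] (g : C(X, Y)) :
    ((AlgebraicTopology.singularHomologyFunctor (ModuleCat.{0} ℤ) k).obj
        (ModuleCat.of ℤ ℤ)).obj (TopCat.of X) ⟶
      ((AlgebraicTopology.singularHomologyFunctor (ModuleCat.{0} ℤ) k).obj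
        (ModuleCat.of ℤ ℤ)).obj (TopCat.of Y) :=
  ((AlgebraicTopology.singularHomologyFunctor (ModuleCat.{0} ℤ) k).obj
    (ModuleCat.of ℤ ℤ)).map (TopCat.ofHom g)

/-- The inclusion of the unit sphere `S^{d-1}` into `ℝ^d ∖ {0}`. -/
def sphereInclusion (d : ℕ) :
    C(Metric.sphere (0 : EuclideanSpace ℝ (Fin d)) 1, {v : EuclideanSpace ℝ (Fin d) // v ≠ 0}) where
  toFun u := ⟨u, ne_zero_of_mem_unit_sphere u⟩

theorem add_smul_mem_closedBall {d : ℕ} (x : EuclideanSpace ℝ (Fin d)) {r : ℝ} (hr : 0 < r)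
    (u : Metric.sphere (0 : EuclideanSpace ℝ (Fin d)) 1) :
    x + r • (u : EuclideanSpace ℝ (Fin d)) ∈ Metric.closedBall x r := by
  simp [norm_smul, abs_of_pos hr]

/-- For a homeomorphism `f` between open subsets of `ℝ^d` and a closed ball of radius `r > 0` about
`x` inside its domain, the map `S^{d-1} → ℝ^d ∖ {0}`, `u ↦ f (x + r u) - f x`. -/
def sphereMap {d : ℕ}
    (f : OpenPartialHomeomorph (EuclideanSpace ℝ (Fin d)) (EuclideanSpace ℝ (Fin d)))
    (x : EuclideanSpace ℝ (Fin d)) (r : ℝ) (hr : 0 < r) (hx : Metric.closedBall x r ⊆ f.source) :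
    C(Metric.sphere (0 : EuclideanSpace ℝ (Fin d)) 1, {v : EuclideanSpace ℝ (Fin d) // v ≠ 0}) where
  toFun u := ⟨f (x + r • (u : EuclideanSpace ℝ (Fin d))) - f x, by
    intro h
    have h1 := f.injOn (hx (add_smul_mem_closedBall x hr u))
      (hx (Metric.mem_closedBall_self hr.le)) (sub_eq_zero.mp h)
    have h2 : r • (u : EuclideanSpace ℝ (Fin d)) = 0 := by simpa using h1
    exact (smul_ne_zero hr.ne' (ne_zero_of_mem_unit_sphere u)) h2⟩
  continuous_toFun := by
    refine Continuous.subtype_mk (Continuous.sub ?_ continuous_const) _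
    exact f.continuousOn.comp_continuous (by fun_prop)
      (fun u => hx (add_smul_mem_closedBall x hr u))

/-- A homeomorphism between open subsets of `ℝ^d` preserves orientation if it has local degree `1`
at each point `x` of its domain: on a small sphere about `x` the map `u ↦ f (x + r u) - f x`
to `ℝ^d ∖ {0}` induces the same map as the inclusion of the sphere on `H_{d-1}( - ; ℤ)`.
(All admissible radii `r` give homotopic maps. For `d = 1` the groups are the unreduced `H_0`, and
the condition says that `f` is increasing near `x`; for `d = 0` it is always true.) -/
def OrientationPreserving {d : ℕ}
    (f : OpenPartialHomeomorph (EuclideanSpace ℝ (Fin d)) (EuclideanSpace ℝ (Fin d))) : Prop :=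
  ∀ (x : EuclideanSpace ℝ (Fin d)) (r : ℝ) (hr : 0 < r) (hx : Metric.closedBall x r ⊆ f.source),
    homologyMap (d - 1) (sphereMap f x r hr hx) = homologyMap (d - 1) (sphereInclusion d)

/-- A topological `d`-manifold `X` is orientable if it has an oriented atlas: a family of charts
(homeomorphisms from open subsets of `X` onto open subsets of `ℝ^d`) that covers `X` and all of
whose transition maps preserve orientation. -/
def IsOrientable (d : ℕ) (X : Type*) [TopologicalSpace X] : Prop :=
  ∃ A : Set (OpenPartialHomeomorph X (EuclideanSpace ℝ (Fin d))),
    (∀ x : X, ∃ φ ∈ A, x ∈ φ.source) ∧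
      ∀ φ ∈ A, ∀ ψ ∈ A, OrientationPreserving (φ.symm.trans ψ)

end

/-! Orientation is measured by the local degree of a local embedding at a point. This integer is
multiplicative under composition (`localDegree_comp`) and over products (`localDegree_pi`), locally
constant (`eventually_localDegree_eq`), equal to 1 or -1 for homeomorphisms between open sets, and
-1 for reflections (`localDegree_reflection`). Hence permuting n blocks of size d by σ has degree
sign(σ)^d (`localDegree_block_perm`); this exponent is the source of the parity condition.

Near a configuration, B(M,n) is a product of disjoint open subsets of M, and charts of M multiply to
charts of B(M,n). A transition map between two such charts is locally a block permutation followed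
by a product of transition maps of M. If M is oriented and d is even, its degree is 1
(`IsOrientedAtlas.exists_config`).

Conversely, an oriented atlas of B(M,n) gives every local parametrization a locally constant sign
(`atlasDegree`). Inside one chart of M let two points v and -v move, with v on the unit sphere,
while the others stay fixed. The sphere is connected because d ≥ 2, so the signs at v = e and v = -e
agree; but these configurations differ by exchanging two labels, which multiplies the sign by
(-1)^d. So d is even (`IsOrientedAtlas.even_of_config`). Next, freeze n - 1 points and let one point
move through a chart of M. The sign tells whether that chart is positive, and the positive charts
orient M (`IsOrientedAtlas.exists_of_config`). Collisions with frozen points do no harm: removing a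
point does not disconnect ℝ^d, and transition degrees are locally constant.

The degree theory rests on singular chains, augmented and with index shifted by one, so that the
punctured d-dimensional space has infinite cyclic homology in index d for every d ≥ 0
(`hasGenerator_punctured`). Barycentric subdivision makes cycles small with respect to a cover, and
Mayer–Vietoris arguments on chains (`DegRel.of_cover`, `DegRel.of_cover_swap`,
`HasGenerator.of_cover`) give the suspension steps. Homotopy invariance is imported through a
comparison with the singular homology functor, and `orientationPreserving_iff` translates the
definition of orientability into local degrees. -/

/-! ### Chains on tuples of points -/

/-- Formal combinations of `k`-tuples of points of `K`. -/
abbrev TupleChain (K : Type*) (k : ℕ) : Type _ := (Fin k → K) →₀ ℤ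

namespace TupleChain

variable {K K' : Type*}

/-- The boundary operator on tuples. -/
noncomputable def bd (k : ℕ) : TupleChain K (k + 1) →ₗ[ℤ] TupleChain K k :=
  ∑ i : Fin (k + 1), (-1 : ℤ) ^ (i : ℕ) • Finsupp.lmapDomain ℤ ℤ (fun v => v ∘ i.succAbove)

theorem bd_single (k : ℕ) (v : Fin (k + 1) → K) :
    bd k (Finsupp.single v 1) =
      ∑ i : Fin (k + 1), (-1 : ℤ) ^ (i : ℕ) • Finsupp.single (v ∘ i.succAbove) 1 := by
  simp [bd, LinearMap.sum_apply]

/-- The cone with apex `b`. -/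
noncomputable def cone (b : K) (k : ℕ) : TupleChain K k →ₗ[ℤ] TupleChain K (k + 1) :=
  Finsupp.lmapDomain ℤ ℤ (fun v => Fin.cons b v)

theorem cone_single (b : K) (k : ℕ) (v : Fin k → K) :
    cone b k (Finsupp.single v 1) = Finsupp.single (Fin.cons b v) 1 := by
  simp [cone]

/-- The map of tuple chains induced by a map of points. -/
noncomputable def map (φ : K → K') (k : ℕ) : TupleChain K k →ₗ[ℤ] TupleChain K' k :=
  Finsupp.lmapDomain ℤ ℤ (fun v => φ ∘ v)

theorem map_single (φ : K → K') (k : ℕ) (v : Fin k → K) (c : ℤ) :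
    map φ k (Finsupp.single v c) = Finsupp.single (φ ∘ v) c := by
  simp [map]

theorem hom_ext {k : ℕ} {N : Type*} [AddCommGroup N] {f g : TupleChain K k →ₗ[ℤ] N}
    (h : ∀ v, f (Finsupp.single v 1) = g (Finsupp.single v 1)) : f = g := by
  refine Finsupp.lhom_ext' fun v => LinearMap.ext_ring ?_
  simpa using h v

theorem bd_cone_zero (b : K) (w : TupleChain K 0) : bd 0 (cone b 0 w) = w := by
  have : (bd 0).comp (cone b 0) = LinearMap.id := by
    refine hom_ext fun v => ?_
    simp only [LinearMap.comp_apply, cone_single, bd_single, LinearMap.id_apply]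
    rw [Fin.sum_univ_succ, Fin.sum_univ_zero, add_zero, Fin.val_zero, pow_zero, one_smul]
    congr 1
  exact LinearMap.congr_fun this w

/-- Omitting the apex gives back `w`; omitting any other vertex shifts its position by one, whence
the minus sign. All later boundary computations on tuples reduce to this formula. -/
theorem bd_cone (b : K) (k : ℕ) (w : TupleChain K (k + 1)) :
    bd (k + 1) (cone b (k + 1) w) = w - cone b k (bd k w) := by
  have : (bd (k + 1)).comp (cone b (k + 1)) = LinearMap.id - (cone b k).comp (bd k) := by
    refine hom_ext fun v => ?_
    simp only [LinearMap.comp_apply, cone_single, bd_single, LinearMap.id_apply,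
      LinearMap.sub_apply, map_sum, map_smul]
    rw [Fin.sum_univ_succ, sub_eq_add_neg, ← Finset.sum_neg_distrib]
    congr 1
    · simp only [Fin.val_zero, pow_zero, one_smul]
      congr 1
    · refine Finset.sum_congr rfl fun i _ => ?_
      rw [Fin.val_succ, pow_succ, mul_neg_one, neg_smul]
      congr 3
      funext j
      refine Fin.cases ?_ (fun j => ?_) j <;> simp
  exact LinearMap.congr_fun this w

/-- Every tuple is the cone from its first entry over its tail, so induction with the cone formula
replaces the usual cancellation in a double sum. -/
theorem bd_bd (k : ℕ) (w : TupleChain K (k + 2)) : bd k (bd (k + 1) w) = 0 := by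
  suffices h : (bd k).comp (bd (k + 1)) = (0 : TupleChain K (k + 2) →ₗ[ℤ] _) from
    LinearMap.congr_fun h w
  clear w
  refine hom_ext fun v => ?_
  simp only [LinearMap.comp_apply, LinearMap.zero_apply]
  induction k with
  | zero =>
    rw [← Fin.cons_self_tail v, ← cone_single, bd_cone, map_sub, bd_cone_zero, sub_self]
  | succ k ih =>
    have h (u : TupleChain K (k + 2)) : bd k (bd (k + 1) u) = 0 := by
      have : (bd k).comp (bd (k + 1)) = (0 : TupleChain K (k + 2) →ₗ[ℤ] _) :=
        hom_ext fun v => by simpa using ih v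
      exact LinearMap.congr_fun this u
    rw [← Fin.cons_self_tail v, ← cone_single, bd_cone, map_sub, bd_cone, h, map_zero, sub_zero,
      sub_self]

theorem map_bd (φ : K → K') (k : ℕ) (w : TupleChain K (k + 1)) :
    map φ k (bd k w) = bd k (map φ (k + 1) w) := by
  suffices h : (map φ k).comp (bd k) = (bd k).comp (map φ (k + 1)) from LinearMap.congr_fun h w
  refine hom_ext fun v => ?_
  simp [bd_single, map_single, Function.comp_assoc]

theorem map_cone (φ : K → K') (b : K) (k : ℕ) (w : TupleChain K k) :
    map φ (k + 1) (cone b k w) = cone (φ b) k (map φ k w) := by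
  suffices h : (map φ (k + 1)).comp (cone b k) = (cone (φ b) k).comp (map φ k) from
    LinearMap.congr_fun h w
  refine hom_ext fun v => ?_
  simp only [LinearMap.comp_apply, cone_single, map_single]
  congr 1
  funext j
  refine Fin.cases ?_ (fun j => ?_) j <;> simp

/-- Barycentric subdivision with respect to a choice `B` of barycentres. -/
noncomputable def sd (B : ∀ k, (Fin (k + 1) → K) → K) : ∀ k, TupleChain K k →ₗ[ℤ] TupleChain K k
  | 0 => LinearMap.id
  | k + 1 => Finsupp.linearCombination ℤ
      (fun v => cone (B k v) k (sd B k (bd k (Finsupp.single v 1))))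

/-- The chain homotopy between the identity and barycentric subdivision. -/
noncomputable def sdHomotopy (B : ∀ k, (Fin (k + 1) → K) → K) :
    ∀ k, TupleChain K k →ₗ[ℤ] TupleChain K (k + 1)
  | 0 => 0
  | k + 1 => Finsupp.linearCombination ℤ
      (fun v => cone (B k v) (k + 1)
        (Finsupp.single v 1 - sdHomotopy B k (bd k (Finsupp.single v 1))))

variable (B : ∀ k, (Fin (k + 1) → K) → K)

theorem sd_single (k : ℕ) (v : Fin (k + 1) → K) : sd B (k + 1) (Finsupp.single v 1) =
    cone (B k v) k (sd B k (bd k (Finsupp.single v 1))) := by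
  simp [sd]

theorem sdHomotopy_single (k : ℕ) (v : Fin (k + 1) → K) :
    sdHomotopy B (k + 1) (Finsupp.single v 1) = cone (B k v) (k + 1)
        (Finsupp.single v 1 - sdHomotopy B k (bd k (Finsupp.single v 1))) := by
  simp [sdHomotopy]

theorem bd_sd (k : ℕ) (w : TupleChain K (k + 1)) : bd k (sd B (k + 1) w) = sd B k (bd k w) := by
  induction k with
  | zero =>
    suffices h : (bd 0).comp (sd B 1) = (sd B 0).comp (bd 0) from LinearMap.congr_fun h w
    refine hom_ext fun v => ?_
    simp only [LinearMap.comp_apply, sd_single, bd_cone_zero]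
  | succ k ih =>
    suffices h : (bd (k + 1)).comp (sd B (k + 2)) = (sd B (k + 1)).comp (bd (k + 1)) from
      LinearMap.congr_fun h w
    refine hom_ext fun v => ?_
    simp only [LinearMap.comp_apply]
    rw [sd_single, bd_cone, ih, bd_bd, map_zero, map_zero, sub_zero]

theorem bd_sdHomotopy_zero (w : TupleChain K 0) :
    bd 0 (sdHomotopy B 0 w) = w - sd B 0 w := by
  simp [sdHomotopy, sd]

theorem bd_sdHomotopy (k : ℕ) (w : TupleChain K (k + 1)) :
    bd (k + 1) (sdHomotopy B (k + 1) w) = w - sd B (k + 1) w - sdHomotopy B k (bd k w) := by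
  suffices h : (bd (k + 1)).comp (sdHomotopy B (k + 1)) =
      LinearMap.id - sd B (k + 1) - (sdHomotopy B k).comp (bd k) from LinearMap.congr_fun h w
  clear w
  induction k with
  | zero =>
    refine hom_ext fun v => ?_
    simp only [LinearMap.comp_apply, LinearMap.sub_apply, LinearMap.id_apply]
    rw [sdHomotopy_single, bd_cone, map_sub, bd_sdHomotopy_zero, sub_sub_cancel, sd_single]
    abel
  | succ k ih =>
    refine hom_ext fun v => ?_
    have ih' := LinearMap.congr_fun ih (bd (k + 1) (Finsupp.single v 1))
    simp only [LinearMap.comp_apply, LinearMap.sub_apply, LinearMap.id_apply, bd_bd,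
      map_zero, sub_zero] at ih' ⊢
    rw [sdHomotopy_single, bd_cone, map_sub, ih', sub_sub_cancel, sd_single]
    abel

variable {B} {B' : ∀ k, (Fin (k + 1) → K') → K'} {φ : K → K'}

/-- Naturality needs only compatibility with the chosen barycentres; it is applied to affine maps
between simplices. -/
theorem map_sd (hφ : ∀ k v, φ (B k v) = B' k (φ ∘ v)) (k : ℕ) (w : TupleChain K k) :
    map φ k (sd B k w) = sd B' k (map φ k w) := by
  induction k with
  | zero => rfl
  | succ k ih =>
    suffices h : (map φ (k + 1)).comp (sd B (k + 1)) = (sd B' (k + 1)).comp (map φ (k + 1)) from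
      LinearMap.congr_fun h w
    refine hom_ext fun v => ?_
    simp only [LinearMap.comp_apply]
    rw [map_single, sd_single, sd_single, map_cone, ih, map_bd, map_single, hφ]

theorem map_sdHomotopy (hφ : ∀ k v, φ (B k v) = B' k (φ ∘ v)) (k : ℕ) (w : TupleChain K k) :
    map φ (k + 1) (sdHomotopy B k w) = sdHomotopy B' k (map φ k w) := by
  induction k with
  | zero => simp [sdHomotopy]
  | succ k ih =>
    suffices h : (map φ (k + 2)).comp (sdHomotopy B (k + 1)) =
        (sdHomotopy B' (k + 1)).comp (map φ (k + 1)) from LinearMap.congr_fun h w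
    refine hom_ext fun v => ?_
    simp only [LinearMap.comp_apply]
    rw [map_single, sdHomotopy_single, sdHomotopy_single, map_cone, map_sub, ih, map_bd,
      map_single, hφ]

/-- The chains all of whose tuples satisfy `P`. -/
noncomputable def sub (k : ℕ) (P : (Fin k → K) → Prop) : Submodule ℤ (TupleChain K k) :=
  Finsupp.supported ℤ ℤ {v | P v}

theorem single_mem_sub {k : ℕ} {P : (Fin k → K) → Prop} {v : Fin k → K} (h : P v) :
    Finsupp.single v 1 ∈ sub k P := Finsupp.single_mem_supported ℤ 1 h

theorem sub_eq_span (k : ℕ) (P : (Fin k → K) → Prop) :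
    sub k P = Submodule.span ℤ ((fun v => Finsupp.single v (1 : ℤ)) '' {v | P v}) :=
  Finsupp.supported_eq_span_single ℤ _

theorem map_mem_of_sub {k : ℕ} {P : (Fin k → K) → Prop} {N : Type*} [AddCommGroup N]
    {S : Submodule ℤ N} (f : TupleChain K k →ₗ[ℤ] N) (h : ∀ v, P v → f (Finsupp.single v 1) ∈ S)
    {w : TupleChain K k} (hw : w ∈ sub k P) : f w ∈ S := by
  have : sub k P ≤ S.comap f := by
    rw [sub_eq_span, Submodule.span_le]
    rintro _ ⟨v, hv, rfl⟩
    exact h v hv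
  exact this hw

end TupleChain

/-! ### Affine simplices -/

/-- The affine map between standard simplices with prescribed vertices. -/
noncomputable def affineSimplex {j k : ℕ} (v : Fin j → stdSimplex ℝ (Fin k)) :
    C(stdSimplex ℝ (Fin j), stdSimplex ℝ (Fin k)) where
  toFun t := ⟨∑ i, t.1 i • (v i).1,
    (convex_stdSimplex ℝ (Fin k)).sum_mem (fun i _ => t.2.1 i) t.2.2 (fun i _ => (v i).2)⟩
  continuous_toFun := by
    refine Continuous.subtype_mk (continuous_finsetSum _ fun i _ => ?_) _
    exact ((continuous_apply i).comp continuous_subtype_val).smul continuous_const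

theorem affineSimplex_coe {j k : ℕ} (v : Fin j → stdSimplex ℝ (Fin k)) (t : stdSimplex ℝ (Fin j)) :
    (affineSimplex v t).1 = ∑ i, t.1 i • (v i).1 := rfl

theorem affineSimplex_affineSimplex {i j k : ℕ} (w : Fin j → stdSimplex ℝ (Fin k))
    (v : Fin i → stdSimplex ℝ (Fin j)) (t : stdSimplex ℝ (Fin i)) :
    affineSimplex w (affineSimplex v t) = affineSimplex (affineSimplex w ∘ v) t := by
  apply Subtype.ext
  simp only [affineSimplex_coe, Function.comp_apply]
  simp only [Finset.sum_apply, Pi.smul_apply, smul_eq_mul, Finset.sum_smul, Finset.smul_sum,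
    mul_smul]
  exact Finset.sum_comm

theorem affineSimplex_comp {i j k : ℕ} (w : Fin j → stdSimplex ℝ (Fin k))
    (v : Fin i → stdSimplex ℝ (Fin j)) :
    (affineSimplex w).comp (affineSimplex v) = affineSimplex (affineSimplex w ∘ v) :=
  ContinuousMap.ext (affineSimplex_affineSimplex w v)

theorem affineSimplex_vertex {j k : ℕ} (v : Fin j → stdSimplex ℝ (Fin k)) (i : Fin j) :
    affineSimplex v (stdSimplex.vertex i) = v i := by
  apply Subtype.ext
  rw [affineSimplex_coe]
  simp [Pi.single_apply]

theorem affineSimplex_vertex_comp {j k : ℕ} (f : Fin j → Fin k) :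
    ⇑(affineSimplex fun i => stdSimplex.vertex (f i)) = stdSimplex.map f := by
  classical
  funext t
  apply Subtype.ext
  rw [affineSimplex_coe]
  funext x
  refine Eq.trans ?_ (FunOnFinite.linearMap_apply_apply ℝ ℝ f t.1 x).symm
  simp [Pi.single_apply, Finset.sum_filter, eq_comm]

theorem affineSimplex_id (k : ℕ) :
    affineSimplex (fun i : Fin k => stdSimplex.vertex i) = ContinuousMap.id _ := by
  ext1 t
  rw [affineSimplex_vertex_comp (fun i => i)]
  exact stdSimplex.map_id_apply t

theorem dist_affineSimplex_le {j k : ℕ} {v : Fin j → stdSimplex ℝ (Fin k)}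
    {c : stdSimplex ℝ (Fin k)} {R : ℝ} (h : ∀ i, dist c (v i) ≤ R) (t : stdSimplex ℝ (Fin j)) :
    dist c (affineSimplex v t) ≤ R := by
  have := (convex_closedBall (c : Fin k → ℝ) R).sum_mem (fun i (_ : i ∈ Finset.univ) => t.2.1 i)
    t.2.2 (z := fun i => (v i).1) (fun i _ => by
      rw [Metric.mem_closedBall, dist_comm]; exact h i)
  rw [Metric.mem_closedBall, dist_comm] at this
  exact this

/-- The barycentre of a tuple of points of a simplex. -/
noncomputable def tupleBarycenter {k : ℕ} (j : ℕ) (v : Fin (j + 1) → stdSimplex ℝ (Fin k)) :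
    stdSimplex ℝ (Fin k) := affineSimplex v stdSimplex.barycenter

theorem affineSimplex_tupleBarycenter {j k l : ℕ} (w : Fin k → stdSimplex ℝ (Fin l))
    (v : Fin (j + 1) → stdSimplex ℝ (Fin k)) :
    affineSimplex w (tupleBarycenter j v) = tupleBarycenter j (affineSimplex w ∘ v) :=
  affineSimplex_affineSimplex _ _ _

/-- The difference of the barycentre and a vertex is the mean of `j + 1` differences of vertices,
one of which vanishes. -/
theorem dist_tupleBarycenter_le {j k : ℕ} {v : Fin (j + 1) → stdSimplex ℝ (Fin k)} {D : ℝ}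
    (h : ∀ i l, dist (v i) (v l) ≤ D) (i : Fin (j + 1)) :
    dist (tupleBarycenter j v) (v i) ≤ (1 - ((j : ℝ) + 1)⁻¹) * D := by
  have hb (l : Fin (j + 1)) :
      (stdSimplex.barycenter : stdSimplex ℝ (Fin (j + 1))).1 l = ((j : ℝ) + 1)⁻¹ := by
    refine (stdSimplex.barycenter_apply (𝕜 := ℝ) l).trans ?_
    simp
  have key : (tupleBarycenter j v).1 - (v i).1 =
      ∑ l, ((j : ℝ) + 1)⁻¹ • ((v l).1 - (v i).1) := by
    rw [tupleBarycenter, affineSimplex_coe]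
    simp only [hb, smul_sub, Finset.sum_sub_distrib, Finset.sum_const, Finset.card_univ,
      Fintype.card_fin]
    congr 1
    rw [← Nat.cast_smul_eq_nsmul ℝ, smul_smul]
    push_cast
    rw [mul_inv_cancel₀ (by positivity), one_smul]
  rw [Subtype.dist_eq, dist_eq_norm, key]
  refine (norm_sum_le _ _).trans ?_
  rw [← Finset.add_sum_erase _ _ (Finset.mem_univ i)]
  simp only [sub_self, smul_zero, norm_zero, zero_add]
  refine (Finset.sum_le_card_nsmul _ _ (((j : ℝ) + 1)⁻¹ * D) fun l _ => ?_).trans ?_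
  · rw [norm_smul, Real.norm_of_nonneg (by positivity)]
    gcongr
    rw [← dist_eq_norm]
    exact h l i
  · rw [Finset.card_erase_of_mem (Finset.mem_univ i), Finset.card_univ, Fintype.card_fin,
      Nat.add_sub_cancel, nsmul_eq_mul, ← mul_assoc]
    apply le_of_eq
    congr 1
    field_simp
    ring

open TupleChain in
-- Subdivision shrinks diameters by a factor that is uniform over all faces, since `N` bounds the
-- number of vertices. The second conjunct is needed for the induction: the new apex is close to all
-- vertices of `v`, hence by convexity to every point of the simplex they span.
theorem TupleChain.sd_single_mem {k N : ℕ} {D : ℝ} (j : ℕ) (hj : j ≤ N) (hN : 0 < N)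
    (v : Fin j → stdSimplex ℝ (Fin k)) (h : ∀ i l, dist (v i) (v l) ≤ D) :
    sd (fun j => tupleBarycenter j) j (Finsupp.single v 1) ∈
      sub j (fun w => (∀ i l, dist (w i) (w l) ≤ (1 - (N : ℝ)⁻¹) * D) ∧
        ∀ i, w i ∈ Set.range (affineSimplex v)) := by
  induction j with
  | zero =>
    exact single_mem_sub ⟨fun i => i.elim0, fun i => i.elim0⟩
  | succ j ih =>
    have hD : 0 ≤ D := by simpa using h 0 0
    have hr : 1 - ((j : ℝ) + 1)⁻¹ ≤ 1 - (N : ℝ)⁻¹ := by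
      have : ((j : ℝ) + 1) ≤ N := by exact_mod_cast hj
      gcongr
    rw [sd_single, bd_single, map_sum, map_sum]
    refine Submodule.sum_mem _ fun i _ => ?_
    rw [map_smul, map_smul]
    refine Submodule.smul_mem _ _ ?_
    refine map_mem_of_sub (cone (tupleBarycenter j v) j) ?_
      (ih (by omega) (v ∘ i.succAbove) (fun a b => h _ _))
    rintro w ⟨hw1, hw2⟩
    have hw3 : ∀ a, w a ∈ Set.range (affineSimplex v) := by
      intro a
      obtain ⟨t, ht⟩ := hw2 a
      refine ⟨affineSimplex (fun a => stdSimplex.vertex (i.succAbove a)) t, ?_⟩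
      rw [affineSimplex_affineSimplex, ← ht]
      congr 2
      funext a
      exact affineSimplex_vertex _ _
    have hb : ∀ a, dist (tupleBarycenter j v) (w a) ≤ (1 - (N : ℝ)⁻¹) * D := by
      intro a
      obtain ⟨t, ht⟩ := hw3 a
      rw [← ht]
      exact dist_affineSimplex_le
        (fun l => (dist_tupleBarycenter_le h l).trans (by gcongr)) t
    rw [cone_single]
    refine single_mem_sub ⟨fun a b => ?_, fun a => ?_⟩
    · have hnn : 0 ≤ (1 - (N : ℝ)⁻¹) * D := by
        refine mul_nonneg (sub_nonneg.2 (inv_le_one_of_one_le₀ ?_)) hD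
        exact_mod_cast hN
      refine Fin.cases ?_ (fun a => ?_) a <;> refine Fin.cases ?_ (fun b => ?_) b
      · simpa using hnn
      · simpa using hb b
      · simpa [dist_comm] using hb a
      · simpa using hw1 a b
    · refine Fin.cases ?_ (fun a => ?_) a
      · exact ⟨_, rfl⟩
      · simpa using hw3 a

open TupleChain in
theorem TupleChain.exists_iterate_sd_mem {k : ℕ} (j : ℕ) {ε : ℝ} (hε : 0 < ε)
    (v : Fin j → stdSimplex ℝ (Fin k)) :
    ∃ n : ℕ, (sd (fun j => tupleBarycenter j) j)^[n] (Finsupp.single v 1) ∈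
      sub j (fun w => ∀ i l, dist (w i) (w l) < ε) := by
  -- The bound `j + 1` instead of `j` keeps the ratio below 1 when `j = 0`.
  have hN : 0 < j + 1 := Nat.succ_pos j
  set r : ℝ := 1 - ((j + 1 : ℕ) : ℝ)⁻¹ with hr
  have hr0 : 0 ≤ r := by
    rw [hr]
    refine sub_nonneg.2 (inv_le_one_of_one_le₀ ?_)
    exact_mod_cast hN
  have hr1 : r < 1 := by
    rw [hr]
    have : (0 : ℝ) < ((j + 1 : ℕ) : ℝ)⁻¹ := by positivity
    linarith
  obtain ⟨D, hD⟩ : ∃ D, ∀ i l, dist (v i) (v l) ≤ D := by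
    obtain ⟨D, hD⟩ := (Set.finite_range fun p : Fin j × Fin j => dist (v p.1) (v p.2)).bddAbove
    exact ⟨D, fun i l => hD ⟨(i, l), rfl⟩⟩
  have key (n : ℕ) : (sd (fun j => tupleBarycenter j) j)^[n] (Finsupp.single v 1) ∈
      sub j (fun w => ∀ i l, dist (w i) (w l) ≤ r ^ n * D) := by
    induction n with
    | zero => exact single_mem_sub (by simpa using hD)
    | succ n ih =>
      rw [Function.iterate_succ_apply']
      refine map_mem_of_sub _ (fun w hw => ?_) ih
      have := TupleChain.sd_single_mem j (Nat.le_succ j) hN w hw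
      refine Finsupp.supported_mono ?_ this
      rintro u ⟨hu, -⟩ i l
      rw [pow_succ', mul_assoc]
      exact hu i l
  have ht : Filter.Tendsto (fun n => r ^ n * D) Filter.atTop (nhds 0) := by
    simpa using (tendsto_pow_atTop_nhds_zero_of_lt_one hr0 hr1).mul_const D
  obtain ⟨n, hn⟩ := (ht.eventually (gt_mem_nhds hε)).exists
  exact ⟨n, Finsupp.supported_mono (fun u hu i l => (hu i l).trans_lt hn) (key n)⟩

/-! ### Augmented singular chains -/

/-- Augmented singular chains. The index is one more than the dimension of the simplices, so that
the chains of index `0` are the integers and the boundary of index `0` is the augmentation. -/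
abbrev SingChain (X : Type*) [TopologicalSpace X] (k : ℕ) : Type _ :=
  C(stdSimplex ℝ (Fin k), X) →₀ ℤ

namespace SingChain

variable {X Y Z : Type*} [TopologicalSpace X] [TopologicalSpace Y] [TopologicalSpace Z]

theorem hom_ext {k : ℕ} {N : Type*} [AddCommMonoid N] [Module ℤ N] {f g : SingChain X k →ₗ[ℤ] N}
    (h : ∀ v, f (Finsupp.single v 1) = g (Finsupp.single v 1)) : f = g := by
  refine Finsupp.lhom_ext' fun v => LinearMap.ext_ring ?_
  simpa using h v

/-- The boundary operator. -/
noncomputable def bd (k : ℕ) : SingChain X (k + 1) →ₗ[ℤ] SingChain X k :=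
  ∑ i : Fin (k + 1), (-1 : ℤ) ^ (i : ℕ) • Finsupp.lmapDomain ℤ ℤ
    (fun σ => σ.comp (affineSimplex fun j => stdSimplex.vertex (i.succAbove j)))

theorem bd_single (k : ℕ) (σ : C(stdSimplex ℝ (Fin (k + 1)), X)) :
    bd k (Finsupp.single σ 1) = ∑ i : Fin (k + 1), (-1 : ℤ) ^ (i : ℕ) •
      Finsupp.single (σ.comp (affineSimplex fun j => stdSimplex.vertex (i.succAbove j))) 1 := by
  simp [bd, LinearMap.sum_apply]

/-- The chain map induced by a continuous map. -/
noncomputable def map (f : C(X, Y)) (k : ℕ) : SingChain X k →ₗ[ℤ] SingChain Y k :=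
  Finsupp.lmapDomain ℤ ℤ (fun σ => f.comp σ)

theorem map_single (f : C(X, Y)) (k : ℕ) (σ : C(stdSimplex ℝ (Fin k), X)) (c : ℤ) :
    map f k (Finsupp.single σ c) = Finsupp.single (f.comp σ) c := by
  simp [map]

theorem map_map (g : C(Y, Z)) (f : C(X, Y)) (k : ℕ) (z : SingChain X k) :
    map g k (map f k z) = map (g.comp f) k z := by
  suffices h : (map g k).comp (map f k) = map (g.comp f) k from LinearMap.congr_fun h z
  refine hom_ext fun σ => ?_
  simp [map_single, ContinuousMap.comp_assoc]

theorem map_id (k : ℕ) (z : SingChain X k) : map (ContinuousMap.id X) k z = z := by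
  suffices h : map (ContinuousMap.id X) k = LinearMap.id from LinearMap.congr_fun h z
  refine hom_ext fun σ => ?_
  simp [map_single]

theorem map_bd (f : C(X, Y)) (k : ℕ) (z : SingChain X (k + 1)) :
    map f k (bd k z) = bd k (map f (k + 1) z) := by
  suffices h : (map f k).comp (bd k) = (bd k).comp (map f (k + 1)) from LinearMap.congr_fun h z
  refine hom_ext fun v => ?_
  simp [bd_single, map_single, ContinuousMap.comp_assoc]

/-- The singular chain obtained from affine simplices in the domain of a singular simplex. -/
noncomputable def ofAffine {k : ℕ} (σ : C(stdSimplex ℝ (Fin k), X)) (j : ℕ) :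
    TupleChain (stdSimplex ℝ (Fin k)) j →ₗ[ℤ] SingChain X j :=
  Finsupp.lmapDomain ℤ ℤ (fun v => σ.comp (affineSimplex v))

theorem ofAffine_single {k : ℕ} (σ : C(stdSimplex ℝ (Fin k), X)) (j : ℕ)
    (v : Fin j → stdSimplex ℝ (Fin k)) :
    ofAffine σ j (Finsupp.single v 1) = Finsupp.single (σ.comp (affineSimplex v)) 1 := by
  simp [ofAffine]

theorem ofAffine_bd {k : ℕ} (σ : C(stdSimplex ℝ (Fin k), X)) (j : ℕ)
    (w : TupleChain (stdSimplex ℝ (Fin k)) (j + 1)) :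
    ofAffine σ j (TupleChain.bd j w) = bd j (ofAffine σ (j + 1) w) := by
  suffices h : (ofAffine σ j).comp (TupleChain.bd j) = (bd j).comp (ofAffine σ (j + 1)) from
    LinearMap.congr_fun h w
  refine TupleChain.hom_ext fun v => ?_
  simp only [LinearMap.comp_apply, TupleChain.bd_single, ofAffine_single, bd_single, map_sum,
    map_smul, ContinuousMap.comp_assoc, affineSimplex_comp]
  refine Finset.sum_congr rfl fun i _ => ?_
  congr 4
  funext l
  exact (affineSimplex_vertex v (i.succAbove l)).symm

/-- The tuple of all vertices of the standard simplex. -/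
noncomputable def vertices (k : ℕ) : TupleChain (stdSimplex ℝ (Fin k)) k :=
  Finsupp.single (fun i => stdSimplex.vertex i) 1

/-- Every singular simplex is the image of the universal tuple of vertices. Identities between tuple
chains are carried to singular chains by rewriting with this backwards. -/
theorem ofAffine_vertices {k : ℕ} (σ : C(stdSimplex ℝ (Fin k), X)) :
    ofAffine σ k (vertices k) = Finsupp.single σ 1 := by
  rw [vertices, ofAffine_single, affineSimplex_id, ContinuousMap.comp_id]

theorem ofAffine_comp {k l : ℕ} (σ : C(stdSimplex ℝ (Fin k), X))
    (v : Fin l → stdSimplex ℝ (Fin k)) (j : ℕ) (w : TupleChain (stdSimplex ℝ (Fin l)) j) :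
    ofAffine (σ.comp (affineSimplex v)) j w =
      ofAffine σ j (TupleChain.map (affineSimplex v) j w) := by
  suffices h : ofAffine (σ.comp (affineSimplex v)) j =
      (ofAffine σ j).comp (TupleChain.map (affineSimplex v) j) from LinearMap.congr_fun h w
  refine TupleChain.hom_ext fun u => ?_
  simp [ofAffine_single, TupleChain.map_single, ContinuousMap.comp_assoc, affineSimplex_comp]

theorem map_vertices {k l : ℕ} (v : Fin l → stdSimplex ℝ (Fin k)) :
    TupleChain.map (affineSimplex v) l (vertices l) = Finsupp.single v 1 := by
  rw [vertices, TupleChain.map_single]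
  congr 1
  funext i
  exact affineSimplex_vertex v i

theorem bd_bd (k : ℕ) (z : SingChain X (k + 2)) : bd k (bd (k + 1) z) = 0 := by
  suffices h : (bd k).comp (bd (k + 1)) = (0 : SingChain X (k + 2) →ₗ[ℤ] _) from
    LinearMap.congr_fun h z
  refine hom_ext fun σ => ?_
  simp only [LinearMap.comp_apply, LinearMap.zero_apply]
  rw [← ofAffine_vertices, ← ofAffine_bd, ← ofAffine_bd, TupleChain.bd_bd, _root_.map_zero]

/-- Barycentric subdivision of singular chains. -/
noncomputable def sd (k : ℕ) : SingChain X k →ₗ[ℤ] SingChain X k :=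
  Finsupp.linearCombination ℤ
    (fun σ => ofAffine σ k (TupleChain.sd (fun j => tupleBarycenter j) k (vertices k)))

/-- The chain homotopy between the identity and barycentric subdivision. -/
noncomputable def sdHomotopy (k : ℕ) : SingChain X k →ₗ[ℤ] SingChain X (k + 1) :=
  Finsupp.linearCombination ℤ
    (fun σ => ofAffine σ (k + 1)
      (TupleChain.sdHomotopy (fun j => tupleBarycenter j) k (vertices k)))

theorem sd_single (k : ℕ) (σ : C(stdSimplex ℝ (Fin k), X)) : sd k (Finsupp.single σ 1) =
    ofAffine σ k (TupleChain.sd (fun j => tupleBarycenter j) k (vertices k)) := by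
  simp [sd]

theorem sdHomotopy_single (k : ℕ) (σ : C(stdSimplex ℝ (Fin k), X)) :
    sdHomotopy k (Finsupp.single σ 1) = ofAffine σ (k + 1)
      (TupleChain.sdHomotopy (fun j => tupleBarycenter j) k (vertices k)) := by
  simp [sdHomotopy]

theorem sd_ofAffine {k : ℕ} (σ : C(stdSimplex ℝ (Fin k), X)) (j : ℕ)
    (w : TupleChain (stdSimplex ℝ (Fin k)) j) : sd j (ofAffine σ j w) =
      ofAffine σ j (TupleChain.sd (fun j => tupleBarycenter j) j w) := by
  suffices h : (sd j).comp (ofAffine σ j) =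
      (ofAffine σ j).comp (TupleChain.sd (fun j => tupleBarycenter j) j) from
    LinearMap.congr_fun h w
  refine TupleChain.hom_ext fun v => ?_
  simp only [LinearMap.comp_apply]
  rw [ofAffine_single, sd_single, ofAffine_comp, TupleChain.map_sd
    (fun _ _ => affineSimplex_tupleBarycenter _ _), map_vertices]

theorem sdHomotopy_ofAffine {k : ℕ} (σ : C(stdSimplex ℝ (Fin k), X)) (j : ℕ)
    (w : TupleChain (stdSimplex ℝ (Fin k)) j) : sdHomotopy j (ofAffine σ j w) =
      ofAffine σ (j + 1) (TupleChain.sdHomotopy (fun j => tupleBarycenter j) j w) := by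
  suffices h : (sdHomotopy j).comp (ofAffine σ j) =
      (ofAffine σ (j + 1)).comp (TupleChain.sdHomotopy (fun j => tupleBarycenter j) j) from
    LinearMap.congr_fun h w
  refine TupleChain.hom_ext fun v => ?_
  simp only [LinearMap.comp_apply]
  rw [ofAffine_single, sdHomotopy_single, ofAffine_comp, TupleChain.map_sdHomotopy
    (fun _ _ => affineSimplex_tupleBarycenter _ _), map_vertices]

theorem bd_sd (k : ℕ) (z : SingChain X (k + 1)) : bd k (sd (k + 1) z) = sd k (bd k z) := by
  suffices h : (bd k).comp (sd (k + 1)) = (sd k : SingChain X k →ₗ[ℤ] _).comp (bd k) from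
    LinearMap.congr_fun h z
  refine hom_ext fun σ => ?_
  simp only [LinearMap.comp_apply]
  rw [← ofAffine_vertices, sd_ofAffine, ← ofAffine_bd, ← ofAffine_bd, sd_ofAffine,
    TupleChain.bd_sd]

/-- Cycles of the augmented singular complex. -/
def IsCycle : ∀ {k : ℕ}, SingChain X k → Prop
  | 0, _ => True
  | k + 1, z => bd k z = 0

/-- On cycles the term with the homotopy of the boundary drops out, so that index 0 needs no
separate statement. -/
theorem bd_sdHomotopy {k : ℕ} {z : SingChain X k} (hz : IsCycle z) :
    bd k (sdHomotopy k z) = z - sd k z := by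
  cases k with
  | zero =>
    suffices h : (bd 0).comp (sdHomotopy 0) = LinearMap.id - (sd 0 : SingChain X 0 →ₗ[ℤ] _) from
      LinearMap.congr_fun h z
    refine hom_ext fun σ => ?_
    simp only [LinearMap.comp_apply, LinearMap.sub_apply, LinearMap.id_apply]
    rw [← ofAffine_vertices, sd_ofAffine, sdHomotopy_ofAffine, ← ofAffine_bd,
      TupleChain.bd_sdHomotopy_zero, map_sub]
  | succ k =>
    have h : (bd (k + 1)).comp (sdHomotopy (k + 1)) = LinearMap.id -
        (sd (k + 1) : SingChain X (k + 1) →ₗ[ℤ] _) - (sdHomotopy k).comp (bd k) := by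
      refine hom_ext fun σ => ?_
      simp only [LinearMap.comp_apply, LinearMap.sub_apply, LinearMap.id_apply]
      rw [← ofAffine_vertices, sd_ofAffine, sdHomotopy_ofAffine, ← ofAffine_bd, ← ofAffine_bd,
        sdHomotopy_ofAffine, TupleChain.bd_sdHomotopy, map_sub, map_sub]
    have := LinearMap.congr_fun h z
    simp only [LinearMap.comp_apply, LinearMap.sub_apply, LinearMap.id_apply] at this
    rw [this, show bd k z = 0 from hz, _root_.map_zero, sub_zero]

theorem isCycle_bd {k : ℕ} (z : SingChain X (k + 1)) : IsCycle (bd k z) := by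
  cases k with
  | zero => trivial
  | succ k => exact bd_bd k z

theorem IsCycle.map {k : ℕ} {z : SingChain X k} (hz : IsCycle z) (f : C(X, Y)) :
    IsCycle (map f k z) := by
  cases k with
  | zero => trivial
  | succ k =>
    change bd k (SingChain.map f (k + 1) z) = 0
    rw [← map_bd, show bd k z = 0 from hz, _root_.map_zero]

theorem IsCycle.sd {k : ℕ} {z : SingChain X k} (hz : IsCycle z) : IsCycle (sd k z) := by
  cases k with
  | zero => trivial
  | succ k =>
    change bd k (SingChain.sd (k + 1) z) = 0
    rw [bd_sd, show bd k z = 0 from hz, _root_.map_zero]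

/-- Chains supported in a subset. -/
noncomputable def supp (U : Set X) (k : ℕ) : Submodule ℤ (SingChain X k) :=
  Finsupp.supported ℤ ℤ {σ | Set.range σ ⊆ U}

theorem single_mem_supp {U : Set X} {k : ℕ} {σ : C(stdSimplex ℝ (Fin k), X)}
    (h : Set.range σ ⊆ U) : Finsupp.single σ 1 ∈ supp U k :=
  Finsupp.single_mem_supported ℤ 1 h

theorem map_mem_of_supp {U : Set X} {k : ℕ} {N : Type*} [AddCommGroup N]
    {S : Submodule ℤ N} (f : SingChain X k →ₗ[ℤ] N)
    (h : ∀ σ : C(stdSimplex ℝ (Fin k), X), Set.range σ ⊆ U → f (Finsupp.single σ 1) ∈ S)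
    {w : SingChain X k} (hw : w ∈ supp U k) : f w ∈ S := by
  have : supp U k ≤ S.comap f := by
    rw [supp, Finsupp.supported_eq_span_single, Submodule.span_le]
    rintro _ ⟨v, hv, rfl⟩
    exact h v hv
  exact this hw

theorem supp_mono {U V : Set X} (h : U ⊆ V) (k : ℕ) : supp U k ≤ supp V k :=
  Finsupp.supported_mono fun _ hσ => hσ.trans h

theorem supp_univ (k : ℕ) : supp (Set.univ : Set X) k = ⊤ := by
  simp [supp, Finsupp.supported_univ]

theorem mem_supp_inter {U V : Set X} {k : ℕ} {z : SingChain X k} (hU : z ∈ supp U k)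
    (hV : z ∈ supp V k) : z ∈ supp (U ∩ V) k := by
  rw [supp, Finsupp.mem_supported] at *
  exact fun σ hσ => Set.subset_inter (hU hσ) (hV hσ)

theorem bd_mem_supp {U : Set X} {k : ℕ} {z : SingChain X (k + 1)} (hz : z ∈ supp U (k + 1)) :
    bd k z ∈ supp U k := by
  refine map_mem_of_supp _ (fun σ hσ => ?_) hz
  rw [bd_single]
  refine Submodule.sum_mem _ fun i _ => Submodule.smul_mem _ _ (single_mem_supp ?_)
  exact (Set.range_comp_subset_range _ σ).trans hσ

theorem ofAffine_mem_supp {U : Set X} {k : ℕ} {σ : C(stdSimplex ℝ (Fin k), X)}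
    (hσ : Set.range σ ⊆ U) (j : ℕ) (w : TupleChain (stdSimplex ℝ (Fin k)) j) :
    ofAffine σ j w ∈ supp U j := by
  refine TupleChain.map_mem_of_sub (P := fun _ => True) (ofAffine σ j) (fun v _ => ?_)
    (by simp [TupleChain.sub, Finsupp.supported_univ])
  rw [ofAffine_single]
  exact single_mem_supp ((Set.range_comp_subset_range _ σ).trans hσ)

theorem sd_mem_supp {U : Set X} {k : ℕ} {z : SingChain X k} (hz : z ∈ supp U k) :
    sd k z ∈ supp U k := by
  refine map_mem_of_supp _ (fun σ hσ => ?_) hz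
  rw [sd_single]
  exact ofAffine_mem_supp hσ _ _

theorem sdHomotopy_mem_supp {U : Set X} {k : ℕ} {z : SingChain X k} (hz : z ∈ supp U k) :
    sdHomotopy k z ∈ supp U (k + 1) := by
  refine map_mem_of_supp _ (fun σ hσ => ?_) hz
  rw [sdHomotopy_single]
  exact ofAffine_mem_supp hσ _ _

theorem map_mem_supp {U : Set X} {V : Set Y} {f : C(X, Y)} (hf : Set.MapsTo f U V) {k : ℕ}
    {z : SingChain X k} (hz : z ∈ supp U k) : map f k z ∈ supp V k := by
  refine map_mem_of_supp _ (fun σ hσ => ?_) hz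
  rw [map_single]
  refine single_mem_supp ?_
  rintro _ ⟨t, rfl⟩
  exact hf (hσ ⟨t, rfl⟩)

/-- Sums of chains supported in `U` and chains supported in `V`. -/
noncomputable def small (U V : Set X) (k : ℕ) : Submodule ℤ (SingChain X k) := supp U k ⊔ supp V k

variable {U V : Set X}

theorem sd_mem_small {k : ℕ} {z : SingChain X k} (hz : z ∈ small U V k) :
    sd k z ∈ small U V k := by
  obtain ⟨a, ha, b, hb, rfl⟩ := Submodule.mem_sup.1 hz
  rw [map_add]
  exact Submodule.add_mem_sup (sd_mem_supp ha) (sd_mem_supp hb)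

theorem sdHomotopy_mem_small {k : ℕ} {z : SingChain X k} (hz : z ∈ small U V k) :
    sdHomotopy k z ∈ small U V (k + 1) := by
  obtain ⟨a, ha, b, hb, rfl⟩ := Submodule.mem_sup.1 hz
  rw [map_add]
  exact Submodule.add_mem_sup (sdHomotopy_mem_supp ha) (sdHomotopy_mem_supp hb)

/-- The chain `t` is the telescoping sum of the subdivision homotopies. It does not depend on the
cover, and it is small whenever `z` is; this is what `exists_small_bd` uses. -/
theorem exists_bd_eq_sub_iterate_sd {k : ℕ} {z : SingChain X k} (hz : IsCycle z) (n : ℕ) :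
    ∃ t, bd k t = z - (sd k)^[n] z ∧
      ∀ U V : Set X, z ∈ small U V k → t ∈ small U V (k + 1) := by
  induction n generalizing z with
  | zero => exact ⟨0, by simp, fun _ _ _ => Submodule.zero_mem _⟩
  | succ n ih =>
    obtain ⟨t, ht, ht'⟩ := ih hz.sd
    refine ⟨sdHomotopy k z + t, ?_, fun U V h => Submodule.add_mem _ (sdHomotopy_mem_small h)
      (ht' U V (sd_mem_small h))⟩
    rw [map_add, bd_sdHomotopy hz, ht, Function.iterate_succ_apply]
    abel

/-- For one simplex, subdivide until the pieces are smaller than a Lebesgue number of the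
pulled-back cover. Smallness survives further subdivision, so finitely many simplices have a common
exponent. -/
theorem exists_iterate_sd_mem_small (hU : IsOpen U) (hV : IsOpen V) (hUV : U ∪ V = Set.univ)
    {k : ℕ} (z : SingChain X k) : ∃ n, (sd k)^[n] z ∈ small U V k := by
  have mono {z : SingChain X k} {n m : ℕ} (hnm : n ≤ m) (h : (sd k)^[n] z ∈ small U V k) :
      (sd k)^[m] z ∈ small U V k := by
    obtain ⟨l, rfl⟩ := Nat.exists_eq_add_of_le' hnm
    rw [Function.iterate_add_apply]
    clear hnm
    induction l with
    | zero => exact h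
    | succ l ih =>
      rw [Function.iterate_succ_apply']
      exact sd_mem_small ih
  have hiter (n : ℕ) : ((sd k)^[n] : SingChain X k → SingChain X k) =
      ⇑((sd k : SingChain X k →ₗ[ℤ] SingChain X k) ^ n) := by
    rw [Module.End.coe_pow]
  induction z using Finsupp.induction_linear with
  | zero => exact ⟨0, Submodule.zero_mem _⟩
  | add f g hf hg =>
    obtain ⟨n, hn⟩ := hf
    obtain ⟨m, hm⟩ := hg
    refine ⟨max n m, ?_⟩
    have h1 := mono (le_max_left n m) hn
    have h2 := mono (le_max_right n m) hm
    rw [hiter] at *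
    rw [map_add]
    exact Submodule.add_mem _ h1 h2
  | single σ c =>
    obtain ⟨ε, hε, hb⟩ : ∃ ε > 0, ∀ p : stdSimplex ℝ (Fin k),
        Metric.ball p ε ⊆ σ ⁻¹' U ∨ Metric.ball p ε ⊆ σ ⁻¹' V := by
      obtain ⟨ε, hε, hb⟩ := lebesgue_number_lemma_of_metric
        (c := fun i : Bool => σ ⁻¹' (if i then U else V))
        (isCompact_univ (X := stdSimplex ℝ (Fin k)))
        (fun i => by cases i <;> simp [hU.preimage σ.continuous, hV.preimage σ.continuous])
        (fun p _ => by
          have : σ p ∈ U ∪ V := hUV ▸ Set.mem_univ _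
          rcases this with h | h
          · exact Set.mem_iUnion.2 ⟨true, by simpa using h⟩
          · exact Set.mem_iUnion.2 ⟨false, by simpa using h⟩)
      refine ⟨ε, hε, fun p => ?_⟩
      obtain ⟨i, hi⟩ := hb p (Set.mem_univ p)
      cases i
      · right; simpa using hi
      · left; simpa using hi
    obtain ⟨n, hn⟩ := TupleChain.exists_iterate_sd_mem k (half_pos hε)
      (fun i : Fin k => stdSimplex.vertex (S := ℝ) i)
    refine ⟨n, ?_⟩
    have hc : Finsupp.single σ c = c • Finsupp.single σ (1 : ℤ) := by simp
    rw [hiter, hc, map_smul, ← hiter]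
    refine Submodule.smul_mem _ _ ?_
    have hs (m : ℕ) : (sd k)^[m] (Finsupp.single σ 1) = ofAffine σ k
        ((TupleChain.sd (fun j => tupleBarycenter j) k)^[m] (vertices k)) := by
      induction m with
      | zero => exact (ofAffine_vertices σ).symm
      | succ m ih =>
        rw [Function.iterate_succ_apply', ih, Function.iterate_succ_apply', sd_ofAffine]
    rw [hs]
    refine TupleChain.map_mem_of_sub (ofAffine σ k) (fun v hv => ?_) hn
    rw [ofAffine_single]
    -- In index 0 the simplex is empty, and its image lies in `U` for trivial reasons.
    rcases isEmpty_or_nonempty (Fin k) with he | ⟨⟨i⟩⟩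
    · refine Submodule.mem_sup_left (single_mem_supp ?_)
      rintro _ ⟨t, rfl⟩
      have := t.2.2
      simp at this
    · have hr : Set.range (affineSimplex v) ⊆ Metric.ball (v i) ε := by
        rintro _ ⟨t, rfl⟩
        rw [Metric.mem_ball, dist_comm]
        exact (dist_affineSimplex_le (fun l => (hv i l).le) t).trans_lt (half_lt_self hε)
      rcases hb (v i) with h | h
      · refine Submodule.mem_sup_left (single_mem_supp ?_)
        rintro _ ⟨t, rfl⟩
        exact h (hr ⟨t, rfl⟩)
      · refine Submodule.mem_sup_right (single_mem_supp ?_)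
        rintro _ ⟨t, rfl⟩
        exact h (hr ⟨t, rfl⟩)

/-- Every cycle is homologous to a sum of chains supported in the members of an open cover. -/
theorem IsCycle.exists_small (hU : IsOpen U) (hV : IsOpen V) (hUV : U ∪ V = Set.univ)
    {k : ℕ} {z : SingChain X k} (hz : IsCycle z) :
    ∃ a ∈ supp U k, ∃ b ∈ supp V k, ∃ t, z = a + b + bd k t := by
  obtain ⟨n, hn⟩ := exists_iterate_sd_mem_small hU hV hUV z
  obtain ⟨a, ha, b, hb, hab⟩ := Submodule.mem_sup.1 hn
  obtain ⟨t, ht, -⟩ := exists_bd_eq_sub_iterate_sd hz n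
  exact ⟨a, ha, b, hb, t, by rw [ht, hab]; abel⟩

/-- A boundary that is small with respect to an open cover is the boundary of a small chain. -/
theorem exists_small_bd (hU : IsOpen U) (hV : IsOpen V) (hUV : U ∪ V = Set.univ)
    {k : ℕ} {z : SingChain X (k + 1)} (hz : bd k z ∈ small U V k) :
    ∃ a ∈ supp U (k + 1), ∃ b ∈ supp V (k + 1), bd k z = bd k a + bd k b := by
  obtain ⟨n, hn⟩ := exists_iterate_sd_mem_small hU hV hUV z
  obtain ⟨t, ht, ht'⟩ := exists_bd_eq_sub_iterate_sd (isCycle_bd z) n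
  have hs (m : ℕ) : bd k ((sd (k + 1))^[m] z) = (sd k)^[m] (bd k z) := by
    induction m with
    | zero => rfl
    | succ m ih => rw [Function.iterate_succ_apply', bd_sd, ih, Function.iterate_succ_apply']
  obtain ⟨a, ha, b, hb, hab⟩ := Submodule.mem_sup.1 (Submodule.add_mem _ hn (ht' U V hz))
  refine ⟨a, ha, b, hb, ?_⟩
  rw [← map_add, hab, map_add, hs, ht]
  abel

end SingChain

/-! ### Comparison with the singular homology functor -/

/-- Cycles are a kernel and homology is a cokernel, so exactness in modules turns the categorical
condition into one on elements. The neighbouring indices are left as `prev` and `next` so that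
degree 0 is included. -/
theorem homologyMap_eq_zero_iff {K L : ChainComplex (ModuleCat.{0} ℤ) ℕ} (φ : K ⟶ L) {j k l : ℕ}
    (hj : (ComplexShape.down ℕ).prev k = j) (hl : (ComplexShape.down ℕ).next k = l) :
    HomologicalComplex.homologyMap φ k = 0 ↔
      ∀ z : K.X k, K.d k l z = 0 → ∃ y : L.X j, L.d j k y = φ.f k z := by
  have hi (M : ChainComplex (ModuleCat.{0} ℤ) ℕ) (z : M.X k) :
      M.d k l z = 0 ↔ ∃ c : M.cycles k, M.iCycles k c = z := by
    have h := ShortComplex.exact_of_f_is_kernel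
      (ShortComplex.mk (M.iCycles k) (M.d k l) (M.iCycles_d k l)) (M.cyclesIsKernel k l hl)
    rw [ShortComplex.moduleCat_exact_iff] at h
    constructor
    · exact h z
    · rintro ⟨c, rfl⟩
      have := M.iCycles_d k l
      exact congr($this c)
  have hb (c : L.cycles k) : L.homologyπ k c = 0 ↔ ∃ y : L.X j, L.d j k y = L.iCycles k c := by
    have h := ShortComplex.exact_of_g_is_cokernel
      (ShortComplex.mk (L.toCycles j k) (L.homologyπ k) (L.toCycles_comp_homologyπ j k))
      (L.homologyIsCokernel j k hj)
    rw [ShortComplex.moduleCat_exact_iff] at h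
    have ht := L.toCycles_i j k
    have ht' (y : L.X j) : L.iCycles k (L.toCycles j k y) = L.d j k y := congr($ht y)
    constructor
    · intro hc
      obtain ⟨y, hy⟩ := h c hc
      refine ⟨y, ?_⟩
      rw [← ht', ← hy]
    · rintro ⟨y, hy⟩
      rw [← ht'] at hy
      have hinj : Function.Injective (L.iCycles k) :=
        (ModuleCat.mono_iff_injective _).1 inferInstance
      rw [← hinj hy]
      have := L.toCycles_comp_homologyπ j k
      exact congr($this y)
  rw [← cancel_epi (K.homologyπ k), Limits.comp_zero, HomologicalComplex.homologyπ_naturality]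
  have hc (c : K.cycles k) : L.iCycles k (HomologicalComplex.cyclesMap φ k c) =
      φ.f k (K.iCycles k c) := by
    have := HomologicalComplex.cyclesMap_i φ k
    exact congr($this c)
  constructor
  · intro h z hz
    obtain ⟨c, rfl⟩ := (hi K z).1 hz
    rw [← hc]
    refine (hb _).1 ?_
    exact congr($h c)
  · intro h
    ext c
    change L.homologyπ k (HomologicalComplex.cyclesMap φ k c) = 0
    rw [hb, hc]
    exact h _ ((hi K _).2 ⟨c, rfl⟩)

namespace SingChain

open Simplicial Opposite

variable {X Y : Type} [TopologicalSpace X] [TopologicalSpace Y]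

/-- The singular chain complex with integer coefficients. -/
noncomputable abbrev mathlibComplex (X : Type) [TopologicalSpace X] :
    ChainComplex (ModuleCat.{0} ℤ) ℕ :=
  (TopCat.toSSet.obj (TopCat.of X)).chainComplex (ModuleCat.of ℤ ℤ)

/-- The generator of the singular chains given by a singular simplex. -/
noncomputable def mathlibGen (k : ℕ) (σ : C(stdSimplex ℝ (Fin (k + 1)), X)) :
    (mathlibComplex X).X k :=
  (SSet.ιChainComplex (TopCat.toSSet.obj (TopCat.of X)) (R := ModuleCat.of ℤ ℤ)
    (((TopCat.of X).toSSetObjEquiv (op ⦋k⦌)).symm σ)).hom (1 : ℤ)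

/-- The comparison map. -/
noncomputable def toMathlib (k : ℕ) : SingChain X (k + 1) →ₗ[ℤ] (mathlibComplex X).X k :=
  Finsupp.linearCombination ℤ (mathlibGen k)

theorem toMathlib_single (k : ℕ) (σ : C(stdSimplex ℝ (Fin (k + 1)), X)) :
    toMathlib k (Finsupp.single σ 1) = mathlibGen k σ := by
  rw [toMathlib, Finsupp.linearCombination_single]
  exact (((mathlibComplex X).X k).isModule.one_smul _)

/-- The inverse of the comparison map. -/
noncomputable def ofMathlib (k : ℕ) : (mathlibComplex X).X k →ₗ[ℤ] SingChain X (k + 1) :=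
  (Limits.Cofan.IsColimit.desc (SSet.isColimitChainComplexXCofan
    (TopCat.toSSet.obj (TopCat.of X)) (ModuleCat.of ℤ ℤ) k)
    (fun s => (ModuleCat.ofHom (LinearMap.toSpanSingleton ℤ _
      (Finsupp.single ((TopCat.of X).toSSetObjEquiv (op ⦋k⦌) s) 1)) :
      ModuleCat.of ℤ ℤ ⟶ ModuleCat.of ℤ (SingChain X (k + 1))))).hom

theorem ofMathlib_gen (k : ℕ) (σ : C(stdSimplex ℝ (Fin (k + 1)), X)) :
    ofMathlib k (mathlibGen k σ) = Finsupp.single σ 1 := by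
  have := Limits.Cofan.IsColimit.fac (SSet.isColimitChainComplexXCofan
    (TopCat.toSSet.obj (TopCat.of X)) (ModuleCat.of ℤ ℤ) k)
    (fun s => (ModuleCat.ofHom (LinearMap.toSpanSingleton ℤ _
      (Finsupp.single ((TopCat.of X).toSSetObjEquiv (op ⦋k⦌) s) 1)) :
      ModuleCat.of ℤ ℤ ⟶ ModuleCat.of ℤ (SingChain X (k + 1))))
      (((TopCat.of X).toSSetObjEquiv (op ⦋k⦌)).symm σ)
  have h2 := congr($this (1 : ℤ))
  refine h2.trans ?_
  change LinearMap.toSpanSingleton ℤ _ _ (1 : ℤ) = _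
  rw [LinearMap.toSpanSingleton_apply, one_smul, Equiv.apply_symm_apply]

theorem ofMathlib_toMathlib (k : ℕ) (z : SingChain X (k + 1)) :
    ofMathlib k (toMathlib k z) = z := by
  suffices h : (ofMathlib k).comp (toMathlib k) =
    (LinearMap.id : SingChain X (k + 1) →ₗ[ℤ] _) from LinearMap.congr_fun h z
  refine hom_ext fun σ => ?_
  rw [LinearMap.comp_apply, toMathlib_single, ofMathlib_gen, LinearMap.id_apply]

theorem toMathlib_ofMathlib (k : ℕ) (z : (mathlibComplex X).X k) :
    toMathlib k (ofMathlib k z) = z := by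
  suffices h : ModuleCat.ofHom (ofMathlib k) ≫ ModuleCat.ofHom (toMathlib k) =
    𝟙 ((mathlibComplex X).X k) from congr($h z)
  refine SSet.chainComplex_hom_ext fun s => ?_
  refine ModuleCat.hom_ext (LinearMap.ext_ring ?_)
  obtain ⟨σ, rfl⟩ := ((TopCat.of X).toSSetObjEquiv (op ⦋k⦌)).symm.surjective s
  change toMathlib k (ofMathlib k (mathlibGen k σ)) = mathlibGen k σ
  rw [ofMathlib_gen, toMathlib_single]

theorem toMathlib_map (f : C(X, Y)) (k : ℕ) (z : SingChain X (k + 1)) :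
    toMathlib k (map f (k + 1) z) =
      (SSet.chainComplexMap (TopCat.toSSet.map (TopCat.ofHom f)) (ModuleCat.of ℤ ℤ)).f k
        (toMathlib k z) := by
  suffices h : (toMathlib k).comp (map f (k + 1)) = ((SSet.chainComplexMap
      (TopCat.toSSet.map (TopCat.ofHom f)) (ModuleCat.of ℤ ℤ)).f k).hom.comp (toMathlib k) from
    LinearMap.congr_fun h z
  refine hom_ext fun σ => ?_
  simp only [LinearMap.comp_apply, map_single, toMathlib_single]
  have := SSet.ι_chainComplexMap_f (TopCat.toSSet.obj (TopCat.of X))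
    (TopCat.toSSet.obj (TopCat.of Y)) (TopCat.toSSet.map (TopCat.ofHom f))
    (ModuleCat.of ℤ ℤ) (((TopCat.of X).toSSetObjEquiv (op ⦋k⦌)).symm σ)
  exact congr($this (1 : ℤ)).symm

theorem toMathlib_bd (k : ℕ) (z : SingChain X (k + 2)) :
    toMathlib k (bd (k + 1) z) = (mathlibComplex X).d (k + 1) k (toMathlib (k + 1) z) := by
  suffices h : (toMathlib k).comp (bd (k + 1)) =
      ((mathlibComplex X).d (k + 1) k).hom.comp (toMathlib (k + 1)) from LinearMap.congr_fun h z
  refine hom_ext fun σ => ?_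
  simp only [LinearMap.comp_apply, bd_single, toMathlib_single, map_sum]
  have h := SSet.ιChainComplex_d (TopCat.toSSet.obj (TopCat.of X)) (R := ModuleCat.of ℤ ℤ)
    (((TopCat.of X).toSSetObjEquiv (op ⦋k + 1⦌)).symm σ)
  have h2 := LinearMap.congr_fun (congrArg ModuleCat.Hom.hom h) (1 : ℤ)
  refine Eq.trans ?_ h2.symm
  rw [ModuleCat.hom_sum, LinearMap.sum_apply]
  refine Finset.sum_congr rfl fun i _ => ?_
  rw [LinearMap.map_smul, toMathlib_single, ModuleCat.hom_zsmul]
  have hs (c : ℤ) (hc : c = 1 ∨ c = -1) {A B : ModuleCat.{0} ℤ} (F : A →ₗ[ℤ] B) (x : A) (y : B)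
      (hy : y = F x) : c • y = (c • F) x := by
    subst hy
    rcases hc with rfl | rfl <;> simp
  refine (int_smul_eq_zsmul _ _ _).trans (hs _ (neg_one_pow_eq_or ℤ _) _ _ _ ?_)
  have h3 := TopCat.toSSetObjEquiv_symm_naturality (X := TopCat.of X) (SimplexCategory.δ i) σ
  rw [mathlibGen]
  congr 3
  refine Eq.trans ?_ h3.symm
  congr 1
  ext1 t
  exact congrArg σ (congrFun (affineSimplex_vertex_comp (fun j => i.succAbove j)) t)

theorem homologyMap_eq_iff_complex (f g : C(X, Y)) (k : ℕ) :
    homologyMap k f = homologyMap k g ↔ HomologicalComplex.homologyMap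
      (SSet.chainComplexMap (TopCat.toSSet.map (TopCat.ofHom f)) (ModuleCat.of ℤ ℤ) -
        SSet.chainComplexMap (TopCat.toSSet.map (TopCat.ofHom g)) (ModuleCat.of ℤ ℤ)) k = 0 := by
  rw [HomologicalComplex.homologyMap_sub, sub_eq_zero]
  rfl

theorem exists_bd_eq_iff (f g : C(X, Y)) (k : ℕ) (z : SingChain X (k + 1)) :
    (∃ y : (mathlibComplex Y).X (k + 1), (mathlibComplex Y).d (k + 1) k y =
      (SSet.chainComplexMap (TopCat.toSSet.map (TopCat.ofHom f)) (ModuleCat.of ℤ ℤ) -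
        SSet.chainComplexMap (TopCat.toSSet.map (TopCat.ofHom g)) (ModuleCat.of ℤ ℤ)).f k
        (toMathlib k z)) ↔
    ∃ y : SingChain Y (k + 2), bd (k + 1) y = map f (k + 1) z - map g (k + 1) z := by
  have hsub : (SSet.chainComplexMap (TopCat.toSSet.map (TopCat.ofHom f)) (ModuleCat.of ℤ ℤ) -
        SSet.chainComplexMap (TopCat.toSSet.map (TopCat.ofHom g)) (ModuleCat.of ℤ ℤ)).f k
        (toMathlib k z) = toMathlib k (map f (k + 1) z - map g (k + 1) z) := by
    rw [map_sub, toMathlib_map, toMathlib_map]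
    rfl
  rw [hsub]
  constructor
  · rintro ⟨y, hy⟩
    refine ⟨ofMathlib (k + 1) y, ?_⟩
    rw [← toMathlib_ofMathlib (k + 1) y, ← toMathlib_bd] at hy
    rw [← ofMathlib_toMathlib k (bd (k + 1) _), hy, ofMathlib_toMathlib]
  · rintro ⟨y, hy⟩
    exact ⟨toMathlib (k + 1) y, by rw [← toMathlib_bd, hy]⟩

/-- In positive degrees the augmentation plays no role, so cycles and boundaries of the two
complexes correspond. Degree `k + 1` is index `k + 2` of the augmented chains. -/
theorem homologyMap_succ_eq_iff (f g : C(X, Y)) (k : ℕ) :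
    homologyMap (k + 1) f = homologyMap (k + 1) g ↔ ∀ z : SingChain X (k + 2), IsCycle z →
      ∃ y : SingChain Y (k + 3), bd (k + 2) y = map f (k + 2) z - map g (k + 2) z := by
  rw [homologyMap_eq_iff_complex, homologyMap_eq_zero_iff _ (ChainComplex.prev ℕ (k + 1))
    (ChainComplex.next_nat_succ k)]
  constructor
  · intro h z hz
    rw [← exists_bd_eq_iff]
    refine h _ ?_
    rw [← toMathlib_bd, show bd (k + 1) z = 0 from hz, map_zero]
  · intro h z hz
    obtain ⟨z, rfl⟩ : ∃ w, toMathlib (k + 1) w = z := ⟨_, toMathlib_ofMathlib _ _⟩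
    rw [exists_bd_eq_iff]
    refine h z ?_
    rw [← toMathlib_bd] at hz
    change bd (k + 1) z = 0
    rw [← ofMathlib_toMathlib k (bd (k + 1) z), hz, map_zero]

theorem homologyMap_eq_of_homotopic {f g : C(X, Y)} (h : f.Homotopic g) (k : ℕ) :
    homologyMap k f = homologyMap k g := by
  obtain ⟨H⟩ := h
  exact TopCat.Homotopy.congr_homologyMap_singularChainComplexFunctor
    (f := TopCat.ofHom f) (g := TopCat.ofHom g) H (ModuleCat.of ℤ ℤ) k

/-- Three ranges occur. In index 0 the two chain maps coincide, because all maps from the empty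
simplex are equal; index 1 is unreduced `H_0`; higher indices are covered by
`homologyMap_succ_eq_iff`. -/
theorem exists_bd_of_homotopic {f g : C(X, Y)} (h : f.Homotopic g) {k : ℕ} {z : SingChain X k}
    (hz : IsCycle z) : ∃ y : SingChain Y (k + 1), bd k y = map f k z - map g k z := by
  rcases k with - | - | k
  · refine ⟨0, ?_⟩
    rw [map_zero, eq_comm, sub_eq_zero]
    suffices h : map f 0 = map g 0 from LinearMap.congr_fun h z
    refine hom_ext fun σ => ?_
    rw [map_single, map_single]
    congr 1
    ext t
    simpa using t.2.2
  · have h0 := homologyMap_eq_of_homotopic h 0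
    rw [homologyMap_eq_iff_complex, homologyMap_eq_zero_iff _ (ChainComplex.prev ℕ 0)
      ChainComplex.next_nat_zero] at h0
    rw [← exists_bd_eq_iff]
    refine h0 _ ?_
    -- The successor of degree 0 in the complex is 0 itself, with zero differential: every 0-chain
    -- is a cycle there.
    rw [(mathlibComplex X).shape 0 0 (by simp)]
    rfl
  · exact (homologyMap_succ_eq_iff f g k).1 (homologyMap_eq_of_homotopic h _) z hz

end SingChain

/-! ### Homological degrees of maps -/

namespace SingChain

variable {X Y Z X' : Type} [TopologicalSpace X] [TopologicalSpace Y] [TopologicalSpace Z]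
  [TopologicalSpace X']

/-- On homology of index `k`, the map `f` is `n` times the map `g`. -/
def DegRel (k : ℕ) (n : ℤ) (f g : C(X, Y)) : Prop :=
  ∀ z : SingChain X k, IsCycle z → ∃ y, bd k y = map f k z - n • map g k z

theorem DegRel.comp_right {k : ℕ} {n : ℤ} {f g : C(X, Y)} (h : DegRel k n f g) (p : C(X', X)) :
    DegRel k n (f.comp p) (g.comp p) := by
  intro z hz
  simpa [map_map] using h _ (hz.map p)

theorem DegRel.comp_left {k : ℕ} {n : ℤ} {f g : C(X, Y)} (h : DegRel k n f g) (p : C(Y, Z)) :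
    DegRel k n (p.comp f) (p.comp g) := by
  intro z hz
  obtain ⟨y, hy⟩ := h z hz
  exact ⟨map p (k + 1) y, by rw [← map_bd, hy, map_sub, map_smul, map_map, map_map]⟩

theorem DegRel.trans {k : ℕ} {n m : ℤ} {f g h : C(X, Y)} (hfg : DegRel k n f g)
    (hgh : DegRel k m g h) : DegRel k (n * m) f h := by
  intro z hz
  obtain ⟨y, hy⟩ := hfg z hz
  obtain ⟨y', hy'⟩ := hgh z hz
  refine ⟨y + n • y', ?_⟩
  rw [map_add, map_smul, hy, hy', smul_sub, smul_smul]
  abel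

theorem DegRel.of_homotopic {k : ℕ} {f g : C(X, Y)} (h : f.Homotopic g) : DegRel k 1 f g := by
  intro z hz
  simpa using exists_bd_of_homotopic h hz

theorem DegRel.congr {k : ℕ} {n : ℤ} {f g f' g' : C(X, Y)} (h : DegRel k n f g)
    (hf : f'.Homotopic f) (hg : g.Homotopic g') : DegRel k n f' g' := by
  simpa using ((DegRel.of_homotopic hf).trans h).trans (DegRel.of_homotopic hg)

theorem homologyMap_succ_eq_iff_degRel (f g : C(X, Y)) (k : ℕ) :
    homologyMap (k + 1) f = homologyMap (k + 1) g ↔ DegRel (k + 2) 1 f g := by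
  rw [homologyMap_succ_eq_iff]
  simp [DegRel]

variable (k : ℕ)

/-- The (reduced) homology of index `k` vanishes. -/
def Acyclic (k : ℕ) (X : Type*) [TopologicalSpace X] : Prop :=
  ∀ z : SingChain X k, IsCycle z → ∃ y, bd k y = z

theorem eq_smul_of_unique {σ : C(stdSimplex ℝ (Fin k), X)} (hσ : ∀ τ, τ = σ) (z : SingChain X k) :
    z = z σ • Finsupp.single σ 1 := by
  ext τ
  rw [hσ τ]
  simp

/-- There is one simplex in each index, and the alternating sum of its faces makes the boundary
alternately an isomorphism and zero. The augmentation makes the pattern start correctly at index 0.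
-/
theorem acyclic_unit : Acyclic k Unit := by
  have hσ (j : ℕ) (τ : C(stdSimplex ℝ (Fin j), Unit)) : τ = ContinuousMap.const _ () := by
    ext
  have hbd (j : ℕ) : bd j (Finsupp.single (ContinuousMap.const _ ()) 1) =
      (if Even (j + 1) then 0 else 1 : ℤ) •
        (Finsupp.single (ContinuousMap.const _ ()) 1 : SingChain Unit j) := by
    rw [bd_single, ← Fin.sum_neg_one_pow ℤ (j + 1), Finset.sum_smul]
    rfl
  intro z hz
  rw [eq_smul_of_unique k (hσ k) z]
  rcases Nat.even_or_odd k with hk | hk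
  · refine ⟨z (ContinuousMap.const _ ()) • Finsupp.single (ContinuousMap.const _ ()) 1, ?_⟩
    rw [map_smul, hbd, if_neg (Nat.not_even_iff_odd.2 hk.add_one), one_smul]
  · obtain ⟨j, rfl⟩ : ∃ j, k = j + 1 := ⟨k - 1, (Nat.succ_pred_eq_of_pos hk.pos).symm⟩
    have h0 : bd j z = 0 := hz
    rw [eq_smul_of_unique _ (hσ (j + 1)) z, map_smul, hbd,
      if_neg (Nat.not_even_iff_odd.2 hk), one_smul] at h0
    have := DFunLike.congr_fun h0 (ContinuousMap.const _ ())
    refine ⟨0, ?_⟩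
    have h1 : z (ContinuousMap.const _ ()) = 0 := by simpa using this
    simp [h1]

theorem acyclic_of_homotopic_const {x₀ : X}
    (h : (ContinuousMap.id X).Homotopic (ContinuousMap.const X x₀)) : Acyclic k X := by
  intro z hz
  obtain ⟨y, hy⟩ := exists_bd_of_homotopic h hz
  obtain ⟨w, hw⟩ := acyclic_unit k _ (hz.map (ContinuousMap.const X ()))
  refine ⟨y + map (ContinuousMap.const Unit x₀) (k + 1) w, ?_⟩
  rw [map_add, hy, ← map_bd, hw, map_map, map_id]
  have : (ContinuousMap.const Unit x₀).comp (ContinuousMap.const X ()) =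
    ContinuousMap.const X x₀ := rfl
  rw [this, sub_add_cancel]

/-- The inclusion of a subset. -/
def incl (U : Set X) : C(U, X) := ⟨Subtype.val, continuous_subtype_val⟩

variable {k}

theorem exists_map_incl {U : Set X} {z : SingChain X k} (hz : z ∈ supp U k) :
    ∃ w : SingChain U k, map (incl U) k w = z := by
  have := map_mem_of_supp (S := LinearMap.range (map (incl U) k)) LinearMap.id (fun σ hσ => by
    refine ⟨Finsupp.single ⟨fun t => ⟨σ t, hσ ⟨t, rfl⟩⟩, by fun_prop⟩ 1, ?_⟩
    rw [map_single]
    rfl) hz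
  exact this

theorem map_incl_injective (U : Set X) : Function.Injective (map (incl U) k) := by
  refine Finsupp.mapDomain_injective fun σ τ h => ?_
  ext t
  exact congr($h t)

theorem map_incl_mem (U : Set X) (w : SingChain U k) : map (incl U) k w ∈ supp U k := by
  refine map_mem_supp (U := Set.univ) (fun u _ => u.2) ?_
  rw [supp_univ]
  trivial

theorem isCycle_of_map_incl {U : Set X} {w : SingChain U k} (h : IsCycle (map (incl U) k w)) :
    IsCycle w := by
  cases k with
  | zero => trivial
  | succ k =>
    refine map_incl_injective U ?_
    rw [map_bd, _root_.map_zero]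
    exact h

theorem Acyclic.exists_supp {U : Set X} (h : Acyclic k U) {z : SingChain X k}
    (hz : z ∈ supp U k) (hc : IsCycle z) : ∃ y ∈ supp U (k + 1), bd k y = z := by
  obtain ⟨w, rfl⟩ := exists_map_incl hz
  obtain ⟨y, hy⟩ := h w (isCycle_of_map_incl hc)
  exact ⟨map (incl U) (k + 1) y, map_incl_mem U y, by rw [← map_bd, hy]⟩

theorem isCycle_of_succ {z : SingChain X (k + 1)} (h : bd k z = 0) : IsCycle z := h

theorem DegRel.exists_supp {W : Set X} {W' : Set Y} {n : ℤ} {F G : C(X, Y)} {f g : C(W, W')}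
    (h : DegRel k n f g) (hf : ∀ w : W, (f w : Y) = F w) (hg : ∀ w : W, (g w : Y) = G w)
    {z : SingChain X k} (hz : z ∈ supp W k) (hc : IsCycle z) :
    ∃ y ∈ supp W' (k + 1), bd k y = map F k z - n • map G k z := by
  obtain ⟨w, rfl⟩ := exists_map_incl hz
  obtain ⟨y, hy⟩ := h w (isCycle_of_map_incl hc)
  refine ⟨map (incl W') (k + 1) y, map_incl_mem W' y, ?_⟩
  rw [← map_bd, hy, map_sub, map_smul, map_map, map_map, map_map, map_map]
  have h1 : (incl W').comp f = F.comp (incl W) := ContinuousMap.ext hf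
  have h2 : (incl W').comp g = G.comp (incl W) := ContinuousMap.ext hg
  rw [h1, h2]

/-! ### Mayer–Vietoris arguments for degrees -/

section MayerVietoris

variable {U V : Set X} {U' V' : Set Y} {n : ℤ} {F G : C(X, Y)}

/-- Naturality of the connecting map. Write the cycle as a + b, up to a boundary; on the overlap a
chain e bounds F(∂a) - n G(∂a). Then F(a) - n G(a) - e and F(b) - n G(b) + e are cycles in the
acyclic sets `U'` and `V'`, hence boundaries. -/
theorem DegRel.of_cover (hU : IsOpen U) (hV : IsOpen V) (hUV : U ∪ V = Set.univ)
    (aU : Acyclic (k + 1) U') (aV : Acyclic (k + 1) V')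
    (FU : Set.MapsTo F U U') (FV : Set.MapsTo F V V')
    (GU : Set.MapsTo G U U') (GV : Set.MapsTo G V V')
    {f g : C((U ∩ V : Set X), (U' ∩ V' : Set Y))} (h : DegRel k n f g)
    (hf : ∀ w, (f w : Y) = F w) (hg : ∀ w, (g w : Y) = G w) : DegRel (k + 1) n F G := by
  intro z hz
  obtain ⟨a, ha, b, hb, t, rfl⟩ := hz.exists_small hU hV hUV
  have hab : bd k a + bd k b = 0 := by
    have : bd k (a + b + bd (k + 1) t) = 0 := hz
    rwa [map_add, map_add, bd_bd, add_zero] at this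
  have hc : bd k a ∈ supp (U ∩ V) k := by
    refine mem_supp_inter (bd_mem_supp ha) ?_
    rw [eq_neg_of_add_eq_zero_left hab]
    exact Submodule.neg_mem _ (bd_mem_supp hb)
  obtain ⟨e, he, hbe⟩ := h.exists_supp hf hg hc (isCycle_bd a)
  obtain ⟨p, -, hp⟩ := aU.exists_supp (z := map F _ a - n • map G _ a - e)
    (Submodule.sub_mem _ (Submodule.sub_mem _ (map_mem_supp FU ha)
      (Submodule.smul_mem _ _ (map_mem_supp GU ha))) (supp_mono Set.inter_subset_left _ he))
    (isCycle_of_succ (by simp only [map_sub, map_smul, hbe, map_bd, sub_self]))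
  obtain ⟨q, -, hq⟩ := aV.exists_supp (z := map F _ b - n • map G _ b + e)
    (Submodule.add_mem _ (Submodule.sub_mem _ (map_mem_supp FV hb)
      (Submodule.smul_mem _ _ (map_mem_supp GV hb))) (supp_mono Set.inter_subset_right _ he))
    (isCycle_of_succ (by
      simp only [map_sub, map_add, map_smul, hbe, ← map_bd, eq_neg_of_add_eq_zero_right hab,
        map_neg, smul_neg]
      abel))
  refine ⟨p + q + map F _ t - n • map G _ t, ?_⟩
  simp only [map_add, map_sub, map_smul, hp, hq, ← map_bd, smul_add]
  abel

/-- As F exchanges the two pieces, F(a) must now be compared with G(b), which lies in the same set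
`V'`. Since ∂b = -∂a, the degree changes sign. -/
theorem DegRel.of_cover_swap (hU : IsOpen U) (hV : IsOpen V) (hUV : U ∪ V = Set.univ)
    (aU : Acyclic (k + 1) U') (aV : Acyclic (k + 1) V')
    (FU : Set.MapsTo F U V') (FV : Set.MapsTo F V U')
    (GU : Set.MapsTo G U U') (GV : Set.MapsTo G V V')
    {f g : C((U ∩ V : Set X), (U' ∩ V' : Set Y))} (h : DegRel k n f g)
    (hf : ∀ w, (f w : Y) = F w) (hg : ∀ w, (g w : Y) = G w) : DegRel (k + 1) (-n) F G := by
  intro z hz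
  obtain ⟨a, ha, b, hb, t, rfl⟩ := hz.exists_small hU hV hUV
  have hab : bd k a + bd k b = 0 := by
    have : bd k (a + b + bd (k + 1) t) = 0 := hz
    rwa [map_add, map_add, bd_bd, add_zero] at this
  have hc : bd k a ∈ supp (U ∩ V) k := by
    refine mem_supp_inter (bd_mem_supp ha) ?_
    rw [eq_neg_of_add_eq_zero_left hab]
    exact Submodule.neg_mem _ (bd_mem_supp hb)
  obtain ⟨e, he, hbe⟩ := h.exists_supp hf hg hc (isCycle_bd a)
  obtain ⟨p, -, hp⟩ := aV.exists_supp (z := map F _ a + n • map G _ b - e)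
    (Submodule.sub_mem _ (Submodule.add_mem _ (map_mem_supp FU ha)
      (Submodule.smul_mem _ _ (map_mem_supp GV hb))) (supp_mono Set.inter_subset_right _ he))
    (isCycle_of_succ (by
      simp only [map_sub, map_add, map_smul, hbe, ← map_bd, eq_neg_of_add_eq_zero_right hab,
        map_neg, smul_neg]
      abel))
  obtain ⟨q, -, hq⟩ := aU.exists_supp (z := map F _ b + n • map G _ a + e)
    (Submodule.add_mem _ (Submodule.add_mem _ (map_mem_supp FV hb)
      (Submodule.smul_mem _ _ (map_mem_supp GU ha))) (supp_mono Set.inter_subset_left _ he))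
    (isCycle_of_succ (by
      simp only [map_add, map_smul, hbe, ← map_bd, eq_neg_of_add_eq_zero_right hab,
        map_neg]
      abel))
  refine ⟨p + q + map F _ t + n • map G _ t, ?_⟩
  simp only [map_add, map_smul, hp, hq, ← map_bd, smul_add, neg_smul]
  abel

end MayerVietoris

/-- The (reduced) homology of index `k` is infinite cyclic, generated by the class of `ζ`. -/
structure IsGenerator {X : Type*} [TopologicalSpace X] {k : ℕ} (ζ : SingChain X k) : Prop where
  isCycle : IsCycle ζ
  exists_eq : ∀ z : SingChain X k, IsCycle z → ∃ n : ℤ, ∃ y, bd k y = z - n • ζ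
  eq_zero : ∀ (n : ℤ) (y : SingChain X (k + 1)), bd k y = n • ζ → n = 0

/-- The (reduced) homology of index `k` is infinite cyclic. -/
def HasGenerator (k : ℕ) (X : Type*) [TopologicalSpace X] : Prop :=
  ∃ ζ : SingChain X k, IsGenerator ζ

/-- The empty space is the sphere of dimension -1: its augmented complex is ℤ in index 0 and nothing
else. This is the base of the induction on dimension. -/
theorem hasGenerator_of_isEmpty [IsEmpty X] : HasGenerator 0 X := by
  have he : IsEmpty (stdSimplex ℝ (Fin 0)) := ⟨fun t => by simpa using t.2.2⟩
  let σ : C(stdSimplex ℝ (Fin 0), X) := ⟨fun t => he.elim t,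
    continuous_iff_continuousAt.2 fun t => he.elim t⟩
  refine ⟨Finsupp.single σ 1, trivial, fun z _ => ⟨z σ, 0, ?_⟩, fun n y h => ?_⟩
  · rw [_root_.map_zero, ← eq_smul_of_unique 0 (fun τ => by ext t; exact he.elim t) z, sub_self]
  · have : y = 0 := by
      ext τ
      exact isEmptyElim (τ (stdSimplex.vertex 0))
    rw [this, _root_.map_zero] at h
    simpa using (DFunLike.congr_fun h σ).symm

theorem HasGenerator.of_homotopy_equiv (h : HasGenerator k X) {f : C(X, Y)} {g : C(Y, X)}
    (hfg : (f.comp g).Homotopic (ContinuousMap.id Y))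
    (hgf : (g.comp f).Homotopic (ContinuousMap.id X)) : HasGenerator k Y := by
  obtain ⟨ζ, hζ⟩ := h
  refine ⟨map f k ζ, hζ.isCycle.map f, fun z hz => ?_, fun n y h => ?_⟩
  · obtain ⟨n, y, hy⟩ := hζ.exists_eq _ (hz.map g)
    obtain ⟨w, hw⟩ := exists_bd_of_homotopic hfg hz
    refine ⟨n, map f _ y - w, ?_⟩
    rw [map_sub, ← map_bd, hy, hw, map_sub, map_smul, map_map, map_id]
    abel
  · obtain ⟨w, hw⟩ := exists_bd_of_homotopic hgf hζ.isCycle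
    refine hζ.eq_zero n (map g _ y - n • w) ?_
    rw [map_sub, ← map_bd, h, map_smul, map_smul, map_map, hw, map_id, smul_sub]
    abel

/-- The generator is the suspension A - B of a generator ζ of the overlap, where A in `U` and B in
`V` both have boundary ζ. -/
theorem HasGenerator.of_cover {U V : Set X} (hU : IsOpen U) (hV : IsOpen V)
    (hUV : U ∪ V = Set.univ) (aU : ∀ k, Acyclic k U) (aV : ∀ k, Acyclic k V)
    (h : HasGenerator k (U ∩ V : Set X)) : HasGenerator (k + 1) X := by
  obtain ⟨ζ', hζ⟩ := h
  set ζ : SingChain X k := map (incl (U ∩ V)) k ζ' with hζ_def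
  have hζs : ζ ∈ supp (U ∩ V) k := map_incl_mem _ _
  have hζc : IsCycle ζ := hζ.isCycle.map _
  obtain ⟨A, hA, hbA⟩ := (aU k).exists_supp (supp_mono Set.inter_subset_left _ hζs) hζc
  obtain ⟨B, hB, hbB⟩ := (aV k).exists_supp (supp_mono Set.inter_subset_right _ hζs) hζc
  refine ⟨A - B, isCycle_of_succ (by rw [map_sub, hbA, hbB, sub_self]), fun z hz => ?_,
    fun n y h => ?_⟩
  · obtain ⟨a, ha, b, hb, t, rfl⟩ := hz.exists_small hU hV hUV
    have hab : bd k a + bd k b = 0 := by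
      have : bd k (a + b + bd (k + 1) t) = 0 := hz
      rwa [map_add, map_add, bd_bd, add_zero] at this
    have hc : bd k a ∈ supp (U ∩ V) k := by
      refine mem_supp_inter (bd_mem_supp ha) ?_
      rw [eq_neg_of_add_eq_zero_left hab]
      exact Submodule.neg_mem _ (bd_mem_supp hb)
    obtain ⟨c, hc'⟩ := exists_map_incl hc
    obtain ⟨n, e', he'⟩ := hζ.exists_eq c (isCycle_of_map_incl (hc' ▸ isCycle_bd a))
    set e := map (incl (U ∩ V)) (k + 1) e'
    have he : e ∈ supp (U ∩ V) (k + 1) := map_incl_mem _ _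
    have hbe : bd k e = bd k a - n • ζ := by
      rw [← map_bd, he', map_sub, map_smul, hc']
    obtain ⟨p, -, hp⟩ := (aU (k + 1)).exists_supp (z := a - n • A - e)
      (Submodule.sub_mem _ (Submodule.sub_mem _ ha (Submodule.smul_mem _ _ hA))
        (supp_mono Set.inter_subset_left _ he))
      (isCycle_of_succ (by simp only [map_sub, map_smul, hbe, hbA, sub_self]))
    obtain ⟨q, -, hq⟩ := (aV (k + 1)).exists_supp (z := b + n • B + e)
      (Submodule.add_mem _ (Submodule.add_mem _ hb (Submodule.smul_mem _ _ hB))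
        (supp_mono Set.inter_subset_right _ he))
      (isCycle_of_succ (by
        simp only [map_add, map_smul, hbe, hbB, eq_neg_of_add_eq_zero_right hab]
        abel))
    refine ⟨n, p + q + t, ?_⟩
    simp only [map_add, hp, hq, smul_sub]
    abel
  -- If n(A - B) bounds, it bounds a small chain a + b. Then nA - ∂a = ∂b + nB lies in the overlap
  -- and has boundary nζ there, which forces n = 0.
  · have hs : bd (k + 1) y ∈ small U V (k + 1) := by
      rw [h, smul_sub, sub_eq_add_neg]
      exact Submodule.add_mem_sup (Submodule.smul_mem _ _ hA)
        (Submodule.neg_mem _ (Submodule.smul_mem _ _ hB))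
    obtain ⟨a, ha, b, hb, hab⟩ := exists_small_bd hU hV hUV hs
    rw [h] at hab
    have heq : n • A - bd (k + 1) a = bd (k + 1) b + n • B := by
      rw [sub_eq_iff_eq_add, add_comm (bd (k + 1) b), add_assoc, add_comm (bd (k + 1) b), ← hab,
        smul_sub]
      abel
    have he : n • A - bd (k + 1) a ∈ supp (U ∩ V) (k + 1) := by
      refine mem_supp_inter (Submodule.sub_mem _ (Submodule.smul_mem _ _ hA) (bd_mem_supp ha)) ?_
      rw [heq]
      exact Submodule.add_mem _ (bd_mem_supp hb) (Submodule.smul_mem _ _ hB)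
    obtain ⟨e, he'⟩ := exists_map_incl he
    refine hζ.eq_zero n e (map_incl_injective _ ?_)
    rw [map_bd, he', map_sub, bd_bd, sub_zero, map_smul, hbA, map_smul]

end SingChain

set_option linter.unusedSectionVars false

/-! ### Homology of punctured spaces -/

open Topology SingChain

/-- The complement of the origin. -/
abbrev Punctured (E : Type*) [Zero E] : Type _ := {v : E // v ≠ 0}

section Punctured

variable {E F X : Type} [NormedAddCommGroup E] [NormedSpace ℝ E]
  [NormedAddCommGroup F] [NormedSpace ℝ F] [TopologicalSpace X]

theorem homotopic_subtype {Y : Type} [TopologicalSpace Y] {P : Y → Prop} {φ₀ φ₁ : C(X, {y // P y})}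
    (H : unitInterval × X → Y) (hH : Continuous H) (h₀ : ∀ x, H (0, x) = φ₀ x)
    (h₁ : ∀ x, H (1, x) = φ₁ x) (hP : ∀ t x, P (H (t, x))) : φ₀.Homotopic φ₁ :=
  ⟨{ toFun := fun p => ⟨H p, hP p.1 p.2⟩
     continuous_toFun := by fun_prop
     map_zero_left := fun x => Subtype.ext (h₀ x)
     map_one_left := fun x => Subtype.ext (h₁ x) }⟩

/-- The complement in a punctured product of a closed half of the last coordinate axis. -/
def axisCompl (E : Type) [NormedAddCommGroup E] (s : ℝ) : Set (Punctured (E × ℝ)) :=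
  {p | p.1.1 ≠ 0 ∨ 0 < s * p.1.2}

theorem isOpen_axisCompl (s : ℝ) : IsOpen (axisCompl E s) := by
  have h1 : Continuous fun p : Punctured (E × ℝ) => p.1.1 := by fun_prop
  have h2 : Continuous fun p : Punctured (E × ℝ) => s * p.1.2 := by fun_prop
  exact (isOpen_ne_fun h1 continuous_const).union (isOpen_lt continuous_const h2)

/-- The set is star-shaped about `(0, s)`: along the segment a nonzero first component survives
until the end, and a last coordinate on the side of `s` stays there. -/
theorem acyclic_axisCompl {s : ℝ} (hs : s ≠ 0) (k : ℕ) : Acyclic k (axisCompl E s) := by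
  have hss : 0 < s * s := mul_self_pos.2 hs
  let x₀ : axisCompl E s := ⟨⟨(0, s), by simpa using hs⟩, Or.inr hss⟩
  refine acyclic_of_homotopic_const k (x₀ := x₀) ?_
  have key (t : unitInterval) (p : axisCompl E s) :
      (1 - (t : ℝ)) • p.1.1.1 ≠ 0 ∨ 0 < s * ((1 - t) * p.1.1.2 + t * s) := by
    rcases eq_or_lt_of_le t.2.2 with h1 | h1
    · right
      rw [h1]
      simpa using hss
    · rcases p.2 with h | h
      · left
        exact smul_ne_zero (sub_pos.2 h1).ne' h
      · right
        have h2 : 0 < (1 - (t : ℝ)) * (s * p.1.1.2) := mul_pos (sub_pos.2 h1) h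
        have h3 : 0 ≤ (t : ℝ) * (s * s) := mul_nonneg t.2.1 hss.le
        nlinarith
  refine homotopic_subtype (fun q : unitInterval × axisCompl E s =>
    (⟨((1 - (q.1 : ℝ)) • q.2.1.1.1, (1 - q.1) * q.2.1.1.2 + q.1 * s), ?_⟩ : Punctured (E × ℝ)))
    ?_ ?_ ?_ key
  · intro h
    rw [Prod.mk_eq_zero] at h
    rcases key q.1 q.2 with h' | h'
    · exact h' h.1
    · rw [h.2, mul_zero] at h'
      exact lt_irrefl _ h'
  · fun_prop
  · intro p
    simp
  · intro p
    simp [x₀]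

theorem axisCompl_union : axisCompl E 1 ∪ axisCompl E (-1) = Set.univ := by
  refine Set.eq_univ_of_forall fun p => ?_
  by_cases h : p.1.1 = 0
  · have h2 : p.1.2 ≠ 0 := fun h2 => p.2 (Prod.ext h h2)
    rcases lt_or_gt_of_ne h2 with h3 | h3
    · exact Or.inr (Or.inr (by linarith))
    · exact Or.inl (Or.inr (by linarith))
  · exact Or.inl (Or.inl h)

theorem mem_axisCompl_inter {p : Punctured (E × ℝ)} :
    p ∈ axisCompl E 1 ∩ axisCompl E (-1) ↔ p.1.1 ≠ 0 := by
  constructor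
  · rintro ⟨h | h, h' | h'⟩ <;> first | assumption | skip
    intro _
    linarith
  · exact fun h => ⟨Or.inl h, Or.inl h⟩

/-- The equator of a punctured product. -/
def equatorIncl (E : Type) [NormedAddCommGroup E] [NormedSpace ℝ E] :
    C(Punctured E, (axisCompl E 1 ∩ axisCompl E (-1) : Set (Punctured (E × ℝ)))) where
  toFun v := ⟨⟨(v.1, 0), fun h => v.2 (congrArg Prod.fst h)⟩, mem_axisCompl_inter.2 v.2⟩

/-- The projection to the equator of a punctured product. -/
def equatorProj (E : Type) [NormedAddCommGroup E] [NormedSpace ℝ E] :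
    C((axisCompl E 1 ∩ axisCompl E (-1) : Set (Punctured (E × ℝ))), Punctured E) where
  toFun p := ⟨p.1.1.1, mem_axisCompl_inter.1 p.2⟩

/-- Maps to the complement of the axis are homotopic if their components off the axis agree. -/
theorem homotopic_of_fst_eq
    {φ ψ : C(X, (axisCompl E 1 ∩ axisCompl E (-1) : Set (Punctured (E × ℝ))))}
    (h : ∀ x, (φ x).1.1.1 = (ψ x).1.1.1) : φ.Homotopic ψ := by
  refine homotopic_subtype (fun q : unitInterval × X => (⟨((φ q.2).1.1.1,
    (1 - (q.1 : ℝ)) * (φ q.2).1.1.2 + q.1 * (ψ q.2).1.1.2), fun h =>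
      mem_axisCompl_inter.1 (φ q.2).2 (congrArg Prod.fst h)⟩ : Punctured (E × ℝ))) ?_ ?_ ?_ ?_
  · fun_prop
  · intro x
    simp
  · intro x
    apply Subtype.ext
    simp [h]
  · intro t x
    have := mem_axisCompl_inter.1 (φ x).2
    exact mem_axisCompl_inter.2 this

/-- Suspension: the two axis complements are acyclic and cover, and their intersection retracts onto
the equator `Punctured E`. -/
theorem SingChain.HasGenerator.punctured_prod {k : ℕ} (h : HasGenerator k (Punctured E)) :
    HasGenerator (k + 1) (Punctured (E × ℝ)) := by
  refine HasGenerator.of_cover (isOpen_axisCompl 1) (isOpen_axisCompl (-1)) axisCompl_union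
    (acyclic_axisCompl one_ne_zero) (acyclic_axisCompl (neg_ne_zero.2 one_ne_zero))
    (h.of_homotopy_equiv (f := equatorIncl E) (g := equatorProj E) ?_ ?_)
  · exact homotopic_of_fst_eq fun x => rfl
  · have : (equatorProj E).comp (equatorIncl E) = ContinuousMap.id _ := rfl
    rw [this]

/-- The map of punctured spaces induced by a continuous linear equivalence. -/
def puncturedMap (A : E ≃L[ℝ] F) : C(Punctured E, Punctured F) where
  toFun v := ⟨A v, by simpa using v.2⟩

theorem SingChain.HasGenerator.punctured_congr {k : ℕ} (A : E ≃L[ℝ] F)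
    (h : HasGenerator k (Punctured E)) : HasGenerator k (Punctured F) := by
  refine h.of_homotopy_equiv (f := puncturedMap A) (g := puncturedMap A.symm) ?_ ?_
  · have : (puncturedMap A).comp (puncturedMap A.symm) = ContinuousMap.id _ := by
      ext v
      simp [puncturedMap]
    rw [this]
  · have : (puncturedMap A.symm).comp (puncturedMap A) = ContinuousMap.id _ := by
      ext v
      simp [puncturedMap]
    rw [this]

theorem hasGenerator_punctured [FiniteDimensional ℝ E] {k : ℕ} (hk : Module.finrank ℝ E = k) :
    HasGenerator k (Punctured E) := by
  induction k generalizing E with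
  | zero =>
    have : Subsingleton E := Module.finrank_zero_iff.1 hk
    have : IsEmpty (Punctured E) := ⟨fun v => v.2 (Subsingleton.elim _ _)⟩
    exact hasGenerator_of_isEmpty
  | succ k ih =>
    have h := (ih (E := EuclideanSpace ℝ (Fin k)) (by simp)).punctured_prod
    exact h.punctured_congr (ContinuousLinearEquiv.ofFinrankEq (by simp [hk]))

end Punctured

/-! ### Local degrees -/

section LocalDegree

variable {E F : Type} [NormedAddCommGroup E] [NormedSpace ℝ E]
  [NormedAddCommGroup F] [NormedSpace ℝ F]

/-- The map `f` has local degree `n` at `x`, measured on homology of index `k` (which is to be the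
dimension of `E`). -/
def HasLocalDegree (k : ℕ) (f : E → E) (x : E) (n : ℤ) : Prop :=
  ∃ W ∈ 𝓝 x, ∃ φ ψ : C({w : E // w ∈ W ∧ w ≠ x}, Punctured E),
    (∀ w, (φ w : E) = f w - f x) ∧ (∀ w, (ψ w : E) = w - x) ∧ DegRel k n φ ψ

variable {k : ℕ} {f g : E → E} {x : E} {n m : ℤ}

/-- The inclusion of punctured neighbourhoods. -/
def puncturedInclusion {W W' : Set E} (h : W' ⊆ W) (x : E) :
    C({w : E // w ∈ W' ∧ w ≠ x}, {w : E // w ∈ W ∧ w ≠ x}) where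
  toFun w := ⟨w, h w.2.1, w.2.2⟩

theorem HasLocalDegree.exists_subset (h : HasLocalDegree k f x n) {V : Set E} (hV : V ∈ 𝓝 x) :
    ∃ W ∈ 𝓝 x, W ⊆ V ∧ ∃ φ ψ : C({w : E // w ∈ W ∧ w ≠ x}, Punctured E),
      (∀ w, (φ w : E) = f w - f x) ∧ (∀ w, (ψ w : E) = w - x) ∧ DegRel k n φ ψ := by
  obtain ⟨W, hW, φ, ψ, hφ, hψ, hd⟩ := h
  exact ⟨W ∩ V, Filter.inter_mem hW hV, Set.inter_subset_right, _, _,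
    fun w => hφ (puncturedInclusion Set.inter_subset_left x w),
    fun w => hψ (puncturedInclusion Set.inter_subset_left x w), hd.comp_right _⟩

theorem HasLocalDegree.congr (h : HasLocalDegree k f x n) (hfg : g =ᶠ[𝓝 x] f) :
    HasLocalDegree k g x n := by
  obtain ⟨W, hW, hWV, φ, ψ, hφ, hψ, hd⟩ := h.exists_subset hfg
  refine ⟨W, hW, φ, ψ, fun w => ?_, hψ, hd⟩
  rw [hφ, show g w = f w from hWV w.2.1, hfg.eq_of_nhds]

theorem hasLocalDegree_id (x : E) : HasLocalDegree k (fun y => y) x 1 := by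
  refine ⟨Set.univ, Filter.univ_mem, ⟨fun w => ⟨w - x, sub_ne_zero.2 w.2.2⟩, by fun_prop⟩, _,
    fun w => rfl, fun w => rfl, DegRel.of_homotopic (ContinuousMap.Homotopic.refl _)⟩

/-- The displacement map `φ` of `f` is also the map by which the degree of `g` is normalized after
pulling back along `f`, so the two degree relations compose. -/
theorem HasLocalDegree.comp (hg : HasLocalDegree k g (f x) m) (hf : HasLocalDegree k f x n)
    (hc : ContinuousAt f x) : HasLocalDegree k (fun y => g (f y)) x (m * n) := by
  obtain ⟨V, hV, φ', ψ', hφ', hψ', hd'⟩ := hg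
  obtain ⟨W, hW, hWV, φ, ψ, hφ, hψ, hd⟩ := hf.exists_subset (hc.preimage_mem_nhds hV)
  have hfw (w : {w : E // w ∈ W ∧ w ≠ x}) : f w = φ w + f x := by rw [hφ]; abel
  -- This is `f` on the punctured neighbourhood, written through `φ` so that it inherits continuity
  -- and avoids `f x`.
  let p : C({w : E // w ∈ W ∧ w ≠ x}, {w : E // w ∈ V ∧ w ≠ f x}) :=
    ⟨fun w => ⟨φ w + f x, hfw w ▸ hWV w.2.1, by simpa using (φ w).2⟩, by fun_prop⟩
  have hpsi : ψ'.comp p = φ := by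
    ext w
    change (ψ' (p w) : E) = φ w
    rw [hψ']
    exact add_sub_cancel_right _ _
  refine ⟨W, hW, φ'.comp p, ψ, fun w => ?_, hψ, (hpsi ▸ hd'.comp_right p).trans hd⟩
  change (φ' (p w) : E) = _
  rw [hφ']
  change g (φ w + f x) - _ = _
  rw [← hfw]

theorem HasLocalDegree.conj (A : E ≃L[ℝ] F) (h : HasLocalDegree k f x n) :
    HasLocalDegree k (fun y => A (f (A.symm y))) (A x) n := by
  obtain ⟨W, hW, φ, ψ, hφ, hψ, hd⟩ := h
  let p : C({w : F // w ∈ A.symm ⁻¹' W ∧ w ≠ A x}, {w : E // w ∈ W ∧ w ≠ x}) :=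
    ⟨fun w => ⟨A.symm w, w.2.1, fun h => w.2.2 ((A.apply_symm_apply w.1).symm.trans (congrArg A h))⟩,
      by fun_prop⟩
  refine ⟨A.symm ⁻¹' W, A.symm.continuous.continuousAt.preimage_mem_nhds (by simpa using hW),
    (puncturedMap A).comp (φ.comp p), (puncturedMap A).comp (ψ.comp p), fun w => ?_, fun w => ?_,
    (hd.comp_right p).comp_left _⟩
  · change A (φ (p w)) = _
    rw [hφ, map_sub]
    simp [p]
  · change A (ψ (p w)) = _
    rw [hψ, map_sub]
    simp [p]

/-- A punctured ball deformation retracts to small spheres: its inclusion has a homotopy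
inverse. -/
theorem exists_homotopy_inverse {W : Set E} {r : ℝ} (hr : 0 < r) (hW : Metric.ball x r ⊆ W) :
    ∃ s : C(Punctured E, {w : E // w ∈ W ∧ w ≠ x}),
      (∀ ψ : C({w : E // w ∈ W ∧ w ≠ x}, Punctured E), (∀ w, (ψ w : E) = w - x) →
        (ψ.comp s).Homotopic (ContinuousMap.id _) ∧
        (W = Metric.ball x r → (s.comp ψ).Homotopic (ContinuousMap.id _))) := by
  have hpos (v : Punctured E) : 0 < ‖v.1‖ := norm_pos_iff.2 v.2
  have hc : Continuous fun v : Punctured E => (r / 2 / ‖v.1‖) • v.1 := by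
    refine Continuous.smul (Continuous.div continuous_const (by fun_prop) fun v => (hpos v).ne')
      (by fun_prop)
  have hnorm (v : Punctured E) : ‖(r / 2 / ‖v.1‖) • v.1‖ = r / 2 := by
    rw [norm_smul, Real.norm_of_nonneg (by have := hpos v; positivity),
      div_mul_cancel₀ _ (hpos v).ne']
  let s : C(Punctured E, {w : E // w ∈ W ∧ w ≠ x}) :=
    ⟨fun v => ⟨x + (r / 2 / ‖v.1‖) • v.1, hW (by
      rw [mem_ball_iff_norm, add_sub_cancel_left, hnorm]; linarith), by
      rw [ne_eq, add_eq_left, ← norm_eq_zero, hnorm]; linarith⟩, by fun_prop⟩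
  refine ⟨s, fun ψ hψ => ⟨?_, ?_⟩⟩
  · have hs (v : Punctured E) : (ψ (s v) : E) = (r / 2 / ‖v.1‖) • v.1 := by
      rw [hψ]; exact add_sub_cancel_left _ _
    refine homotopic_subtype (fun q => ((1 - (q.1 : ℝ)) * (r / 2 / ‖q.2.1‖) + q.1) • q.2.1)
      ?_ (fun v => ?_) (fun v => ?_) (fun t v => ?_)
    · refine Continuous.smul (Continuous.add (Continuous.mul (by fun_prop)
        (Continuous.div continuous_const (by fun_prop) fun v => (hpos v.2).ne')) (by fun_prop))
        (by fun_prop)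
    · rw [ContinuousMap.comp_apply, hs]
      simp
    · simp
    · refine smul_ne_zero (ne_of_gt ?_) v.2
      have h1 : 0 < r / 2 / ‖v.1‖ := by have := hpos v; positivity
      rcases eq_or_lt_of_le t.2.1 with h | h
      · rw [← h]; simpa using h1
      · have := mul_nonneg (sub_nonneg.2 t.2.2) h1.le
        linarith
  · rintro rfl
    have hs (w : {w : E // w ∈ Metric.ball x r ∧ w ≠ x}) :
        (s (ψ w) : E) = x + (r / 2 / ‖w.1 - x‖) • (w.1 - x) := by
      rw [← hψ]; rfl
    have hw (w : {w : E // w ∈ Metric.ball x r ∧ w ≠ x}) : 0 < ‖w.1 - x‖ :=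
      norm_pos_iff.2 (sub_ne_zero.2 w.2.2)
    have hco (t : unitInterval) (w : {w : E // w ∈ Metric.ball x r ∧ w ≠ x}) :
        0 < (1 - (t : ℝ)) * (r / 2 / ‖w.1 - x‖) + t := by
      have h1 : 0 < r / 2 / ‖w.1 - x‖ := by have := hw w; positivity
      rcases eq_or_lt_of_le t.2.1 with h | h
      · rw [← h]; simpa using h1
      · have := mul_nonneg (sub_nonneg.2 t.2.2) h1.le
        linarith
    refine homotopic_subtype
      (fun q => x + ((1 - (q.1 : ℝ)) * (r / 2 / ‖q.2.1 - x‖) + q.1) • (q.2.1 - x))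
      ?_ (fun w => ?_) (fun w => ?_) (fun t w => ⟨?_, ?_⟩)
    · refine Continuous.add continuous_const (Continuous.smul (Continuous.add (Continuous.mul
        (by fun_prop) (Continuous.div continuous_const (by fun_prop) fun v => (hw v.2).ne'))
        (by fun_prop)) (by fun_prop))
    · rw [ContinuousMap.comp_apply, hs]
      simp
    · simp
    · rw [mem_ball_iff_norm, add_sub_cancel_left, norm_smul, Real.norm_of_nonneg (hco t w).le,
        add_mul, mul_assoc, div_mul_cancel₀ _ (hw w).ne']
      have h1 : ‖w.1 - x‖ < r := mem_ball_iff_norm.1 w.2.1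
      rcases eq_or_lt_of_le t.2.1 with h | h
      · rw [← h]; simp; linarith
      · have := mul_lt_mul_of_pos_left h1 h
        have h2 : (1 - (t : ℝ)) * (r / 2) ≤ (1 - t) * r :=
          mul_le_mul_of_nonneg_left (by linarith) (sub_nonneg.2 t.2.2)
        linarith
    · rw [ne_eq, add_eq_left]
      exact smul_ne_zero (hco t w).ne' (sub_ne_zero.2 w.2.2)

/-- On a common neighbourhood, composing with `s` makes both nζ and mζ homologous to the same image
of the generator ζ, and no nonzero multiple of ζ bounds. -/
theorem HasLocalDegree.unique (hE : HasGenerator k (Punctured E)) (hn : HasLocalDegree k f x n)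
    (hm : HasLocalDegree k f x m) : n = m := by
  obtain ⟨V, hV, φ', ψ', hφ', hψ', hd'⟩ := hm
  obtain ⟨W, hW, hWV, φ, ψ, hφ, hψ, hd⟩ := hn.exists_subset hV
  obtain ⟨r, hr, hrW⟩ := Metric.mem_nhds_iff.1 hW
  obtain ⟨s, hs⟩ := exists_homotopy_inverse hr hrW
  have h1 : φ'.comp (puncturedInclusion hWV x) = φ := by
    ext w
    rw [hφ]
    exact hφ' _
  have h2 : ψ'.comp (puncturedInclusion hWV x) = ψ := by
    ext w
    rw [hψ]
    exact hψ' _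
  replace hd' := hd'.comp_right (puncturedInclusion hWV x)
  rw [h1, h2] at hd'
  obtain ⟨ζ, hζ⟩ := hE
  have hA := (hd.comp_right s).congr (.refl _) (hs ψ hψ).1
  have hB := (hd'.comp_right s).congr (.refl _) (hs ψ hψ).1
  obtain ⟨y, hy⟩ := hA ζ hζ.isCycle
  obtain ⟨y', hy'⟩ := hB ζ hζ.isCycle
  refine sub_eq_zero.1 (hζ.eq_zero (n - m) (y' - y) ?_)
  rw [map_sub, hy, hy', map_id, sub_smul]
  abel

/-- An endomorphism of an infinite cyclic group is multiplication by an integer. Here it is induced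
by `φ.comp s`, and the homotopy inverse of `s` brings the relation back to the punctured ball. -/
theorem exists_hasLocalDegree (hE : HasGenerator k (Punctured E)) {W : Set E} (hW : W ∈ 𝓝 x)
    (hc : ContinuousOn f W) (hi : Set.InjOn f W) : ∃ n, HasLocalDegree k f x n := by
  obtain ⟨r, hr, hrW⟩ := Metric.mem_nhds_iff.1 hW
  obtain ⟨s, hs⟩ := exists_homotopy_inverse (x := x) hr subset_rfl
  let φ : C({w : E // w ∈ Metric.ball x r ∧ w ≠ x}, Punctured E) :=
    ⟨fun w => ⟨f w - f x, fun h => w.2.2 (hi (hrW w.2.1) (mem_of_mem_nhds hW)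
      (sub_eq_zero.1 h))⟩, by
      refine Continuous.subtype_mk (Continuous.sub ?_ continuous_const) _
      exact hc.comp_continuous continuous_subtype_val fun w => hrW w.2.1⟩
  let ψ : C({w : E // w ∈ Metric.ball x r ∧ w ≠ x}, Punctured E) :=
    ⟨fun w => ⟨w - x, sub_ne_zero.2 w.2.2⟩, by fun_prop⟩
  obtain ⟨h1, h2⟩ := hs ψ fun w => rfl
  obtain ⟨ζ, hζ⟩ := hE
  obtain ⟨n, e, he⟩ := hζ.exists_eq _ ((hζ.isCycle.map s).map φ)
  have hn : DegRel k n (φ.comp s) (ContinuousMap.id _) := by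
    intro z hz
    obtain ⟨m, y, hy⟩ := hζ.exists_eq z hz
    refine ⟨map (φ.comp s) _ y + m • e - n • y, ?_⟩
    rw [map_sub, map_add, ← map_bd, map_smul, map_smul, hy, he, map_sub, map_smul, ← map_map,
      ← map_map, map_id, smul_sub, smul_sub, smul_comm m n]
    abel
  refine ⟨n, Metric.ball x r, Metric.ball_mem_nhds x hr, φ, ψ, fun w => rfl, fun w => rfl, ?_⟩
  refine (hn.comp_right ψ).congr ?_ (.refl _)
  rw [ContinuousMap.comp_assoc]
  exact ((ContinuousMap.Homotopic.refl φ).comp (h2 rfl)).symm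

/-- Slide the centre along the segment from `y` to `x`, translating the ball with it. Injectivity
keeps the differences of values nonzero throughout; both radii are `r / 2` so that the moving ball
stays within distance `r` of `x`. -/
theorem HasLocalDegree.eventually (h : HasLocalDegree k f x n) {O : Set E} (hO : O ∈ 𝓝 x)
    (hc : ContinuousOn f O) (hi : Set.InjOn f O) : ∀ᶠ y in 𝓝 x, HasLocalDegree k f y n := by
  obtain ⟨W, hW, hWO, φ, ψ, hφ, hψ, hd⟩ := h.exists_subset hO
  obtain ⟨r, hr, hrW⟩ := Metric.mem_nhds_iff.1 hW
  filter_upwards [Metric.ball_mem_nhds x (half_pos hr)] with y hy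
  have hyx : ‖y - x‖ < r / 2 := mem_ball_iff_norm.1 hy
  let p : C({w : E // w ∈ Metric.ball y (r / 2) ∧ w ≠ y}, {w : E // w ∈ W ∧ w ≠ x}) :=
    ⟨fun w => ⟨w.1 + (x - y), hrW (by
      have := w.2.1
      rw [mem_ball_iff_norm] at this ⊢
      rw [show w.1 + (x - y) - x = w.1 - y by abel]
      linarith), fun h => w.2.2 (by
        rw [← sub_eq_zero] at h ⊢
        rw [← h]; abel)⟩, by fun_prop⟩
  have hin (t : unitInterval) {w : E} (hw : w ∈ Metric.ball y (r / 2)) :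
      w + (t : ℝ) • (x - y) ∈ W := by
    refine hrW ?_
    rw [mem_ball_iff_norm] at hw ⊢
    rw [show w + (t : ℝ) • (x - y) - x = (w - y) + (1 - (t : ℝ)) • (y - x) by
      rw [sub_smul, one_smul, ← neg_sub y x, smul_neg]; abel]
    refine (norm_add_le _ _).trans_lt ?_
    rw [norm_smul, Real.norm_of_nonneg (sub_nonneg.2 t.2.2)]
    have : (1 - (t : ℝ)) * ‖y - x‖ ≤ 1 * ‖y - x‖ :=
      mul_le_mul_of_nonneg_right (by linarith [t.2.1]) (norm_nonneg _)
    linarith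
  have hne (t : unitInterval) (w : {w : E // w ∈ Metric.ball y (r / 2) ∧ w ≠ y}) :
      f (w.1 + (t : ℝ) • (x - y)) - f (y + (t : ℝ) • (x - y)) ≠ 0 := by
    intro h
    have := hi (hWO (hin t w.2.1)) (hWO (hin t (Metric.mem_ball_self (half_pos hr))))
      (sub_eq_zero.1 h)
    exact w.2.2 (add_right_cancel this)
  have hcont : Continuous fun q : unitInterval × {w : E // w ∈ Metric.ball y (r / 2) ∧ w ≠ y} =>
      f (q.2.1 + (q.1 : ℝ) • (x - y)) - f (y + (q.1 : ℝ) • (x - y)) :=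
    Continuous.sub
      (ContinuousOn.comp_continuous (f := fun q : unitInterval ×
          {w : E // w ∈ Metric.ball y (r / 2) ∧ w ≠ y} => q.2.1 + (q.1 : ℝ) • (x - y))
        (hc.mono hWO) (by fun_prop) (fun q => hin q.1 q.2.2.1))
      (ContinuousOn.comp_continuous (f := fun q : unitInterval ×
          {w : E // w ∈ Metric.ball y (r / 2) ∧ w ≠ y} => y + (q.1 : ℝ) • (x - y))
        (hc.mono hWO) (by fun_prop) (fun q => hin q.1 (Metric.mem_ball_self (half_pos hr))))
  let φ' : C({w : E // w ∈ Metric.ball y (r / 2) ∧ w ≠ y}, Punctured E) :=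
    ⟨fun w => ⟨f w - f y, by simpa using hne 0 w⟩, by
      refine Continuous.subtype_mk ?_ _
      simpa [Function.comp_def] using hcont.comp (Continuous.prodMk_right (0 : unitInterval))⟩
  refine ⟨Metric.ball y (r / 2), Metric.ball_mem_nhds y (half_pos hr), φ', ψ.comp p,
    fun w => rfl, fun w => ?_, (hd.comp_right p).congr ?_ (.refl _)⟩
  · rw [ContinuousMap.comp_apply, hψ]
    change w.1 + (x - y) - x = _
    abel
  · refine homotopic_subtype _ hcont (fun w => ?_) (fun w => ?_) hne
    · simp [φ']
    · rw [ContinuousMap.comp_apply, hφ]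
      simp [p]

theorem isOpen_preimage_axisCompl {X : Type} [TopologicalSpace X] (G : C(X, Punctured (E × ℝ)))
    (s : ℝ) : IsOpen (G ⁻¹' axisCompl E s) := (isOpen_axisCompl s).preimage G.continuous

theorem preimage_axisCompl_union {X : Type} [TopologicalSpace X] (G : C(X, Punctured (E × ℝ))) :
    G ⁻¹' axisCompl E 1 ∪ G ⁻¹' axisCompl E (-1) = Set.univ := by
  rw [← Set.preimage_union, axisCompl_union, Set.preimage_univ]

/-- The product map preserves the two axis complements, since it fixes the last coordinate. On their
overlap only the `E`-component matters up to homotopy, where the given relation applies;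
Mayer–Vietoris raises the index by one. -/
theorem HasLocalDegree.prod_id (h : HasLocalDegree k f x n) {O : Set E} (hO : O ∈ 𝓝 x)
    (hc : ContinuousOn f O) (t : ℝ) :
    HasLocalDegree (k + 1) (fun p : E × ℝ => (f p.1, p.2)) (x, t) n := by
  obtain ⟨W, hW, hWO, φ, ψ, hφ, hψ, hd⟩ := h.exists_subset hO
  let X := {p : E × ℝ // p ∈ W ×ˢ Set.univ ∧ p ≠ (x, t)}
  have hf (p : X) (hp : p.1.1 ≠ x) : f p.1.1 - f x ≠ 0 := by
    rw [← hφ ⟨p.1.1, p.2.1.1, hp⟩]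
    exact (φ _).2
  let F : C(X, Punctured (E × ℝ)) := ⟨fun p => ⟨(f p.1.1 - f x, p.1.2 - t), fun h => by
      rw [Prod.mk_eq_zero] at h
      by_cases hp : p.1.1 = x
      · exact p.2.2 (Prod.ext hp (sub_eq_zero.1 h.2))
      · exact hf p hp h.1⟩, by
      refine Continuous.subtype_mk (Continuous.prodMk (Continuous.sub ?_ continuous_const)
        (by fun_prop)) _
      exact hc.comp_continuous (by fun_prop) fun p => hWO p.2.1.1⟩
  let G : C(X, Punctured (E × ℝ)) :=
    ⟨fun p => ⟨p.1 - (x, t), sub_ne_zero.2 p.2.2⟩, by fun_prop⟩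
  have hF (s : ℝ) : Set.MapsTo F (G ⁻¹' axisCompl E s) (axisCompl E s) := by
    rintro p (hp | hp)
    · exact Or.inl (hf p (sub_ne_zero.1 hp))
    · exact Or.inr hp
  let π : C((G ⁻¹' axisCompl E 1 ∩ G ⁻¹' axisCompl E (-1) : Set X), {w : E // w ∈ W ∧ w ≠ x}) :=
    ⟨fun p => ⟨p.1.1.1, p.1.2.1.1, sub_ne_zero.1 (mem_axisCompl_inter.1 p.2)⟩,
      Continuous.subtype_mk (continuous_fst.comp
        (continuous_subtype_val.comp continuous_subtype_val)) _⟩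
  refine ⟨W ×ˢ Set.univ, prod_mem_nhds hW Filter.univ_mem, F, G, fun p => rfl, fun p => rfl, ?_⟩
  refine DegRel.of_cover (isOpen_preimage_axisCompl G 1) (isOpen_preimage_axisCompl G (-1))
    (preimage_axisCompl_union G) (acyclic_axisCompl one_ne_zero _)
    (acyclic_axisCompl (neg_ne_zero.2 one_ne_zero) _) (hF 1) (hF (-1)) (Set.mapsTo_preimage _ _)
    (Set.mapsTo_preimage _ _)
    (f := ⟨fun p => ⟨F p, hF 1 p.2.1, hF (-1) p.2.2⟩, by fun_prop⟩)
    (g := ⟨fun p => ⟨G p, p.2⟩, by fun_prop⟩)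
    (((hd.comp_right π).comp_left (equatorIncl E)).congr
      (homotopic_of_fst_eq fun p => ?_) (homotopic_of_fst_eq fun p => ?_))
    (fun p => rfl) (fun p => rfl)
  · exact (hφ (π p)).symm
  · exact hψ (π p)

/-- The reflection exchanges the two axis complements, while on their overlap it is homotopic to the
unreflected displacement. The exchange alone produces the sign. -/
theorem hasLocalDegree_reflection (x : E × ℝ) :
    HasLocalDegree (k + 1) (fun p : E × ℝ => (p.1, -p.2)) x (-1) := by
  let X := {p : E × ℝ // p ∈ Set.univ ∧ p ≠ x}
  let F : C(X, Punctured (E × ℝ)) := ⟨fun p => ⟨(p.1.1 - x.1, -p.1.2 - -x.2), fun h => by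
      rw [Prod.mk_eq_zero, sub_eq_zero, sub_eq_zero, neg_inj] at h
      exact p.2.2 (Prod.ext h.1 h.2)⟩, by fun_prop⟩
  let G : C(X, Punctured (E × ℝ)) := ⟨fun p => ⟨p.1 - x, sub_ne_zero.2 p.2.2⟩, by fun_prop⟩
  have hF (s : ℝ) : Set.MapsTo F (G ⁻¹' axisCompl E s) (axisCompl E (-s)) := by
    rintro p (hp | hp)
    · exact Or.inl hp
    · refine Or.inr ?_
      change 0 < -s * (-p.1.2 - -x.2)
      have : 0 < s * (p.1.2 - x.2) := hp
      linarith
  have hF' : Set.MapsTo F (G ⁻¹' axisCompl E (-1)) (axisCompl E 1) := by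
    simpa using hF (-1)
  refine ⟨Set.univ, Filter.univ_mem, F, G, fun p => rfl, fun p => rfl, ?_⟩
  exact DegRel.of_cover_swap (isOpen_preimage_axisCompl G 1) (isOpen_preimage_axisCompl G (-1))
    (preimage_axisCompl_union G) (acyclic_axisCompl one_ne_zero _)
    (acyclic_axisCompl (neg_ne_zero.2 one_ne_zero) _) (hF 1) hF' (Set.mapsTo_preimage _ _)
    (Set.mapsTo_preimage _ _)
    (f := ⟨fun p => ⟨F p, hF' p.2.2, hF 1 p.2.1⟩, by fun_prop⟩)
    (g := ⟨fun p => ⟨G p, p.2⟩, by fun_prop⟩)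
    (DegRel.of_homotopic (homotopic_of_fst_eq fun p => rfl))
    (fun p => rfl) (fun p => rfl)

end LocalDegree

/-! ### Local degree as an integer-valued function -/

section LocalDegree

variable {E F : Type} [NormedAddCommGroup E] [NormedSpace ℝ E]
  [NormedAddCommGroup F] [NormedSpace ℝ F]

/-- The map `f` is continuous and injective near `x`. -/
def IsLocalEmbeddingAt {X Y : Type*} [TopologicalSpace X] [TopologicalSpace Y] (f : X → Y)
    (x : X) : Prop := ∃ W ∈ 𝓝 x, ContinuousOn f W ∧ Set.InjOn f W

theorem IsLocalEmbeddingAt.continuousAt {X Y : Type*} [TopologicalSpace X] [TopologicalSpace Y]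
    {f : X → Y} {x : X} (h : IsLocalEmbeddingAt f x) : ContinuousAt f x := by
  obtain ⟨W, hW, hc, -⟩ := h
  exact hc.continuousAt hW

theorem IsLocalEmbeddingAt.eventually {X Y : Type*} [TopologicalSpace X] [TopologicalSpace Y]
    {f : X → Y} {x : X} (h : IsLocalEmbeddingAt f x) : ∀ᶠ y in 𝓝 x, IsLocalEmbeddingAt f y := by
  obtain ⟨W, hW, h⟩ := h
  filter_upwards [eventually_mem_nhds_iff.2 hW] with y hy using ⟨W, hy, h⟩

theorem IsLocalEmbeddingAt.comp {X Y Z : Type*} [TopologicalSpace X] [TopologicalSpace Y]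
    [TopologicalSpace Z] {g : Y → Z} {f : X → Y} {x : X} (hg : IsLocalEmbeddingAt g (f x))
    (hf : IsLocalEmbeddingAt f x) : IsLocalEmbeddingAt (fun y => g (f y)) x := by
  have hfx := hf.continuousAt
  obtain ⟨V, hV, hgc, hgi⟩ := hg
  obtain ⟨W, hW, hfc, hfi⟩ := hf
  refine ⟨W ∩ f ⁻¹' V, Filter.inter_mem hW (hfx.preimage_mem_nhds hV), ?_, ?_⟩
  · exact hgc.comp (hfc.mono Set.inter_subset_left) fun y hy => hy.2
  · exact hgi.comp (hfi.mono Set.inter_subset_left) fun y hy => hy.2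

theorem IsLocalEmbeddingAt.congr {X Y : Type*} [TopologicalSpace X] [TopologicalSpace Y]
    {f g : X → Y} {x : X} (h : IsLocalEmbeddingAt f x) (hfg : g =ᶠ[𝓝 x] f) :
    IsLocalEmbeddingAt g x := by
  obtain ⟨W, hW, hc, hi⟩ := h
  have hs : W ∩ {y | g y = f y} ⊆ W := Set.inter_subset_left
  exact ⟨W ∩ {y | g y = f y}, Filter.inter_mem hW hfg, (hc.mono hs).congr fun y hy => hy.2,
    (hi.mono hs).congr fun y hy => hy.2.symm⟩

theorem OpenPartialHomeomorph.isLocalEmbeddingAt {X Y : Type*} [TopologicalSpace X]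
    [TopologicalSpace Y] (f : OpenPartialHomeomorph X Y) {x : X} (hx : x ∈ f.source) :
    IsLocalEmbeddingAt f x :=
  ⟨f.source, f.open_source.mem_nhds hx, f.continuousOn, f.injOn⟩

theorem HasLocalDegree.of_conj {k : ℕ} {f : E → E} {f' : F → F} {x : E} {n : ℤ}
    (h : HasLocalDegree k f x n) (A : E ≃L[ℝ] F) (hf' : ∀ y, f' (A y) = A (f y)) :
    HasLocalDegree k f' (A x) n := by
  convert h.conj A using 1
  funext y
  rw [← hf', A.apply_symm_apply]

/-- The factor `F` is split into lines, which are added one at a time by `prod_id`. -/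
theorem HasLocalDegree.prod_right [FiniteDimensional ℝ F] {k m : ℕ} {f : E → E} {x : E} {n : ℤ}
    (h : HasLocalDegree k f x n) (hf : IsLocalEmbeddingAt f x) (hm : Module.finrank ℝ F = m)
    (y : F) : HasLocalDegree (k + m) (fun p : E × F => (f p.1, p.2)) (x, y) n := by
  induction m generalizing F with
  | zero =>
    have : Subsingleton F := Module.finrank_zero_iff.1 hm
    let _ : Unique F := uniqueOfSubsingleton y
    exact h.of_conj (ContinuousLinearEquiv.prodUnique ℝ E F).symm fun p => rfl
  | succ m ih =>
    have B : F ≃L[ℝ] EuclideanSpace ℝ (Fin m) × ℝ :=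
      ContinuousLinearEquiv.ofFinrankEq (by simp [hm])
    obtain ⟨W, hW, hc, hi⟩ := hf
    have h1 := ih (F := EuclideanSpace ℝ (Fin m)) (by simp) (B y).1
    have h2 := h1.prod_id (O := W ×ˢ Set.univ) (prod_mem_nhds hW Filter.univ_mem)
      (ContinuousOn.prodMk (hc.comp continuous_fst.continuousOn fun p hp => hp.1)
        continuous_snd.continuousOn) (B y).2
    have hA := h2.of_conj (f' := fun p : E × F => (f p.1, p.2))
      ((ContinuousLinearEquiv.prodAssoc ℝ E (EuclideanSpace ℝ (Fin m)) ℝ).trans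
      ((ContinuousLinearEquiv.refl ℝ E).prodCongr B.symm)) fun p => rfl
    have hy : (x, y) = ((ContinuousLinearEquiv.prodAssoc ℝ E (EuclideanSpace ℝ (Fin m)) ℝ).trans
      ((ContinuousLinearEquiv.refl ℝ E).prodCongr B.symm)) ((x, (B y).1), (B y).2) :=
      Prod.ext rfl (B.symm_apply_apply y).symm
    rw [hy]
    exact hA

variable [FiniteDimensional ℝ E] [FiniteDimensional ℝ F]

open Classical in
/-- The local degree of a self-map of a finite-dimensional space at a point (`0` if undefined). -/
noncomputable def localDegree (f : E → E) (x : E) : ℤ :=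
  if h : ∃ n, HasLocalDegree (Module.finrank ℝ E) f x n then h.choose else 0

variable {f g : E → E} {x : E} {n : ℤ}

theorem HasLocalDegree.localDegree_eq (h : HasLocalDegree (Module.finrank ℝ E) f x n) :
    localDegree f x = n := by
  have h' : ∃ n, HasLocalDegree (Module.finrank ℝ E) f x n := ⟨n, h⟩
  rw [localDegree, dif_pos h']
  exact h'.choose_spec.unique (hasGenerator_punctured rfl) h

theorem IsLocalEmbeddingAt.hasLocalDegree (h : IsLocalEmbeddingAt f x) :
    HasLocalDegree (Module.finrank ℝ E) f x (localDegree f x) := by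
  obtain ⟨W, hW, hc, hi⟩ := h
  obtain ⟨n, hn⟩ := exists_hasLocalDegree (hasGenerator_punctured rfl) hW hc hi
  rw [hn.localDegree_eq]
  exact hn

theorem localDegree_congr (h : IsLocalEmbeddingAt f x) (hfg : g =ᶠ[𝓝 x] f) :
    localDegree g x = localDegree f x :=
  (h.hasLocalDegree.congr hfg).localDegree_eq

theorem localDegree_id (x : E) : localDegree (fun y => y) x = 1 :=
  (hasLocalDegree_id x).localDegree_eq

theorem localDegree_comp (hg : IsLocalEmbeddingAt g (f x)) (hf : IsLocalEmbeddingAt f x) :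
    localDegree (fun y => g (f y)) x = localDegree g (f x) * localDegree f x :=
  (hg.hasLocalDegree.comp hf.hasLocalDegree hf.continuousAt).localDegree_eq

theorem localDegree_conj (A : E ≃L[ℝ] F) (hf : IsLocalEmbeddingAt f x) :
    localDegree (fun y => A (f (A.symm y))) (A x) = localDegree f x := by
  have h := hf.hasLocalDegree.conj A
  rw [A.toLinearEquiv.finrank_eq] at h
  exact h.localDegree_eq

theorem eventually_localDegree_eq (h : IsLocalEmbeddingAt f x) :
    ∀ᶠ y in 𝓝 x, localDegree f y = localDegree f x := by
  have hd := h.hasLocalDegree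
  obtain ⟨W, hW, hc, hi⟩ := h
  filter_upwards [hd.eventually hW hc hi] with y hy using hy.localDegree_eq

theorem localDegree_prod (hf : IsLocalEmbeddingAt f x) (y : F) :
    localDegree (fun p : E × F => (f p.1, p.2)) (x, y) = localDegree f x := by
  have h := hf.hasLocalDegree.prod_right hf (F := F) rfl y
  rw [← Module.finrank_prod] at h
  exact h.localDegree_eq

theorem OpenPartialHomeomorph.localDegree_symm_mul (f : OpenPartialHomeomorph E E)
    (hx : x ∈ f.source) : localDegree f.symm (f x) * localDegree f x = 1 := by
  rw [← localDegree_comp (f.symm.isLocalEmbeddingAt (f.map_source hx)) (f.isLocalEmbeddingAt hx),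
    ← localDegree_id x]
  exact localDegree_congr ⟨Set.univ, Filter.univ_mem, continuousOn_id, Set.injOn_id _⟩
    (f.eventually_left_inverse hx)

theorem OpenPartialHomeomorph.localDegree_eq_or (f : OpenPartialHomeomorph E E)
    (hx : x ∈ f.source) : localDegree f x = 1 ∨ localDegree f x = -1 :=
  Int.isUnit_iff.1 (IsUnit.of_mul_eq_one _ ((mul_comm _ _).trans (f.localDegree_symm_mul hx)))

/-- Reflections have local degree `-1`. -/
theorem localDegree_reflection {φ : Module.Dual ℝ E} {v : E} (h : φ v = 2) (x : E) :
    localDegree (fun y => y - φ y • v) x = -1 := by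
  -- In the coordinates (u, t) ↦ u + t v the map becomes (u, t) ↦ (u, -t). The factors 1/2 in the
  -- inverse come from φ v = 2.
  let B : (LinearMap.ker φ × ℝ) ≃ₗ[ℝ] E :=
    LinearEquiv.ofLinearMap ((LinearMap.ker φ).subtype.coprod (LinearMap.toSpanSingleton ℝ E v))
      (LinearMap.prod ((LinearMap.id - (1 / 2 : ℝ) • φ.smulRight v).codRestrict (LinearMap.ker φ)
        (fun y => by simp [h]; ring)) ((1 / 2 : ℝ) • φ))
      (by ext y; simp; module)
      (by
        refine LinearMap.prod_ext ?_ ?_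
        · ext y <;> simp
        · ext <;> simp [h])
  have hB (p : LinearMap.ker φ × ℝ) : B p = p.1 + p.2 • v := by simp [B]
  have h1 := (hasLocalDegree_reflection (k := Module.finrank ℝ (LinearMap.ker φ))
    (B.symm x)).conj B.toContinuousLinearEquiv
  have hfin : Module.finrank ℝ (LinearMap.ker φ) + 1 = Module.finrank ℝ E := by
    rw [← B.finrank_eq]; simp
  rw [hfin] at h1
  refine HasLocalDegree.localDegree_eq ?_
  convert h1 using 1
  · funext y
    obtain ⟨p, rfl⟩ := B.surjective y
    have h2 : B.toContinuousLinearEquiv.symm (B p) = p := B.symm_apply_apply p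
    have h3 : φ p.1 = 0 := p.1.2
    rw [h2]
    change _ = B (p.1, -p.2)
    rw [hB, hB, map_add, map_smul, h, h3]
    module
  · exact (B.apply_symm_apply x).symm

theorem exists_localDegree_eq_neg_one (hE : 0 < Module.finrank ℝ E) :
    ∃ R : E ≃L[ℝ] E, ∀ x, localDegree R x = -1 := by
  have : Nontrivial E := Module.nontrivial_of_finrank_pos hE
  obtain ⟨v, hv⟩ := exists_ne (0 : E)
  obtain ⟨φ, hφ⟩ := Module.Projective.exists_dual_eq_one ℝ hv
  have h2 : ((2 : ℝ) • φ) v = 2 := by simp [hφ]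
  exact ⟨(Module.reflection h2).toContinuousLinearEquiv, localDegree_reflection h2⟩

/-- A transposition of coordinates i and j is the reflection along e_i - e_j for the functional x_i
- x_j; general permutations follow from the chain rule. -/
theorem localDegree_comp_perm {ι : Type} [Fintype ι] [DecidableEq ι] (e : Equiv.Perm ι)
    (x : ι → ℝ) : localDegree (fun y : ι → ℝ => y ∘ e) x = Equiv.Perm.sign e := by
  have hemb (e : Equiv.Perm ι) (x : ι → ℝ) :
      IsLocalEmbeddingAt (fun y : ι → ℝ => y ∘ e) x :=
    ⟨Set.univ, Filter.univ_mem, by fun_prop, fun y _ z _ h => by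
      funext i
      simpa using congrFun h (e.symm i)⟩
  induction e using Equiv.Perm.swap_induction_on generalizing x with
  | one => simpa using localDegree_id x
  | swap_mul e i j hij ih =>
    have h1 : (fun y : ι → ℝ => y ∘ (Equiv.swap i j * e)) =
        fun y => (fun y : ι → ℝ => y ∘ e) ((fun y : ι → ℝ => y ∘ Equiv.swap i j) y) := rfl
    rw [h1, localDegree_comp (hemb _ _) (hemb _ _), ih]
    let φ : Module.Dual ℝ (ι → ℝ) := LinearMap.proj (R := ℝ) (φ := fun _ => ℝ) i -
      LinearMap.proj (R := ℝ) (φ := fun _ => ℝ) j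
    have hφ : φ (Pi.single i 1 - Pi.single j 1) = 2 := by
      simp [φ, hij, hij.symm]
      norm_num
    have h2 : (fun y : ι → ℝ => y ∘ Equiv.swap i j) =
        fun y => y - φ y • (Pi.single i 1 - Pi.single j 1) := by
      funext y l
      by_cases hi : l = i
      · subst hi
        simp [φ, hij]
      · by_cases hj : l = j
        · subst hj
          simp [φ, hij.symm]
        · simp [hi, hj, Equiv.swap_apply_of_ne_of_ne]
    rw [h2, localDegree_reflection hφ]
    simp [Equiv.Perm.sign_swap hij]

/-- The degree of a permutation of `n` blocks of size `d`. -/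
theorem localDegree_block_perm {n d : ℕ} (σ : Equiv.Perm (Fin n))
    (x : Fin n → EuclideanSpace ℝ (Fin d)) :
    localDegree (fun y : Fin n → EuclideanSpace ℝ (Fin d) => y ∘ σ) x =
      (Equiv.Perm.sign σ : ℤ) ^ d := by
  let A : (Fin n × Fin d → ℝ) ≃ₗ[ℝ] (Fin n → EuclideanSpace ℝ (Fin d)) :=
    { toFun := fun y i => WithLp.toLp 2 fun j => y (i, j)
      invFun := fun z p => z p.1 p.2
      map_add' := fun _ _ => rfl
      map_smul' := fun _ _ => rfl
      left_inv := fun _ => rfl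
      right_inv := fun _ => rfl }
  have h0 : IsLocalEmbeddingAt (fun y : Fin n × Fin d → ℝ =>
      y ∘ (Equiv.prodCongrLeft fun _ : Fin d => σ)) (A.symm x) :=
    ⟨Set.univ, Filter.univ_mem, by fun_prop, fun y _ z _ h => by
      funext i
      simpa only [Function.comp_apply, Equiv.apply_symm_apply] using
        congrFun h ((Equiv.prodCongrLeft fun _ : Fin d => σ).symm i)⟩
  have h1 := localDegree_conj A.toContinuousLinearEquiv h0
  -- On the scalar coordinates `Fin n × Fin d` the permutation acts by σ once for each of the d
  -- second indices.
  rw [localDegree_comp_perm, Equiv.Perm.sign_prodCongrLeft] at h1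
  simp at h1
  refine Eq.trans ?_ h1
  congr 1

end LocalDegree

/-! ### Orientation preserving maps have local degree one -/

/-- The open ball of radius `r` about `x` without its centre. -/
abbrev PuncturedBall {E : Type} [NormedAddCommGroup E] (x : E) (r : ℝ) : Type :=
  {w : E // w ∈ Metric.ball x r ∧ w ≠ x}

/-- Radial homotopies compare one sphere of fixed radius with arbitrarily small punctured
neighbourhoods. In particular the condition does not depend on the admissible radius. -/
theorem degRel_sphereMap_iff {d k : ℕ} {n : ℤ}
    (f : OpenPartialHomeomorph (EuclideanSpace ℝ (Fin d)) (EuclideanSpace ℝ (Fin d)))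
    (x : EuclideanSpace ℝ (Fin d)) (r : ℝ) (hr : 0 < r) (hx : Metric.closedBall x r ⊆ f.source) :
    DegRel k n (sphereMap f x r hr hx) (sphereInclusion d) ↔ HasLocalDegree k f x n := by
  have hxs : x ∈ f.source := hx (Metric.mem_closedBall_self hr.le)
  constructor
  · intro h
    have hpos (w : PuncturedBall x r) : 0 < ‖w.1 - x‖ := norm_pos_iff.2 (sub_ne_zero.2 w.2.2)
    have hlt (w : PuncturedBall x r) : ‖w.1 - x‖ < r := mem_ball_iff_norm.1 w.2.1
    have hinv : Continuous fun w : PuncturedBall x r => ‖w.1 - x‖⁻¹ :=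
      Continuous.inv₀ (by fun_prop) fun w => (hpos w).ne'
    let u : C(PuncturedBall x r, Metric.sphere (0 : EuclideanSpace ℝ (Fin d)) 1) :=
      ⟨fun w => ⟨‖w.1 - x‖⁻¹ • (w.1 - x), by
        rw [mem_sphere_zero_iff_norm, norm_smul, norm_inv, norm_norm,
          inv_mul_cancel₀ (hpos w).ne']⟩, by fun_prop⟩
    let φ : C(PuncturedBall x r, Punctured (EuclideanSpace ℝ (Fin d))) :=
      ⟨fun w => ⟨f w - f x, fun h => w.2.2 (f.injOn (hx (Metric.ball_subset_closedBall w.2.1))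
        hxs (sub_eq_zero.1 h))⟩, by
        refine Continuous.subtype_mk (Continuous.sub ?_ continuous_const) _
        exact f.continuousOn.comp_continuous continuous_subtype_val
          fun w => hx (Metric.ball_subset_closedBall w.2.1)⟩
    let ψ : C(PuncturedBall x r, Punctured (EuclideanSpace ℝ (Fin d))) :=
      ⟨fun w => ⟨w - x, sub_ne_zero.2 w.2.2⟩, by fun_prop⟩
    refine ⟨Metric.ball x r, Metric.ball_mem_nhds x hr, φ, ψ, fun w => rfl, fun w => rfl,
      (h.comp_right u).congr ?_ ?_⟩
    · have hc (t : unitInterval) (w : PuncturedBall x r) :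
          0 < (1 - (t : ℝ)) + t * (r * ‖w.1 - x‖⁻¹) := by
        have h1 : 0 < r * ‖w.1 - x‖⁻¹ := mul_pos hr (inv_pos.2 (hpos w))
        rcases eq_or_lt_of_le t.2.1 with h | h
        · rw [← h]; simp
        · have := mul_pos h h1
          linarith [t.2.2]
      have hmem (t : unitInterval) (w : PuncturedBall x r) :
          x + ((1 - (t : ℝ)) + t * (r * ‖w.1 - x‖⁻¹)) • (w.1 - x) ∈ f.source := by
        refine hx ?_
        rw [mem_closedBall_iff_norm, add_sub_cancel_left, norm_smul,
          Real.norm_of_nonneg (hc t w).le, add_mul, mul_assoc, mul_assoc,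
          inv_mul_cancel₀ (hpos w).ne', mul_one]
        have := mul_le_mul_of_nonneg_left (hlt w).le (sub_nonneg.2 t.2.2)
        linarith
      refine homotopic_subtype
        (fun q : unitInterval × PuncturedBall x r =>
          f (x + ((1 - (q.1 : ℝ)) + q.1 * (r * ‖q.2.1 - x‖⁻¹)) • (q.2.1 - x)) - f x)
        ?_ (fun w => ?_) (fun w => ?_) (fun t w => ?_)
      · refine Continuous.sub ?_ continuous_const
        have hinv' : Continuous fun q : unitInterval × PuncturedBall x r => ‖q.2.1 - x‖⁻¹ :=
          hinv.comp continuous_snd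
        exact f.continuousOn.comp_continuous (by fun_prop) fun q => hmem q.1 q.2
      · simp [φ]
      · simp only [Set.Icc.coe_one, sub_self, one_mul, zero_add, mul_smul]
        rfl
      · intro h
        have h2 := f.injOn (hmem t w) hxs (sub_eq_zero.1 h)
        rw [add_eq_left] at h2
        exact smul_ne_zero (hc t w).ne' (sub_ne_zero.2 w.2.2) h2
    · refine homotopic_subtype
        (fun q : unitInterval × PuncturedBall x r =>
          ((1 - (q.1 : ℝ)) * ‖q.2.1 - x‖⁻¹ + q.1) • (q.2.1 - x))
        ?_ (fun w => ?_) (fun w => ?_) (fun t w => ?_)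
      · have hinv' : Continuous fun q : unitInterval × PuncturedBall x r => ‖q.2.1 - x‖⁻¹ :=
          hinv.comp continuous_snd
        fun_prop
      · simp [u, sphereInclusion]
      · simp [ψ]
      · refine smul_ne_zero (ne_of_gt ?_) (sub_ne_zero.2 w.2.2)
        have h1 : 0 < ‖w.1 - x‖⁻¹ := inv_pos.2 (hpos w)
        rcases eq_or_lt_of_le t.2.1 with h | h
        · rw [← h]; simpa using hpos w
        · have := mul_nonneg (sub_nonneg.2 t.2.2) h1.le
          linarith
  · rintro ⟨W, hW, φ, ψ, hφ, hψ, hd⟩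
    obtain ⟨δ, hδ, hδW⟩ := Metric.mem_nhds_iff.1 hW
    -- The ε-sphere lies in `W`, and as ε ≤ r the radius can be shrunk from r to ε inside the domain
    -- of `f`.
    set ε := min r (δ / 2) with hε
    have hε0 : 0 < ε := lt_min hr (half_pos hδ)
    let s : C(Metric.sphere (0 : EuclideanSpace ℝ (Fin d)) 1,
        {w : EuclideanSpace ℝ (Fin d) // w ∈ W ∧ w ≠ x}) :=
      ⟨fun u => ⟨x + ε • u.1, hδW (by
        rw [mem_ball_iff_norm, add_sub_cancel_left, norm_smul, Real.norm_of_nonneg hε0.le,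
          mem_sphere_zero_iff_norm.1 u.2, mul_one]
        exact (min_le_right _ _).trans_lt (half_lt_self hδ)), by
        rw [ne_eq, add_eq_left]
        exact smul_ne_zero hε0.ne' (ne_zero_of_mem_unit_sphere u)⟩, by fun_prop⟩
    refine (hd.comp_right s).congr ?_ ?_
    · have hc (t : unitInterval) : 0 < (1 - (t : ℝ)) * r + t * ε := by
        rcases eq_or_lt_of_le t.2.1 with h | h
        · rw [← h]; simpa using hr
        · have h1 := mul_pos h hε0
          have := mul_nonneg (sub_nonneg.2 t.2.2) hr.le
          linarith
      have hmem (t : unitInterval) (u : Metric.sphere (0 : EuclideanSpace ℝ (Fin d)) 1) :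
          x + ((1 - (t : ℝ)) * r + t * ε) • u.1 ∈ f.source := by
        refine hx ?_
        rw [mem_closedBall_iff_norm, add_sub_cancel_left, norm_smul,
          Real.norm_of_nonneg (hc t).le, mem_sphere_zero_iff_norm.1 u.2, mul_one]
        have := mul_le_mul_of_nonneg_left (min_le_left r (δ / 2)) t.2.1
        linarith
      refine homotopic_subtype
        (fun q : unitInterval × Metric.sphere (0 : EuclideanSpace ℝ (Fin d)) 1 =>
          f (x + ((1 - (q.1 : ℝ)) * r + q.1 * ε) • q.2.1) - f x)
        ?_ (fun w => ?_) (fun w => ?_) (fun t w => ?_)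
      · refine Continuous.sub ?_ continuous_const
        exact f.continuousOn.comp_continuous (by fun_prop) fun q => hmem q.1 q.2
      · simp [sphereMap]
      · rw [ContinuousMap.comp_apply, hφ]
        simp [s]
      · intro h
        have h2 := f.injOn (hmem t w) hxs (sub_eq_zero.1 h)
        rw [add_eq_left] at h2
        exact smul_ne_zero (hc t).ne' (ne_zero_of_mem_unit_sphere w) h2
    · refine homotopic_subtype
        (fun q : unitInterval × Metric.sphere (0 : EuclideanSpace ℝ (Fin d)) 1 =>
          ((1 - (q.1 : ℝ)) * ε + q.1) • q.2.1) (by fun_prop) (fun w => ?_) (fun w => ?_)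
        (fun t w => ?_)
      · rw [ContinuousMap.comp_apply, hψ]
        simp [s]
      · simp [sphereInclusion]
      · refine smul_ne_zero (ne_of_gt ?_) (ne_zero_of_mem_unit_sphere w)
        rcases eq_or_lt_of_le t.2.1 with h | h
        · rw [← h]; simpa using hε0
        · have := mul_nonneg (sub_nonneg.2 t.2.2) hε0.le
          linarith

/-- For d ≥ 2 the homology degree d - 1 is positive, so unreduced homology agrees with the augmented
theory in index d. -/
theorem orientationPreserving_iff {d : ℕ} (hd : 2 ≤ d)
    (f : OpenPartialHomeomorph (EuclideanSpace ℝ (Fin d)) (EuclideanSpace ℝ (Fin d))) :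
    OrientationPreserving f ↔ ∀ x ∈ f.source, localDegree f x = 1 := by
  obtain ⟨k, rfl⟩ : ∃ k, d = k + 2 := ⟨d - 2, by omega⟩
  have hfin : Module.finrank ℝ (EuclideanSpace ℝ (Fin (k + 2))) = k + 2 := by simp
  have key (x : EuclideanSpace ℝ (Fin (k + 2))) (r : ℝ) (hr : 0 < r)
      (hx : Metric.closedBall x r ⊆ f.source) :
      homologyMap (k + 2 - 1) (sphereMap f x r hr hx) =
        homologyMap (k + 2 - 1) (sphereInclusion (k + 2)) ↔ localDegree f x = 1 := by
    refine (homologyMap_succ_eq_iff_degRel _ _ k).trans ?_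
    rw [degRel_sphereMap_iff]
    have h0 := (f.isLocalEmbeddingAt (hx (Metric.mem_closedBall_self hr.le))).hasLocalDegree
    constructor
    · intro h
      refine HasLocalDegree.localDegree_eq ?_
      rwa [hfin]
    · intro h
      rwa [h, hfin] at h0
  constructor
  · intro h x hx
    obtain ⟨r, hr, hrs⟩ := Metric.nhds_basis_closedBall.mem_iff.1 (f.open_source.mem_nhds hx)
    exact (key x r hr hrs).1 (h x r hr hrs)
  · intro h x r hr hx
    exact (key x r hr hx).2 (h x (hx (Metric.mem_closedBall_self hr.le)))

/-! ### Local degree of products of maps -/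

theorem isLocalEmbeddingAt_id {X : Type*} [TopologicalSpace X] (x : X) :
    IsLocalEmbeddingAt (fun y : X => y) x :=
  ⟨Set.univ, Filter.univ_mem, continuousOn_id, Set.injOn_id _⟩

theorem isLocalEmbeddingAt_pi {ι : Type*} [Finite ι] {X Y : ι → Type*}
    [∀ i, TopologicalSpace (X i)] [∀ i, TopologicalSpace (Y i)] {f : ∀ i, X i → Y i}
    {x : ∀ i, X i} (h : ∀ i, IsLocalEmbeddingAt (f i) (x i)) :
    IsLocalEmbeddingAt (fun y i => f i (y i)) x := by
  choose W hW hc hi using h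
  refine ⟨Set.univ.pi W, set_pi_mem_nhds Set.finite_univ fun i _ => hW i, ?_, ?_⟩
  · exact continuousOn_pi.2 fun i => (hc i).comp (continuous_apply i).continuousOn
      fun y hy => hy i trivial
  · exact fun y hy z hz h => funext fun i => hi i (hy i trivial) (hz i trivial) (congrFun h i)

theorem isLocalEmbeddingAt_comp_perm {ι X : Type*} [TopologicalSpace X] (σ : Equiv.Perm ι)
    (x : ι → X) : IsLocalEmbeddingAt (fun y : ι → X => y ∘ σ) x :=
  ⟨Set.univ, Filter.univ_mem, (continuous_pi fun i => continuous_apply (σ i)).continuousOn,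
    σ.surjective.injective_comp_right.injOn⟩

theorem isLocalEmbeddingAt_update {ι X : Type*} [Finite ι] [DecidableEq ι] [TopologicalSpace X]
    {f : X → X} {x : ι → X} {i : ι}
    (hf : IsLocalEmbeddingAt f (x i)) :
    IsLocalEmbeddingAt (fun y => Function.update y i (f (y i))) x := by
  have h := isLocalEmbeddingAt_pi (f := fun j y => if j = i then f y else y) (x := x) fun j => by
    by_cases hj : j = i
    · subst hj; simpa using hf
    · simpa [hj] using isLocalEmbeddingAt_id (x j)
  convert h using 1
  funext y j
  by_cases hj : j = i
  · subst hj; simp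
  · simp [hj]

section Pi

variable {ι E : Type} [Fintype ι] [DecidableEq ι] [NormedAddCommGroup E] [NormedSpace ℝ E]
  [FiniteDimensional ℝ E]

theorem localDegree_update {f : E → E} {x : ι → E} {i : ι} (hf : IsLocalEmbeddingAt f (x i)) :
    localDegree (fun y => Function.update y i (f (y i))) x = localDegree f (x i) := by
  let A : (ι → E) ≃L[ℝ] E × ({j // j ≠ i} → E) :=
    ({ Equiv.funSplitAt i E with
      map_add' := fun _ _ => rfl
      map_smul' := fun _ _ => rfl } : (ι → E) ≃ₗ[ℝ] E × ({j // j ≠ i} → E)).toContinuousLinearEquiv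
  have hA (y : ι → E) : A y = (y i, fun j => y j.1) := rfl
  rw [← localDegree_conj A (isLocalEmbeddingAt_update hf),
    ← localDegree_prod hf (fun j : {j // j ≠ i} => x j)]
  rw [hA]
  congr 1
  funext p
  have hp := A.apply_symm_apply p
  generalize A.symm p = q at hp
  subst hp
  refine Prod.ext ?_ ?_
  · simp [hA]
  · funext j
    simp [hA, Function.update_of_ne j.2]

/-- Apply the maps one coordinate at a time; each step is a composition with a map that changes a
single factor. -/
theorem localDegree_pi {f : ι → E → E} {x : ι → E} (h : ∀ i, IsLocalEmbeddingAt (f i) (x i)) :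
    localDegree (fun y i => f i (y i)) x = ∏ i, localDegree (f i) (x i) := by
  suffices H : ∀ s : Finset ι, localDegree (fun y i => if i ∈ s then f i (y i) else y i) x =
      ∏ i ∈ s, localDegree (f i) (x i) by simpa using H Finset.univ
  intro s
  induction s using Finset.induction_on with
  | empty => simpa using localDegree_id x
  | insert a s ha ih =>
    rw [Finset.prod_insert ha, ← ih]
    have h1 : IsLocalEmbeddingAt (fun (y : ι → E) i => if i ∈ s then f i (y i) else y i) x :=
      isLocalEmbeddingAt_pi (f := fun i y => if i ∈ s then f i y else y) fun i => by
        by_cases hi : i ∈ s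
        · simpa [hi] using h i
        · simpa [hi] using isLocalEmbeddingAt_id (x i)
    have hx : (if a ∈ s then f a (x a) else x a) = x a := if_neg ha
    have h2 := localDegree_comp (g := fun y => Function.update y a (f a (y a)))
      (isLocalEmbeddingAt_update (hx.symm ▸ h a)) h1
    rw [localDegree_update (hx.symm ▸ h a), hx] at h2
    rw [← h2]
    congr 1
    funext y i
    by_cases hi : i = a
    · subst hi; simp [ha]
    · simp [hi]

end Pi

/-! ### Oriented atlases -/

section Atlas

variable {E F : Type} [NormedAddCommGroup E] [NormedSpace ℝ E] [FiniteDimensional ℝ E]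
  [NormedAddCommGroup F] [NormedSpace ℝ F] [FiniteDimensional ℝ F]
  {X : Type*} [TopologicalSpace X]

/-- A family of charts which covers `X` and all of whose transition maps have local degree one. -/
structure IsOrientedAtlas (A : Set (OpenPartialHomeomorph X E)) : Prop where
  exists_mem_source (x : X) : ∃ φ ∈ A, x ∈ φ.source
  localDegree_eq_one {φ ψ : OpenPartialHomeomorph X E} (hφ : φ ∈ A) (hψ : ψ ∈ A) {x : X}
    (hxφ : x ∈ φ.source) (hxψ : x ∈ ψ.source) : localDegree (fun y => ψ (φ.symm y)) (φ x) = 1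

theorem OpenPartialHomeomorph.isLocalEmbeddingAt_symm_comp {Y Z : Type*} [TopologicalSpace Y]
    [TopologicalSpace Z] (φ : OpenPartialHomeomorph X Y) (ψ : OpenPartialHomeomorph X Z) {x : X}
    (hφ : x ∈ φ.source) (hψ : x ∈ ψ.source) :
    IsLocalEmbeddingAt (fun y => ψ (φ.symm y)) (φ x) := by
  refine IsLocalEmbeddingAt.comp ?_ (φ.symm.isLocalEmbeddingAt (φ.map_source hφ))
  rw [φ.left_inv hφ]
  exact ψ.isLocalEmbeddingAt hψ

theorem isOrientable_iff {d : ℕ} (hd : 2 ≤ d) :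
    IsOrientable d X ↔
      ∃ A : Set (OpenPartialHomeomorph X (EuclideanSpace ℝ (Fin d))), IsOrientedAtlas A := by
  refine exists_congr fun A => ⟨fun h => ⟨h.1, fun {φ ψ} hφ hψ x hx hx' => ?_⟩,
    fun h => ⟨h.1, fun φ hφ ψ hψ => ?_⟩⟩
  · refine (orientationPreserving_iff hd _).1 (h.2 φ hφ ψ hψ) (φ x) ?_
    simpa [hx] using hx'
  · refine (orientationPreserving_iff hd _).2 fun y hy => ?_
    obtain ⟨h1, h2⟩ : y ∈ φ.target ∧ φ.symm y ∈ ψ.source := by simpa using hy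
    have h3 := h.2 hφ hψ (φ.map_target h1) h2
    rwa [φ.right_inv h1] at h3

theorem IsOrientedAtlas.image {A : Set (OpenPartialHomeomorph X E)} (hA : IsOrientedAtlas A)
    (L : E ≃L[ℝ] F) :
    IsOrientedAtlas ((fun φ => φ.transHomeomorph L.toHomeomorph) '' A) where
  exists_mem_source x := by
    obtain ⟨φ, hφ, hx⟩ := hA.exists_mem_source x
    exact ⟨_, Set.mem_image_of_mem _ hφ, hx⟩
  localDegree_eq_one := by
    rintro _ _ ⟨φ, hφ, rfl⟩ ⟨ψ, hψ, rfl⟩ x hxφ hxψ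
    rw [← hA.localDegree_eq_one hφ hψ hxφ hxψ]
    exact localDegree_conj L (φ.isLocalEmbeddingAt_symm_comp ψ hxφ hxψ)

/-- This permits charts of the configuration space with values in (ℝ^d)^n in place of ℝ^(nd). -/
theorem exists_isOrientedAtlas_congr (h : Module.finrank ℝ E = Module.finrank ℝ F) :
    (∃ A : Set (OpenPartialHomeomorph X E), IsOrientedAtlas A) ↔
      ∃ A : Set (OpenPartialHomeomorph X F), IsOrientedAtlas A :=
  ⟨fun ⟨_, hA⟩ => ⟨_, hA.image (ContinuousLinearEquiv.ofFinrankEq h)⟩,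
    fun ⟨_, hA⟩ => ⟨_, hA.image (ContinuousLinearEquiv.ofFinrankEq h.symm)⟩⟩

open Classical in
/-- The local degree of a map `p : E → X` in the charts of an oriented atlas of `X`. -/
noncomputable def atlasDegree (A : Set (OpenPartialHomeomorph X E)) (p : E → X) (y : E) : ℤ :=
  if h : ∃ φ ∈ A, p y ∈ φ.source then localDegree (fun z => h.choose (p z)) y else 0

namespace IsOrientedAtlas

variable {A : Set (OpenPartialHomeomorph X E)} (hA : IsOrientedAtlas A) {p : E → X} {y : E}

include hA

/-- The arbitrary choice of chart is harmless: two charts of the atlas differ by a transition map of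
degree one. -/
theorem atlasDegree_eq (hp : IsLocalEmbeddingAt p y) {φ : OpenPartialHomeomorph X E} (hφ : φ ∈ A)
    (hy : p y ∈ φ.source) : atlasDegree A p y = localDegree (fun z => φ (p z)) y := by
  have h : ∃ φ ∈ A, p y ∈ φ.source := ⟨φ, hφ, hy⟩
  rw [atlasDegree, dif_pos h]
  obtain ⟨hψ, hyψ⟩ := h.choose_spec
  generalize h.choose = ψ at hψ hyψ
  have h1 := localDegree_comp (f := fun z => φ (p z)) (φ.isLocalEmbeddingAt_symm_comp ψ hy hyψ)
    (IsLocalEmbeddingAt.comp (φ.isLocalEmbeddingAt hy) hp)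
  rw [hA.localDegree_eq_one hφ hψ hy hyψ, one_mul] at h1
  rw [← h1]
  refine (localDegree_congr (IsLocalEmbeddingAt.comp (ψ.isLocalEmbeddingAt hyψ) hp) ?_)|>.symm
  filter_upwards [hp.continuousAt.eventually (φ.eventually_left_inverse hy)] with z hz
  rw [hz]

theorem atlasDegree_congr (hp : IsLocalEmbeddingAt p y) {q : E → X} (h : q =ᶠ[𝓝 y] p) :
    atlasDegree A q y = atlasDegree A p y := by
  obtain ⟨φ, hφ, hy⟩ := hA.exists_mem_source (p y)
  rw [hA.atlasDegree_eq hp hφ hy, hA.atlasDegree_eq (hp.congr h) hφ (by rwa [h.self_of_nhds])]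
  refine localDegree_congr (IsLocalEmbeddingAt.comp (φ.isLocalEmbeddingAt hy) hp) ?_
  filter_upwards [h] with z hz
  rw [hz]

theorem eventually_atlasDegree_eq (hp : IsLocalEmbeddingAt p y) :
    ∀ᶠ z in 𝓝 y, atlasDegree A p z = atlasDegree A p y := by
  obtain ⟨φ, hφ, hy⟩ := hA.exists_mem_source (p y)
  filter_upwards [hp.eventually, hp.continuousAt.eventually (φ.open_source.mem_nhds hy),
    eventually_localDegree_eq (IsLocalEmbeddingAt.comp (φ.isLocalEmbeddingAt hy) hp)]
    with z h1 h2 h3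
  rw [hA.atlasDegree_eq h1 hφ h2, hA.atlasDegree_eq hp hφ hy, h3]

theorem atlasDegree_comp {g : E → E} (hp : IsLocalEmbeddingAt p (g y))
    (hg : IsLocalEmbeddingAt g y) :
    atlasDegree A (fun z => p (g z)) y = atlasDegree A p (g y) * localDegree g y := by
  obtain ⟨φ, hφ, hy⟩ := hA.exists_mem_source (p (g y))
  rw [hA.atlasDegree_eq hp hφ hy, hA.atlasDegree_eq (hp.comp hg) hφ hy]
  exact localDegree_comp (g := fun z => φ (p z))
    (IsLocalEmbeddingAt.comp (φ.isLocalEmbeddingAt hy) hp) hg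

theorem atlasDegree_eq_or (e : OpenPartialHomeomorph E X) (hy : y ∈ e.source) :
    atlasDegree A e y = 1 ∨ atlasDegree A e y = -1 := by
  obtain ⟨φ, hφ, hy'⟩ := hA.exists_mem_source (e y)
  rw [hA.atlasDegree_eq (e.isLocalEmbeddingAt hy) hφ hy']
  exact (e.trans φ).localDegree_eq_or (by simp [hy, hy'])

end IsOrientedAtlas

end Atlas

/-! ### Charts onto the whole model space -/

section Manifold

variable {E : Type} [NormedAddCommGroup E] [NormedSpace ℝ E] {X : Type*} [TopologicalSpace X]
  [ChartedSpace E X]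

/-- Every neighbourhood in a manifold contains a chart onto the whole model space. -/
theorem exists_chart_target_eq_univ (x : X) {N : Set X} (hN : N ∈ 𝓝 x) :
    ∃ φ : OpenPartialHomeomorph X E, x ∈ φ.source ∧ φ.source ⊆ N ∧ φ.target = Set.univ := by
  have hx := mem_chart_source E x
  have h1 : (chartAt E x).target ∩ (chartAt E x).symm ⁻¹' N ∈ 𝓝 (chartAt E x x) := by
    refine Filter.inter_mem ((chartAt E x).open_target.mem_nhds (mem_chart_target E x)) ?_
    refine ((chartAt E x).continuousAt_symm (mem_chart_target E x)).preimage_mem_nhds ?_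
    rwa [(chartAt E x).left_inv hx]
  obtain ⟨r, hr, hrs⟩ := Metric.mem_nhds_iff.1 h1
  -- A small ball inside the image of the chart is stretched to the whole space.
  refine ⟨(chartAt E x).trans (OpenPartialHomeomorph.univBall (chartAt E x x) r).symm,
    ?_, ?_, ?_⟩
  · simp [OpenPartialHomeomorph.univBall_target _ hr, hr]
  · intro z hz
    obtain ⟨hz1, hz2⟩ : z ∈ (chartAt E x).source ∧
        chartAt E x z ∈ Metric.ball (chartAt E x x) r := by
      simpa [OpenPartialHomeomorph.univBall_target _ hr] using hz
    have := (hrs hz2).2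
    rwa [Set.mem_preimage, (chartAt E x).left_inv hz1] at this
  · refine Set.eq_univ_of_forall fun z => ?_
    have hz := (OpenPartialHomeomorph.univBall (chartAt E x x) r).map_source (x := z) (by simp)
    rw [OpenPartialHomeomorph.univBall_target _ hr] at hz
    simpa using (hrs hz).1

variable (E) in
theorem infinite_of_mem_nhds_chartedSpace [Nontrivial E] (x : X) {N : Set X}
    (hN : N ∈ 𝓝 x) : N.Infinite := by
  obtain ⟨φ, -, hφN, hφ⟩ := exists_chart_target_eq_univ (E := E) x hN
  have : Infinite E := Module.Free.infinite ℝ E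
  refine Set.Infinite.mono ?_ (Set.infinite_univ.image
    (φ.symm.injOn.mono (by rw [φ.symm_source, hφ])))
  rintro _ ⟨y, -, rfl⟩
  exact hφN (φ.map_target (hφ ▸ Set.mem_univ y))

end Manifold

/-! ### Charts of unordered configuration spaces -/

section Config

variable {M : Type*} {n : ℕ}

/-- The underlying unordered configuration of an ordered one. -/
def OrderedConfig.toUnordered (x : OrderedConfig M n) : UnorderedConfig M n :=
  Quotient.mk (configSetoid M n) x

theorem OrderedConfig.toUnordered_eq_iff {x y : OrderedConfig M n} :
    x.toUnordered = y.toUnordered ↔ ∃ σ : Equiv.Perm (Fin n), y.1 = x.1 ∘ σ :=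
  Quotient.eq.trans (exists_congr fun _ => funext_iff.symm)

open Classical in
/-- The unordered configuration with given labelled points (a junk value if two of them agree). -/
noncomputable def unorderedConfig [Nonempty (UnorderedConfig M n)] (x : Fin n → M) :
    UnorderedConfig M n :=
  if h : ∀ i j : Fin n, i ≠ j → x i ≠ x j then OrderedConfig.toUnordered ⟨x, h⟩
  else Classical.arbitrary _

theorem injective_iff_forall_ne {x : Fin n → M} :
    Function.Injective x ↔ ∀ i j : Fin n, i ≠ j → x i ≠ x j :=
  ⟨fun h _ _ => h.ne, fun h _ _ => not_imp_not.1 (h _ _)⟩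

theorem injective_of_mem_pi {U : Fin n → Set M} (hd : Pairwise (Function.onFun Disjoint U))
    {x : Fin n → M} (hx : x ∈ Set.univ.pi U) : Function.Injective x := fun i j hij => by
  by_contra h
  exact (hd h).le_bot ⟨hx i trivial, hij ▸ hx j trivial⟩

theorem exists_disjoint_open [TopologicalSpace M] [T2Space M] {x : Fin n → M}
    (hx : Function.Injective x) :
    ∃ U : Fin n → Set M, (∀ i, IsOpen (U i)) ∧ Pairwise (Function.onFun Disjoint U) ∧
      ∀ i, x i ∈ U i := by
  obtain ⟨U, hU, hd⟩ := (Set.finite_range x).t2_separation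
  exact ⟨U ∘ x, fun i => (hU _).2, fun i j h => hd ⟨i, rfl⟩ ⟨j, rfl⟩ (hx.ne h), fun i => (hU _).1⟩

variable [Nonempty (UnorderedConfig M n)]

theorem unorderedConfig_coe (x : OrderedConfig M n) :
    unorderedConfig x.1 = x.toUnordered := dif_pos x.2

theorem unorderedConfig_eq_iff {x y : Fin n → M} (hx : Function.Injective x)
    (hy : Function.Injective y) :
    unorderedConfig x = unorderedConfig y ↔ ∃ σ : Equiv.Perm (Fin n), y = x ∘ σ := by
  rw [injective_iff_forall_ne] at hx hy
  rw [unorderedConfig_coe ⟨x, hx⟩, unorderedConfig_coe ⟨y, hy⟩,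
    OrderedConfig.toUnordered_eq_iff]

theorem unorderedConfig_comp_perm (x : Fin n → M) (σ : Equiv.Perm (Fin n)) :
    unorderedConfig (x ∘ σ) = unorderedConfig x := by
  by_cases hx : Function.Injective x
  · exact ((unorderedConfig_eq_iff hx (hx.comp σ.injective)).2 ⟨σ, rfl⟩).symm
  · have hx' : ¬ Function.Injective (x ∘ σ) := by rwa [σ.injective_comp]
    rw [injective_iff_forall_ne] at hx hx'
    unfold unorderedConfig
    rw [dif_neg hx', dif_neg hx]

theorem exists_unorderedConfig_eq (b : UnorderedConfig M n) :
    ∃ x : Fin n → M, Function.Injective x ∧ unorderedConfig x = b := by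
  obtain ⟨x, rfl⟩ := Quotient.exists_rep b
  exact ⟨x.1, injective_iff_forall_ne.2 x.2, unorderedConfig_coe x⟩

/-- Disjointness makes the labels readable from the positions: a relabelling that moves a point
would put it in two of the sets at once. -/
theorem injOn_unorderedConfig {U : Fin n → Set M} (hd : Pairwise (Function.onFun Disjoint U)) :
    Set.InjOn (unorderedConfig (M := M) (n := n)) (Set.univ.pi U) := fun x hx y hy h => by
  obtain ⟨σ, rfl⟩ := (unorderedConfig_eq_iff (injective_of_mem_pi hd hx)
    (injective_of_mem_pi hd hy)).1 h
  funext i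
  by_contra hi
  refine (hd (i := i) (j := σ i) fun h => hi (congrArg x h)).le_bot ⟨hy i trivial, hx (σ i) trivial⟩

variable [TopologicalSpace M]

theorem continuousOn_unorderedConfig :
    ContinuousOn (unorderedConfig (M := M) (n := n)) {x | Function.Injective x} := by
  rw [continuousOn_iff_continuous_domRestrict]
  have h : Continuous fun x : {x : Fin n → M | Function.Injective x} =>
      OrderedConfig.toUnordered ⟨x.1, injective_iff_forall_ne.1 x.2⟩ :=
    continuous_quotient_mk'.comp (continuous_subtype_val.subtype_mk _)
  exact h.congr fun x => (unorderedConfig_coe ⟨x.1, injective_iff_forall_ne.1 x.2⟩).symm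

/-- The preimage in the ordered configuration space is the union of the relabellings of `S`. -/
theorem isOpen_image_unorderedConfig {S : Set (Fin n → M)} (hS : IsOpen S)
    (hi : ∀ x ∈ S, Function.Injective x) : IsOpen (unorderedConfig '' S) := by
  refine (isQuotientMap_quotient_mk' (s := configSetoid M n)).isOpen_preimage.1 ?_
  have h : OrderedConfig.toUnordered ⁻¹' (unorderedConfig '' S) =
      ⋃ σ : Equiv.Perm (Fin n), {x : OrderedConfig M n | x.1 ∘ σ ∈ S} := by
    ext x
    rw [Set.mem_preimage, ← unorderedConfig_coe, Set.mem_iUnion]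
    constructor
    · rintro ⟨y, hy, hyx⟩
      obtain ⟨σ, rfl⟩ := (unorderedConfig_eq_iff (injective_iff_forall_ne.2 x.2) (hi y hy)).1
        hyx.symm
      exact ⟨σ, hy⟩
    · rintro ⟨σ, hσ⟩
      exact ⟨_, hσ, unorderedConfig_comp_perm _ _⟩
  exact h ▸ isOpen_iUnion fun σ => hS.preimage
    (continuous_pi fun i => (continuous_apply (σ i)).comp continuous_subtype_val)

/-- The quotient map from ordered to unordered configurations, restricted to a product of disjoint
open sets, where it is a homeomorphism onto an open set. -/
noncomputable def configChart (U : Fin n → Set M) (hU : ∀ i, IsOpen (U i))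
    (hd : Pairwise (Function.onFun Disjoint U)) [Nonempty (Fin n → M)] :
    OpenPartialHomeomorph (Fin n → M) (UnorderedConfig M n) :=
  OpenPartialHomeomorph.ofContinuousOpenRestrict
    (injOn_unorderedConfig hd).bijOn_image.toPartialEquiv
    (continuousOn_unorderedConfig.mono fun _ hx => injective_of_mem_pi hd hx)
    (fun S hS => by
      have hopen := isOpen_set_pi Set.finite_univ fun i _ => hU i
      have h := isOpen_image_unorderedConfig (hopen.isOpenMap_subtype_val S hS) (by
        rintro _ ⟨x, -, rfl⟩
        exact injective_of_mem_pi hd x.2)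
      exact (congrArg IsOpen (Set.image_comp unorderedConfig Subtype.val S)).mpr h)
    (isOpen_set_pi Set.finite_univ fun i _ => hU i)

variable {E : Type} [NormedAddCommGroup E]

/-- The unordered configuration whose points have given coordinates in given charts. -/
noncomputable def configParam (φ : Fin n → OpenPartialHomeomorph M E) (y : Fin n → E) :
    UnorderedConfig M n := unorderedConfig fun i => (φ i).symm (y i)

variable {φ : Fin n → OpenPartialHomeomorph M E} {y : Fin n → E}

theorem exists_eq_configParam [T2Space M] (hy : ∀ i, y i ∈ (φ i).target)
    (hi : Function.Injective fun i => (φ i).symm (y i)) :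
    ∃ e : OpenPartialHomeomorph (Fin n → E) (UnorderedConfig M n),
      y ∈ e.source ∧ ⇑e = configParam φ := by
  obtain ⟨U, hU, hd, hyU⟩ := exists_disjoint_open hi
  have : Nonempty (Fin n → M) := ⟨fun i => (φ i).symm (y i)⟩
  refine ⟨(OpenPartialHomeomorph.pi φ).symm.trans (configChart U hU hd), ?_, rfl⟩
  rw [OpenPartialHomeomorph.trans_source]
  exact ⟨fun i _ => hy i, fun i _ => hyU i⟩

theorem isLocalEmbeddingAt_configParam [T2Space M] (hy : ∀ i, y i ∈ (φ i).target)
    (hi : Function.Injective fun i => (φ i).symm (y i)) :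
    IsLocalEmbeddingAt (configParam φ) y := by
  obtain ⟨e, he, he'⟩ := exists_eq_configParam hy hi
  exact he' ▸ e.isLocalEmbeddingAt he

theorem configParam_comp_perm (φ : OpenPartialHomeomorph M E) (y : Fin n → E)
    (σ : Equiv.Perm (Fin n)) :
    configParam (fun _ => φ) (y ∘ σ) = configParam (fun _ => φ) y :=
  unorderedConfig_comp_perm (fun i => φ.symm (y i)) σ

end Config

/-! ### Orientability of unordered configuration spaces -/

section ConfigOrientation

variable {M : Type*} [TopologicalSpace M] [T2Space M] {d n : ℕ}
  [Nonempty (UnorderedConfig M n)]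

/-- The charts of the unordered configuration space induced by an oriented atlas form an
oriented atlas if the dimension is even. -/
theorem IsOrientedAtlas.exists_config [Nonempty M]
    {A : Set (OpenPartialHomeomorph M (EuclideanSpace ℝ (Fin d)))} (hA : IsOrientedAtlas A)
    (hd : Even d) :
    ∃ B : Set (OpenPartialHomeomorph (UnorderedConfig M n) (Fin n → EuclideanSpace ℝ (Fin d))),
      IsOrientedAtlas B := by
  refine ⟨{Φ | ∃ (U : Fin n → Set M) (hU : ∀ i, IsOpen (U i))
    (hd : Pairwise (Function.onFun Disjoint U))
    (φ : Fin n → OpenPartialHomeomorph M (EuclideanSpace ℝ (Fin d))), (∀ i, φ i ∈ A) ∧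
      Φ = (configChart U hU hd).symm.trans (OpenPartialHomeomorph.pi φ)}, ?_, ?_⟩
  · intro b
    obtain ⟨x, hx, rfl⟩ := exists_unorderedConfig_eq b
    obtain ⟨U, hU, hUd, hxU⟩ := exists_disjoint_open hx
    choose φ hφ hxφ using fun i => hA.exists_mem_source (x i)
    refine ⟨_, ⟨U, hU, hUd, φ, hφ, rfl⟩, ?_⟩
    have hxs : x ∈ (configChart U hU hUd).source := fun i _ => hxU i
    rw [OpenPartialHomeomorph.trans_source]
    refine ⟨(configChart U hU hUd).map_source hxs, ?_⟩
    rw [Set.mem_preimage]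
    exact ((configChart U hU hUd).left_inv hxs).symm ▸ fun i _ => hxφ i
  · rintro _ _ ⟨U, hU, hUd, φ, hφ, rfl⟩ ⟨V, hV, hVd, ψ, hψ, rfl⟩ b hb hb'
    obtain ⟨hb1, hb2⟩ := hb
    obtain ⟨hb1', hb2'⟩ := hb'
    set e₁ := configChart U hU hUd with he₁
    set e₂ := configChart V hV hVd with he₂
    have hx := e₁.map_target hb1
    have hx' := e₂.map_target hb1'
    have hxb : e₁ (e₁.symm b) = b := e₁.right_inv hb1
    have hxb' : e₂ (e₂.symm b) = b := e₂.right_inv hb1'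
    have hbφ : e₁.symm b ∈ (OpenPartialHomeomorph.pi φ).source := hb2
    have hb3 (i) : e₁.symm b i ∈ (φ i).source := hb2 i trivial
    have hb3' (i) : e₂.symm b i ∈ (ψ i).source := hb2' i trivial
    change localDegree (fun y => OpenPartialHomeomorph.pi ψ (e₂.symm (e₁
      ((OpenPartialHomeomorph.pi φ).symm y)))) (OpenPartialHomeomorph.pi φ (e₁.symm b)) = 1
    generalize e₁.symm b = x at *
    generalize e₂.symm b = x' at *
    obtain ⟨σ, rfl⟩ := (unorderedConfig_eq_iff (injective_of_mem_pi hUd hx)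
      (injective_of_mem_pi hVd hx')).1 (hxb.trans hxb'.symm)
    set y₀ := OpenPartialHomeomorph.pi φ x with hy₀
    have hφy : (OpenPartialHomeomorph.pi φ).symm y₀ = x :=
      (OpenPartialHomeomorph.pi φ).left_inv hbφ
    -- The relabelling σ was found at `b` only; by continuity it stays valid nearby, so the
    -- transition map is locally the block permutation σ followed by a product of transition maps of
    -- `M`.
    have h1 : ∀ᶠ y in 𝓝 y₀, (OpenPartialHomeomorph.pi φ).symm y ∘ σ ∈ e₂.source := by
      have hc : ContinuousAt (fun y => (OpenPartialHomeomorph.pi φ).symm y ∘ σ) y₀ :=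
        (continuous_pi fun i => continuous_apply (σ i)).continuousAt.comp
          ((OpenPartialHomeomorph.pi φ).continuousAt_symm
            ((OpenPartialHomeomorph.pi φ).map_source hbφ))
      refine hc.eventually (e₂.open_source.mem_nhds ?_)
      change (OpenPartialHomeomorph.pi φ).symm y₀ ∘ σ ∈ _
      rwa [hφy]
    have h2 (i : Fin n) : IsLocalEmbeddingAt (fun t => ψ i ((φ (σ i)).symm t)) ((y₀ ∘ σ) i) :=
      (φ (σ i)).isLocalEmbeddingAt_symm_comp (ψ i) (hb3 (σ i)) (hb3' i)
    have h3 : IsLocalEmbeddingAt (fun (y : Fin n → EuclideanSpace ℝ (Fin d)) i =>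
        ψ i ((φ (σ i)).symm ((y ∘ σ) i))) y₀ :=
      (isLocalEmbeddingAt_pi h2).comp (f := fun y => y ∘ σ) (isLocalEmbeddingAt_comp_perm σ y₀)
    have h4 : (fun y => OpenPartialHomeomorph.pi ψ (e₂.symm (e₁
        ((OpenPartialHomeomorph.pi φ).symm y)))) =ᶠ[𝓝 y₀]
          fun y i => ψ i ((φ (σ i)).symm ((y ∘ σ) i)) := by
      filter_upwards [h1] with y hy
      have h5 : e₁ ((OpenPartialHomeomorph.pi φ).symm y) =
          e₂ ((OpenPartialHomeomorph.pi φ).symm y ∘ σ) :=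
        (unorderedConfig_comp_perm _ σ).symm
      rw [h5, e₂.left_inv hy]
      rfl
    have h6 : ∏ i, localDegree (fun t => ψ i ((φ (σ i)).symm t)) ((y₀ ∘ σ) i) = 1 :=
      Finset.prod_eq_one fun i _ =>
        hA.localDegree_eq_one (hφ (σ i)) (hψ i) (hb3 (σ i)) (hb3' i)
    rw [localDegree_congr h3 h4]
    refine (localDegree_comp (isLocalEmbeddingAt_pi h2)
      (isLocalEmbeddingAt_comp_perm σ y₀)).trans ?_
    rw [localDegree_pi h2, localDegree_block_perm, h6, one_mul]
    obtain ⟨k, rfl⟩ := hd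
    rw [← two_mul, pow_mul, ← Units.val_pow_eq_pow_val, Int.units_sq, Units.val_one, one_pow]

end ConfigOrientation

/-! ### Evenness of the dimension -/

section EvenDimension

variable {M : Type*} [TopologicalSpace M] [T2Space M] {d m : ℕ}

/-- Local constancy is continuity into the discrete topology. -/
theorem IsPreconnected.eq_of_eventually_eq {X Y : Type*} [TopologicalSpace X] {s : Set X}
    (hs : IsPreconnected s) {f : X → Y} (hf : ∀ x ∈ s, ∀ᶠ y in 𝓝 x, f y = f x) {x y : X}
    (hx : x ∈ s) (hy : y ∈ s) : f x = f y := by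
  let _ : TopologicalSpace Y := ⊥
  have : DiscreteTopology Y := ⟨rfl⟩
  exact hs.constant (fun z hz => ((continuousAt_const (y := f z)).congr
    ((hf z hz).mono fun _ h => h.symm)).continuousWithinAt) hx hy

/-- Exchanging two nearby points along a path preserves the sign by continuity, and multiplies it by
(-1)^d by the chain rule. -/
theorem IsOrientedAtlas.even_of_config [Nonempty M] [ChartedSpace (EuclideanSpace ℝ (Fin d)) M]
    [Nonempty (UnorderedConfig M (m + 2))] (hd : 2 ≤ d)
    {B : Set (OpenPartialHomeomorph (UnorderedConfig M (m + 2))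
      (Fin (m + 2) → EuclideanSpace ℝ (Fin d)))} (hB : IsOrientedAtlas B) : Even d := by
  have hrank : 1 < Module.rank ℝ (EuclideanSpace ℝ (Fin d)) := by
    rw [← Module.finrank_eq_rank, finrank_euclideanSpace_fin]
    exact_mod_cast hd
  have : Nontrivial (EuclideanSpace ℝ (Fin d)) :=
    Module.nontrivial_of_finrank_pos (R := ℝ) (by rw [finrank_euclideanSpace_fin]; omega)
  obtain ⟨φ, -, -, hφ⟩ := exists_chart_target_eq_univ (E := EuclideanSpace ℝ (Fin d))
    (Classical.arbitrary M) Filter.univ_mem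
  obtain ⟨e, he⟩ := exists_norm_eq (EuclideanSpace ℝ (Fin d)) zero_le_one
  -- The remaining points (j + 2) e have norm at least 2, so they never meet ±v on the unit sphere.
  let Y (v : EuclideanSpace ℝ (Fin d)) : Fin (m + 2) → EuclideanSpace ℝ (Fin d) :=
    Fin.cons v (Fin.cons (-v) fun j : Fin m => ((j : ℝ) + 2) • e)
  have hYc : Continuous Y := by
    refine continuous_pi (Fin.cases continuous_id (Fin.cases continuous_neg fun j => ?_))
    exact continuous_const
  have hYi (v : EuclideanSpace ℝ (Fin d)) (hv : ‖v‖ = 1) : Function.Injective (Y v) := by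
    have hj (j : Fin m) : 1 < ‖((j : ℝ) + 2) • e‖ := by
      rw [norm_smul, he, mul_one, Real.norm_of_nonneg (by positivity)]
      have : (0 : ℝ) ≤ j := by positivity
      linarith
    refine Fin.cons_injective_iff.2 ⟨?_, Fin.cons_injective_iff.2 ⟨?_, fun i j hij => ?_⟩⟩
    · rintro ⟨j, hjv⟩
      revert hjv
      refine Fin.cases (fun h => ?_) (fun j h => ?_) j
      · have h0 : v + v = 0 := by
          nth_rewrite 1 [← show -v = v from h]
          exact neg_add_cancel v
        rw [← two_smul ℝ, smul_eq_zero_iff_right two_ne_zero] at h0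
        simp [h0] at hv
      · exact (hj j).ne' (by rw [← hv, ← h]; rfl)
    · rintro ⟨j, h⟩
      exact (hj j).ne' (by rw [← hv, ← norm_neg v, ← h])
    · have he0 : e ≠ 0 := by rintro rfl; simp at he
      have h := smul_left_injective ℝ he0 hij
      exact Fin.ext (by exact_mod_cast add_right_cancel h)
  have hYn (v : EuclideanSpace ℝ (Fin d)) : Y (-v) = Y v ∘ Equiv.swap 0 1 := by
    funext i
    refine Fin.cases ?_ (fun i => Fin.cases ?_ (fun i => ?_) i) i
    · rw [Function.comp_apply, Equiv.swap_apply_left]; rfl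
    · have h : (Fin.succ 0 : Fin (m + 2)) = 1 := rfl
      rw [h, Function.comp_apply, Equiv.swap_apply_right]
      exact neg_neg v
    · rw [Function.comp_apply, Equiv.swap_apply_of_ne_of_ne (Fin.succ_ne_zero _)
        (show i.succ.succ ≠ 1 from fun h => Fin.succ_ne_zero i (Fin.succ_injective _ h))]
      rfl
  have ht (y : Fin (m + 2) → EuclideanSpace ℝ (Fin d)) (i) : y i ∈ φ.target := hφ ▸ Set.mem_univ _
  have hi {y : Fin (m + 2) → EuclideanSpace ℝ (Fin d)} (hy : Function.Injective y) :
      Function.Injective fun i => φ.symm (y i) := fun i j hij =>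
    hy (φ.symm.injOn (ht y i) (ht y j) hij)
  have hp {y : Fin (m + 2) → EuclideanSpace ℝ (Fin d)} (hy : Function.Injective y) :
      IsLocalEmbeddingAt (configParam (n := m + 2) fun _ => φ) y :=
    isLocalEmbeddingAt_configParam (ht y) (hi hy)
  have hconst := (isPreconnected_sphere hrank 0 1).eq_of_eventually_eq
    (f := fun v => atlasDegree B (configParam fun _ => φ) (Y v)) (fun v hv =>
      hYc.continuousAt.eventually (hB.eventually_atlasDegree_eq
        (hp (hYi v (mem_sphere_zero_iff_norm.1 hv)))))
    (x := e) (y := -e) (by simpa using he) (by simpa using he)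
  simp only [hYn] at hconst
  have hYe := hYi e he
  have hcomp := hB.atlasDegree_comp (g := fun y => y ∘ Equiv.swap 0 1)
    (hp (hYe.comp (Equiv.swap 0 1).injective)) (isLocalEmbeddingAt_comp_perm _ (Y e))
  -- The parametrization uses the same chart for every label, hence is unchanged by the swap; only
  -- the degree of the swap remains.
  simp only [configParam_comp_perm] at hcomp
  rw [← hconst, localDegree_block_perm, Equiv.Perm.sign_swap (by simp)] at hcomp
  obtain ⟨e', he', hee⟩ := exists_eq_configParam (ht (Y e)) (hi hYe)
  have hone := hB.atlasDegree_eq_or e' he'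
  rw [hee] at hone
  have hpow : (-1 : ℤ) ^ d = 1 := by
    rcases hone with h | h <;> rw [h] at hcomp <;> simpa using hcomp.symm
  exact (neg_one_pow_eq_one_iff_even (by norm_num)).1 hpow

end EvenDimension

/-! ### Orienting the manifold from its configuration space -/

section OrientationOfFactor

variable {M : Type*} [TopologicalSpace M] {E : Type} [NormedAddCommGroup E]
  {m : ℕ} {w : Fin m → M} {ψ : Fin m → OpenPartialHomeomorph M E}
  {φ φ' : OpenPartialHomeomorph M E}

theorem cons_mem_target (hψ : ∀ j, w j ∈ (ψ j).source) {z : E} (hz : z ∈ φ.target)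
    (i : Fin (m + 1)) :
    (Fin.cons z fun j => ψ j (w j) : Fin (m + 1) → E) i ∈
      ((Fin.cons φ ψ : Fin (m + 1) → OpenPartialHomeomorph M E) i).target :=
  Fin.cases hz (fun j => (ψ j).map_source (hψ j)) i

theorem injective_cons_symm (hw : Function.Injective w) (hψ : ∀ j, w j ∈ (ψ j).source) {z : E}
    (hzw : φ.symm z ∉ Set.range w) :
    Function.Injective fun i => ((Fin.cons φ ψ : Fin (m + 1) → OpenPartialHomeomorph M E) i).symm
      ((Fin.cons z fun j => ψ j (w j) : Fin (m + 1) → E) i) := by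
  convert Fin.cons_injective_iff.2 ⟨hzw, hw⟩ using 1
  funext i
  exact Fin.cases rfl (fun j => (ψ j).left_inv (hψ j)) i

variable [T2Space M] [Nonempty (UnorderedConfig M (m + 1))]

theorem isLocalEmbeddingAt_cons (hw : Function.Injective w) (hψ : ∀ j, w j ∈ (ψ j).source) {z : E}
    (hz : z ∈ φ.target) (hzw : φ.symm z ∉ Set.range w) :
    IsLocalEmbeddingAt (configParam (n := m + 1) (Fin.cons φ ψ)) (Fin.cons z fun j => ψ j (w j)) :=
  isLocalEmbeddingAt_configParam (cons_mem_target hψ hz) (injective_cons_symm hw hψ hzw)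

variable [NormedSpace ℝ E] [FiniteDimensional ℝ E]

/-- The degree, with respect to charts of the space of unordered configurations, of moving one
point through the chart `φ` while the other points stay near `w` in the charts `ψ`. -/
noncomputable def pointDegree (B : Set (OpenPartialHomeomorph (UnorderedConfig M (m + 1))
    (Fin (m + 1) → E))) (w : Fin m → M) (ψ : Fin m → OpenPartialHomeomorph M E)
    (φ : OpenPartialHomeomorph M E) (z : E) : ℤ :=
  atlasDegree B (configParam (Fin.cons φ ψ)) (Fin.cons z fun j => ψ j (w j))

namespace IsOrientedAtlas

variable {B : Set (OpenPartialHomeomorph (UnorderedConfig M (m + 1)) (Fin (m + 1) → E))}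
  (hB : IsOrientedAtlas B) (hw : Function.Injective w) (hψ : ∀ j, w j ∈ (ψ j).source)

include hB hw hψ

theorem pointDegree_eq_or {z : E} (hz : z ∈ φ.target) (hzw : φ.symm z ∉ Set.range w) :
    pointDegree B w ψ φ z = 1 ∨ pointDegree B w ψ φ z = -1 := by
  obtain ⟨e, he, hee⟩ := exists_eq_configParam (cons_mem_target hψ hz)
    (injective_cons_symm hw hψ hzw)
  have h := hB.atlasDegree_eq_or e he
  rwa [hee] at h

theorem eventually_pointDegree_eq {z : E} (hz : z ∈ φ.target) (hzw : φ.symm z ∉ Set.range w) :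
    ∀ᶠ z' in 𝓝 z, pointDegree B w ψ φ z' = pointDegree B w ψ φ z := by
  have hc : Continuous fun z : E => (Fin.cons z fun j => ψ j (w j) : Fin (m + 1) → E) :=
    continuous_pi (Fin.cases continuous_id fun j => continuous_const)
  exact hc.continuousAt.eventually
    (hB.eventually_atlasDegree_eq (isLocalEmbeddingAt_cons hw hψ hz hzw))

/-- Changing the chart of the moving point composes the parametrization, near the given point, with
a product map that is the identity on all other factors. -/
theorem pointDegree_mul {x : M} (hx : x ∈ φ.source) (hx' : x ∈ φ'.source) (hxw : x ∉ Set.range w) :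
    pointDegree B w ψ φ' (φ' x) =
      pointDegree B w ψ φ (φ x) * localDegree (fun z => φ (φ'.symm z)) (φ' x) := by
  let g : Fin (m + 1) → E → E := Fin.cons (fun z => φ (φ'.symm z)) fun _ z => z
  let y' : Fin (m + 1) → E := Fin.cons (φ' x) fun j => ψ j (w j)
  have hg (i) : IsLocalEmbeddingAt (g i) (y' i) :=
    Fin.cases (φ'.isLocalEmbeddingAt_symm_comp φ hx' hx) (fun j => isLocalEmbeddingAt_id _) i
  have hgy : (fun i => g i (y' i)) = Fin.cons (φ x) fun j => ψ j (w j) := by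
    funext i
    exact Fin.cases (congrArg φ (φ'.left_inv hx')) (fun j => rfl) i
  have h1 : IsLocalEmbeddingAt (configParam (n := m + 1) (Fin.cons φ ψ)) fun i => g i (y' i) := by
    rw [hgy]
    exact isLocalEmbeddingAt_cons hw hψ (φ.map_source hx) (by rwa [φ.left_inv hx])
  have h2 : configParam (n := m + 1) (Fin.cons φ' ψ) =ᶠ[𝓝 y']
      fun y => configParam (n := m + 1) (Fin.cons φ ψ) fun i => g i (y i) := by
    have h3 : ∀ᶠ z in 𝓝 (φ' x), φ.symm (φ (φ'.symm z)) = φ'.symm z := by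
      refine (φ'.continuousAt_symm (φ'.map_source hx')).eventually (φ.eventually_left_inverse ?_)
      rwa [φ'.left_inv hx']
    filter_upwards [(continuous_apply (0 : Fin (m + 1))).continuousAt.eventually h3] with y hy
    refine congrArg unorderedConfig (funext fun i => ?_)
    exact Fin.cases hy.symm (fun j => rfl) i
  have h4 := hB.atlasDegree_comp h1 (isLocalEmbeddingAt_pi hg)
  have h5 : ∏ j, localDegree (g (Fin.succ j)) (y' (Fin.succ j)) = 1 :=
    Finset.prod_eq_one fun j _ => localDegree_id (y' (Fin.succ j))
  rw [← hB.atlasDegree_congr (IsLocalEmbeddingAt.comp h1 (isLocalEmbeddingAt_pi hg)) h2,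
    localDegree_pi hg, Fin.prod_univ_succ, hgy,
    h5, mul_one] at h4
  exact h4

omit hw hψ in
theorem exists_of_config [ChartedSpace E M] [Nonempty M] (hE : 1 < Module.rank ℝ E) :
    ∃ A : Set (OpenPartialHomeomorph M E), IsOrientedAtlas A := by
  have hpos : 0 < Module.finrank ℝ E := by
    have h := hE
    rw [← Module.finrank_eq_rank] at h
    exact zero_lt_one.trans (by exact_mod_cast h)
  have : Nontrivial E := Module.nontrivial_of_finrank_pos (R := ℝ) hpos
  have : Infinite M := Set.infinite_univ_iff.1
    (infinite_of_mem_nhds_chartedSpace E (Classical.arbitrary M) Filter.univ_mem)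
  obtain ⟨w, hw⟩ : ∃ w : Fin m → M, Function.Injective w :=
    ⟨_, (Infinite.natEmbedding M).injective.comp Fin.val_injective⟩
  obtain ⟨ψ, hψ⟩ : ∃ ψ : Fin m → OpenPartialHomeomorph M E, ∀ j, w j ∈ (ψ j).source :=
    ⟨_, fun j => mem_chart_source E (w j)⟩
  -- Positivity is tested only off the frozen points, where the configuration has no collision.
  refine ⟨{φ | ∀ x ∈ φ.source, x ∉ Set.range w → pointDegree B w ψ φ (φ x) = 1}, ?_, ?_⟩
  · intro x
    -- The chart is chosen to avoid all frozen points other than possibly `x`, so at most one point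
    -- has to be deleted from its target.
    have hN : (Set.range w \ {x})ᶜ ∈ 𝓝 x :=
      ((Set.finite_range w).subset Set.sdiff_subset).isClosed.isOpen_compl.mem_nhds (by simp)
    obtain ⟨φ, hx, hφN, hφ⟩ := exists_chart_target_eq_univ (E := E) x hN
    have ht (z : E) : z ∈ φ.target := hφ ▸ Set.mem_univ z
    -- The set lies between the complement of one point, connected in dimension at least 2, and its
    -- closure.
    have hT : IsPreconnected {z | φ.symm z ∉ Set.range w} := by
      refine (isConnected_compl_singleton_of_one_lt_rank hE (φ x)).isPreconnected.subset_closure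
        (fun z hz hzw => hz ?_) fun z _ => (dense_compl_singleton (φ x)).closure_eq ▸ Set.mem_univ z
      have h1 : φ.symm z = x := not_not.1 fun h => hφN (φ.map_target (ht z)) ⟨hzw, h⟩
      rw [Set.mem_singleton_iff, ← h1, φ.right_inv (ht z)]
    have hconst {z z' : E} (hz : φ.symm z ∉ Set.range w) (hz' : φ.symm z' ∉ Set.range w) :
        pointDegree B w ψ φ z = pointDegree B w ψ φ z' :=
      hT.eq_of_eventually_eq (fun y hy => hB.eventually_pointDegree_eq hw hψ (ht y) hy) hz hz'
    by_cases hone : ∀ z, φ.symm z ∉ Set.range w → pointDegree B w ψ φ z = 1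
    · exact ⟨φ, fun y hy hyw => hone _ (by rwa [φ.left_inv hy]), hx⟩
    · push Not at hone
      obtain ⟨z, hz, hz1⟩ := hone
      have hz2 := (hB.pointDegree_eq_or hw hψ (ht z) hz).resolve_left hz1
      obtain ⟨R, hR⟩ := exists_localDegree_eq_neg_one hpos
      -- The sign is constantly -1 on this chart, and composing with a map of degree -1 makes the
      -- chart positive.
      refine ⟨φ.transHomeomorph R.toHomeomorph, fun y hy hyw => ?_, hx⟩
      have h1 := hB.pointDegree_mul hw hψ (φ := φ.transHomeomorph R.toHomeomorph) (φ' := φ)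
        hy hy hyw
      have h2 : (fun z => φ.transHomeomorph R.toHomeomorph (φ.symm z)) = R :=
        funext fun z => congrArg R (φ.right_inv (ht z))
      rw [hconst (z' := z) (by rwa [φ.left_inv hy]) hz, hz2, h2, hR] at h1
      linarith
  · intro φ φ' hφ hφ' x hx hx'
    have h1 := φ.isLocalEmbeddingAt_symm_comp φ' hx hx'
    -- If `x` is a frozen point the signs say nothing at `x`; the transition degree is read off at a
    -- nearby point that is not frozen.
    have h2 := ((φ.continuousAt hx).eventually (eventually_localDegree_eq h1)).and
      ((φ.open_source.eventually_mem hx).and (φ'.open_source.eventually_mem hx'))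
    obtain ⟨y, ⟨hy, hyφ, hyφ'⟩, hyw⟩ :=
      (infinite_of_mem_nhds_chartedSpace E x h2).exists_notMem_finite (Set.finite_range w)
    have h3 := hB.pointDegree_mul hw hψ (φ := φ') (φ' := φ) hyφ' hyφ hyw
    rw [hφ y hyφ hyw, hφ' y hyφ' hyw, one_mul, hy] at h3
    exact h3.symm

end IsOrientedAtlas

end OrientationOfFactor

/-- `M` is a nonempty topological manifold (without boundary) of dimension `d ≥ 2`; then `B(M, n)`
is a manifold of dimension `n * d`. Neither connectedness nor second countability is required. -/
theorem lemma2p3 {M : Type*} [TopologicalSpace M] [T2Space M] [Nonempty M] (d n : ℕ)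
    [ChartedSpace (EuclideanSpace ℝ (Fin d)) M] (hd : 2 ≤ d) (hn : 2 ≤ n) :
    IsOrientable (n * d) (UnorderedConfig M n) ↔ IsOrientable d M ∧ Even d := by
  have hfin : Module.finrank ℝ (EuclideanSpace ℝ (Fin (n * d))) =
      Module.finrank ℝ (Fin n → EuclideanSpace ℝ (Fin d)) := by
    rw [Module.finrank_pi_fintype]
    simp
  have hrank : 1 < Module.rank ℝ (EuclideanSpace ℝ (Fin d)) := by
    rw [← Module.finrank_eq_rank, finrank_euclideanSpace_fin]
    exact_mod_cast hd
  have : Nontrivial (EuclideanSpace ℝ (Fin d)) :=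
    Module.nontrivial_of_finrank_pos (R := ℝ) (by rw [finrank_euclideanSpace_fin]; omega)
  have : Infinite M := Set.infinite_univ_iff.1 (infinite_of_mem_nhds_chartedSpace
    (EuclideanSpace ℝ (Fin d)) (Classical.arbitrary M) Filter.univ_mem)
  -- An infinite `M` contains n distinct points; this supplies the default value in
  -- `unorderedConfig`.
  have : Nonempty (UnorderedConfig M n) := ⟨OrderedConfig.toUnordered
    ⟨_, injective_iff_forall_ne.1 ((Infinite.natEmbedding M).injective.comp Fin.val_injective)⟩⟩
  rw [isOrientable_iff hd, isOrientable_iff (by nlinarith), exists_isOrientedAtlas_congr hfin]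
  constructor
  · rintro ⟨B, hB⟩
    obtain ⟨m, rfl⟩ : ∃ m, n = m + 2 := ⟨n - 2, by omega⟩
    exact ⟨hB.exists_of_config hrank, hB.even_of_config hd⟩
  · rintro ⟨⟨A, hA⟩, heven⟩
    exact hA.exists_config heven
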